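/- Let $n\in\{1,2,\dots\}$ or $n=\infty$ (with $\mathbb C^\infty:=\ell^2$), and let $\mathcal H$ be a separable infinite-dimensional complex Hilbert space. Let $$[B(\mathcal H)^n]_1=\{X=[X_1,\dots,X_n]:\ \|X\|<1\},$$ where $X$ is viewed as a bounded row operator $\mathcal H^{(n)}\to\mathcal H$, so that $\|X\|=\|\sum_i X_iX_i^*\|^{1/2}$. Let $\mathbb F_n^+$ be the free unital semigroup on $g_1,\dots,g_n$. For $\alpha=g_{i_1}\cdots g_{i_k}$ put $|\alpha|=k$ and $X_\alpha=X_{i_1}\cdots X_{i_k}$. A map $\Psi=(\Psi_j)_j:[B(\mathcal H)^n]_1\to[B(\mathcal H)^n]_1$ is *free holomorphic* if for each $j$ there are scalars $a^{(j)}_\alpha$ with $\Psi_j(X)=\sum_{k\ge0}\sum_{|\alpha|=k}a^{(j)}_\alpha X_\alpha$, convergent in operator norm, for all $X\in[B(\mathcal H)^n]_1$. Let $Aut(B(\mathcal H)^n_1)$ be the set of free holomorphic bijections of $[B(\mathcal H)^n]_1$ with free holomorphic inverse, and $Aut(\mathbb B_n)$ the group of biholomorphic self-maps of the open unit ball $\mathbb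 B_n$ of $\mathbb C^n$. Let $S_1,\dots,S_n$ be the left creation operators on the full Fock space $F^2$ with orthonormal basis $(e_\alpha)_{\alpha\in\mathbb F_n^+}$, $S_ie_\alpha=e_{g_i\alpha}$. The *boundary function* of $\Psi$ is $\hat\Psi=(\hat\Psi_j)_j$ with $\hat\Psi_j=\text{SOT-}\lim_{r\to1^-}\Psi_j(rS_1,\dots,rS_n)$, where $\Psi_j$ is evaluated through its power series. For $z\in\mathbb B_n$ the *noncommutative Poisson transform* is $P_z[f]=\lim_{r\to1^-}\langle fK_{z,r},K_{z,r}\rangle$, where $K_{z,r}=\sum_\alpha r^{|\alpha|}(1-r^2\|z\|^2)^{1/2}\,\overline{z_\alpha}\,e_\alpha\in F^2$. **Theorem.** $Aut(B(\mathcal H)^n_1)$ is a group under composition, every $\Psi\in Aut(B(\mathcal H)^n_1)$ has a (unique) boundary function $\hat\Psi$, and the map $$\Gamma:Aut(B(\mathcal H)^n_1)\to Aut(\mathbb B_n),\qquad [\Gamma(\Psi)](z):=(P_z\otimes\mathrm{id})[\hat\Psi]=(P_z[\hat\Psi_j])_j,\quad z\in\mathbb B_n,$$ is well defined (the limits exist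 and $\Gamma(\Psi)\in Aut(\mathbb B_n)$) and is a group isomorphism. Moreover, for every unitary operator $U=[u_{ij}]$ on $\mathbb C^n$ and every $\lambda\in\mathbb B_n$, the map $\Phi_U\circ\Psi_\lambda$ belongs to $Aut(B(\mathcal H)^n_1)$ and $$[\Gamma(\Phi_U\circ\Psi_\lambda)](z)=\varphi_\lambda(z)\,U,\qquad z\in\mathbb B_n.$$ Here $\Phi_U(X)=[X_1,\dots,X_n]U=\big[\sum_i u_{ij}X_i\big]_j$, and $$\Psi_\lambda(X)=\lambda-\Delta_\lambda\Big(I-\sum_i\bar\lambda_iX_i\Big)^{-1}[X_1,\dots,X_n]\,\Delta_{\lambda^*},$$ where $\lambda$ stands for $[\lambda_1I,\dots,\lambda_nI]$, $\Delta_\lambda=(I-\lambda\lambda^*)^{1/2}$ and $\Delta_{\lambda^*}=(I-\lambda^*\lambda)^{1/2}$. Finally $$\varphi_\lambda(z)=\frac{\lambda-Q_\lambda z-(1-\|\lambda\|^2)^{1/2}(I-Q_\lambda)z}{1-\langle z,\lambda\rangle},$$ where $Q_\lambda$ is the orthogonal projection onto $\mathbb C\lambda$ ($Q_0=0$), and $zU$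 denotes the vector with coordinates $(zU)_j=\sum_i z_iu_{ij}$. -/

import Mathlib

noncomputable section

/-- The Hilbert space `ℂⁿ` with orthonormal basis indexed by `ι` (square summable families). For
`ι = Fin n` this is `ℂⁿ`, for `ι = ℕ` it is the case `n = ∞`. -/
abbrev EllTwo (ι : Type*) : Type _ := lp (fun _ : ι => ℂ) 2

/-- The Hilbert space `H⁽ⁿ⁾`, the direct sum of `n` copies of `H`. -/
abbrev Ampl (ι : Type*) (H : Type*) [NormedAddCommGroup H] : Type _ := lp (fun _ : ι => H) 2

/-- The standard basis vector `e_i`. -/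
def basisVec {ι : Type*} (i : ι) : EllTwo ι :=
  letI := Classical.decEq ι
  lp.single 2 i (1 : ℂ)

theorem orthonormal_basisVec {ι : Type*} : Orthonormal ℂ (basisVec : ι → EllTwo ι) := by
  classical
  rw [orthonormal_iff_ite]
  intro i j
  have h := lp.inner_single_left (𝕜 := ℂ) (G := fun _ : ι => ℂ) i (1 : ℂ) (basisVec j)
  have h2 : (basisVec i : EllTwo ι) = lp.single 2 i (1 : ℂ) := by
    unfold basisVec; congr
  have h3 : (basisVec j : EllTwo ι) = lp.single 2 j (1 : ℂ) := by
    unfold basisVec; congr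
  rw [h2, h, h3, lp.single_apply]
  by_cases hij : i = j
  · subst hij; simp
  · simp [hij]

section Rows

variable {ι : Type*} {H : Type*} [NormedAddCommGroup H] [InnerProductSpace ℂ H]

/-- The `n`-tuples `[X₁, …, Xₙ]` of operators on `H`, regarded as row operators `H⁽ⁿ⁾ → H`. The
operator norm is `‖X₁ X₁* + ⋯ + Xₙ Xₙ*‖ ^ (1/2)`. -/
abbrev RowOp (ι : Type*) (H : Type*) [NormedAddCommGroup H] [InnerProductSpace ℂ H] : Type _ :=
  Ampl ι H →L[ℂ] H

/-- The inclusion of `H` into `H⁽ⁿ⁾` as the `i`-th summand. -/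
def inclusion (i : ι) : H →L[ℂ] Ampl ι H :=
  letI := Classical.decEq ι
  LinearMap.mkContinuous (lp.lsingle (𝕜 := ℂ) (E := fun _ : ι => H) 2 i) 1 (fun x => by
    rw [one_mul]
    exact (lp.norm_single (E := fun _ : ι => H) (p := 2) (by norm_num) i x).le)

/-- The `i`-th entry `X_i` of the tuple `X = [X₁, …, Xₙ]`. -/
def entry (X : RowOp ι H) (i : ι) : H →L[ℂ] H := X ∘L inclusion i

/-- The open operatorial unit ball `[B(H)ⁿ]₁`. -/
abbrev OpBall (ι : Type*) (H : Type*) [NormedAddCommGroup H] [InnerProductSpace ℂ H] : Type _ :=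
  Metric.ball (0 : RowOp ι H) 1

/-- For a tuple `X = (X_i)` of operators and a family `a` of scalars indexed by the free semigroup,
`HasFreeSum a X Y` says that `Y = ∑_{k ≥ 0} ∑_{|α| = k} a_α X_α`, with convergence in the operator
norm. (The summability clause has content only for infinitely many variables.) -/
def HasFreeSum (a : FreeMonoid ι → ℂ) (X : ι → (H →L[ℂ] H)) (Y : H →L[ℂ] H) : Prop :=
  (∀ k : ℕ, Summable fun α : {α : FreeMonoid ι // α.length = k} =>
      a α.1 • FreeMonoid.lift X α.1) ∧
    Filter.Tendsto
      (fun N : ℕ => ∑ k ∈ Finset.range N, ∑' α : {α : FreeMonoid ι // α.length = k},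
        a α.1 • FreeMonoid.lift X α.1)
      Filter.atTop (nhds Y)

/-- The power series with coefficients `a` represents the map `f` on the open unit ball. -/
def Represents (a : FreeMonoid ι → ℂ) (f : OpBall ι H → (H →L[ℂ] H)) : Prop :=
  ∀ X : OpBall ι H, HasFreeSum a (entry X.1) (f X)

/-- `F = (F_j)` is a free holomorphic self-map of `[B(H)ⁿ]₁`: each component is given by a power
series in noncommuting variables with scalar coefficients. -/
def IsFreeHolomorphic (F : OpBall ι H → OpBall ι H) : Prop :=
  ∀ j, ∃ a : FreeMonoid ι → ℂ, Represents a (fun X => entry (F X).1 j)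

/-- `Aut(B(H)ⁿ₁)`: the free holomorphic bijections of `[B(H)ⁿ]₁` with free holomorphic inverse. -/
def freeAut (ι : Type*) (H : Type*) [NormedAddCommGroup H] [InnerProductSpace ℂ H] :
    Set (Equiv.Perm (OpBall ι H)) :=
  {Ψ | IsFreeHolomorphic Ψ ∧ IsFreeHolomorphic Ψ.symm}

end Rows

section Fock

variable {ι : Type*}

/-- The full Fock space of `ℂⁿ`, with orthonormal basis `e_α` indexed by the free semigroup. -/
abbrev Fock (ι : Type*) : Type _ := EllTwo (FreeMonoid ι)

theorem orthonormal_shift (i : ι) :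
    Orthonormal ℂ (fun α : FreeMonoid ι => (basisVec (FreeMonoid.of i * α) : Fock ι)) :=
  orthonormal_basisVec.comp _ (mul_right_injective (FreeMonoid.of i))

/-- The left creation operator `S_i`, the isometry with `S_i e_α = e_{g_i α}`. -/
def creation (i : ι) : Fock ι →L[ℂ] Fock ι :=
  (orthonormal_shift i).orthogonalFamily.linearIsometry.toContinuousLinearMap

theorem creation_basisVec (i : ι) (α : FreeMonoid ι) :
    creation i (basisVec α) = basisVec (FreeMonoid.of i * α) := by
  classical
  have h2 : (basisVec α : Fock ι) = lp.single 2 α (1 : ℂ) := by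
    unfold basisVec
    congr
  rw [h2]
  simp [creation, OrthogonalFamily.linearIsometry_apply_single]

/-- `B = (B_j)` is the boundary function of `Ψ` with respect to `S₁, …, Sₙ`:
`B_j` is the strong limit of `Ψ_j(r S₁, …, r Sₙ)` as `r → 1⁻`, where `Ψ_j` is evaluated on the Fock
space through its power series. -/
def IsBoundaryFunction {H : Type*} [NormedAddCommGroup H] [InnerProductSpace ℂ H]
    (Ψ : OpBall ι H → OpBall ι H) (B : ι → (Fock ι →L[ℂ] Fock ι)) : Prop :=
  ∀ j, ∃ (a : FreeMonoid ι → ℂ) (Y : ℝ → (Fock ι →L[ℂ] Fock ι)),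
    Represents a (fun X => entry (Ψ X).1 j) ∧
    (∀ r : ℝ, 0 ≤ r → r < 1 → HasFreeSum a (fun i => (r : ℂ) • creation i) (Y r)) ∧
    ∀ x : Fock ι, Filter.Tendsto (fun r => Y r x) (nhdsWithin 1 (Set.Iio 1)) (nhds (B j x))

theorem tsum_pi_prod {ι : Type*} (w : ι → ENNReal) (n : ℕ) :
    ∑' v : Fin n → ι, ∏ i, w (v i) = (∑' i, w i) ^ n := by
  induction n with
  | zero => simp
  | succ n ih =>
    rw [← (Fin.consEquiv (fun _ : Fin (n + 1) => ι)).tsum_eq, ENNReal.tsum_prod', pow_succ', ← ih,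
      ← ENNReal.tsum_mul_right]
    simp [Fin.consEquiv, Fin.prod_univ_succ, ENNReal.tsum_mul_left]

theorem tsum_freeMonoid {ι : Type*} (w : ι → ENNReal) :
    ∑' α : FreeMonoid ι, FreeMonoid.lift w α = (1 - ∑' i, w i)⁻¹ := by
  rw [← ENNReal.tsum_geometric, ← (FreeMonoid.ofList.tsum_eq (fun α => FreeMonoid.lift w α)),
    ← (List.equivSigmaTuple).symm.tsum_eq, ENNReal.tsum_sigma']
  congr 1; ext n
  rw [← tsum_pi_prod]
  congr 1; ext v
  simp [List.equivSigmaTuple, FreeMonoid.lift_ofList, List.prod_ofFn, List.map_ofFn]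

theorem memlp_lift {ι : Type*} {z : EllTwo ι} (hz : ‖z‖ < 1) :
    Memℓp (fun α : FreeMonoid ι => FreeMonoid.lift (z : ι → ℂ) α) 2 := by
  rw [memℓp_gen_iff (by norm_num)]
  have h1 : ∀ α : FreeMonoid ι, ENNReal.ofReal (‖FreeMonoid.lift (z : ι → ℂ) α‖ ^ 2) =
      FreeMonoid.lift (fun i => ENNReal.ofReal (‖z i‖ ^ 2)) α := by
    intro α
    induction α using FreeMonoid.inductionOn' with
    | one => simp
    | of_mul i xs ih =>
      rw [map_mul, map_mul, norm_mul, mul_pow, ENNReal.ofReal_mul (by positivity), ih,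
        FreeMonoid.lift_eval_of, FreeMonoid.lift_eval_of]
  have hs : Summable fun i => ‖z i‖ ^ 2 := by
    simpa using (memℓp_gen_iff (by norm_num)).1 (lp.memℓp z)
  have hn : ‖z‖ ^ 2 = ∑' i, ‖z i‖ ^ 2 := by
    simpa using lp.norm_rpow_eq_tsum (p := 2) (by norm_num) z
  have h2 : ∑' α : FreeMonoid ι, ENNReal.ofReal (‖FreeMonoid.lift (z : ι → ℂ) α‖ ^ 2) ≠ ⊤ := by
    simp_rw [h1]
    rw [tsum_freeMonoid, ← ENNReal.ofReal_tsum_of_nonneg (fun _ => by positivity) hs, ← hn]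
    simp only [ne_eq, ENNReal.inv_eq_top, tsub_eq_zero_iff_le, not_le]
    rw [ENNReal.ofReal_lt_one]
    nlinarith [norm_nonneg z]
  have := ENNReal.summable_toReal h2
  simpa [ENNReal.toReal_ofReal, sq_nonneg] using this

/-- The noncommutative Poisson kernel `K_{z,r} : ℂ → Fock space` of the row contraction
`z = [z₁, …, zₙ]` on the Hilbert space `ℂ`, as the vector
`K_{z,r} 1 = ∑_α r^|α| (1 - r² ‖z‖²)^(1/2) conj(z_α) e_α`. -/
def ncPoissonKernel (z : EllTwo ι) (r : ℝ) : Fock ι :=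
  ∑' α : FreeMonoid ι,
    ((r : ℂ) ^ α.length * (Real.sqrt (1 - r ^ 2 * ‖z‖ ^ 2) : ℂ) *
      (starRingEnd ℂ) (FreeMonoid.lift z α)) • basisVec α

/-- The series defining the Poisson kernel converges: its coordinates are the expected ones. -/
theorem ncPoissonKernel_apply {z : EllTwo ι} (hz : ‖z‖ < 1) {r : ℝ} (hr₀ : 0 ≤ r) (hr₁ : r ≤ 1)
    (α : FreeMonoid ι) :
    ncPoissonKernel z r α = (r : ℂ) ^ α.length * (Real.sqrt (1 - r ^ 2 * ‖z‖ ^ 2) : ℂ) *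
      (starRingEnd ℂ) (FreeMonoid.lift z α) := by
  classical
  have hrz : ‖(r : ℂ) • z‖ < 1 := by
    rw [norm_smul, Complex.norm_real, Real.norm_of_nonneg hr₀]
    nlinarith [norm_nonneg z]
  have hl : ∀ α : FreeMonoid ι, FreeMonoid.lift (((r : ℂ) • z : EllTwo ι) : ι → ℂ) α =
      (r : ℂ) ^ α.length * FreeMonoid.lift z α := by
    intro α
    induction α using FreeMonoid.inductionOn' with
    | one => simp
    | of_mul i xs ih =>
      rw [map_mul, ih]
      simp only [FreeMonoid.lift_eval_of, map_mul, FreeMonoid.length_mul, FreeMonoid.length_of,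
        lp.coeFn_smul, Pi.smul_apply, smul_eq_mul]
      ring
  have hm : Memℓp (fun α : FreeMonoid ι => (r : ℂ) ^ α.length *
      (Real.sqrt (1 - r ^ 2 * ‖z‖ ^ 2) : ℂ) * (starRingEnd ℂ) (FreeMonoid.lift z α)) 2 := by
    have h := (memlp_lift hrz).star_mem.const_smul (Real.sqrt (1 - r ^ 2 * ‖z‖ ^ 2) : ℂ)
    convert h using 1
    ext α
    simp only [Pi.smul_apply, Pi.star_apply, hl, smul_eq_mul, star_mul', star_pow,
      RCLike.star_def, Complex.conj_ofReal]
    ring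
  have hs := (lp.hasSum_single (by norm_num) (⟨_, hm⟩ : Fock ι)).tsum_eq
  have hk : ncPoissonKernel z r = (⟨_, hm⟩ : Fock ι) := by
    rw [← hs]
    unfold ncPoissonKernel
    congr 1
    ext1 α
    have h2 : (basisVec α : Fock ι) = lp.single 2 α (1 : ℂ) := by
      unfold basisVec
      congr
    rw [h2, ← lp.single_smul]
    simp
  rw [hk]

/-- `w = P_z[f] = lim_{r → 1⁻} K_{z,r}* f K_{z,r}`, the noncommutative Poisson transform of the
operator `f` at `z` (operators on `ℂ` being identified with scalars). -/
def HasPoissonTransform (z : EllTwo ι) (f : Fock ι →L[ℂ] Fock ι) (w : ℂ) : Prop :=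
  Filter.Tendsto (fun r : ℝ => inner ℂ (ncPoissonKernel z r) (f (ncPoissonKernel z r)))
    (nhdsWithin 1 (Set.Iio 1)) (nhds w)

end Fock

section Ball

/-- The open unit ball `𝔹ₙ` of `ℂⁿ`. -/
abbrev UnitBall (ι : Type*) : Type _ := Metric.ball (0 : EllTwo ι) 1

/-- Holomorphic self-maps of `𝔹ₙ`. -/
def IsHolomorphicSelfMap {ι : Type*} (f : UnitBall ι → UnitBall ι) : Prop :=
  ∃ g : EllTwo ι → EllTwo ι, DifferentiableOn ℂ g (Metric.ball 0 1) ∧ ∀ z : UnitBall ι,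
    g z.1 = (f z).1

theorem IsHolomorphicSelfMap.comp {ι : Type*} {f₁ f₂ : UnitBall ι → UnitBall ι}
    (h₁ : IsHolomorphicSelfMap f₁) (h₂ : IsHolomorphicSelfMap f₂) :
    IsHolomorphicSelfMap (f₁ ∘ f₂) := by
  obtain ⟨g₁, hd₁, he₁⟩ := h₁
  obtain ⟨g₂, hd₂, he₂⟩ := h₂
  refine ⟨g₁ ∘ g₂, hd₁.comp hd₂ ?_, ?_⟩
  · intro z hz
    rw [he₂ ⟨z, hz⟩]
    exact (f₂ ⟨z, hz⟩).2
  · intro z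
    simp [he₂ z, he₁ (f₂ z)]

/-- The group `Aut(𝔹ₙ)` of biholomorphic self-maps of the unit ball, under composition. -/
def ballAut (ι : Type*) : Subgroup (Equiv.Perm (UnitBall ι)) where
  carrier := {σ | IsHolomorphicSelfMap σ ∧ IsHolomorphicSelfMap σ.symm}
  mul_mem' := fun ha hb => ⟨ha.1.comp hb.1, hb.2.comp ha.2⟩
  one_mem' := ⟨⟨id, differentiableOn_id, fun _ => rfl⟩, ⟨id, differentiableOn_id, fun _ => rfl⟩⟩
  inv_mem' := fun ha => ⟨ha.2, ha.1⟩

/-- The automorphism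
`φ_a(z) = (a - Q_a z - s_a (I - Q_a) z) / (1 - ⟨z, a⟩)` of the unit ball, where
`Q_a z = (⟨z, a⟩ / ⟨a, a⟩) a` is the projection onto the span of `a` (so `Q_0 = 0`) and
`s_a = (1 - ⟨a, a⟩)^(1/2)`. The pairing `⟨z, a⟩`, linear in `z`, is `inner ℂ a z`. -/
def moebius {ι : Type*} (a z : EllTwo ι) : EllTwo ι :=
  let Qz : EllTwo ι := (inner ℂ a z / inner ℂ a a : ℂ) • a
  (1 - inner ℂ a z : ℂ)⁻¹ • (a - Qz - (Real.sqrt (1 - ‖a‖ ^ 2) : ℂ) • (z - Qz))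

/-- The entry `u_{ij}` of the matrix of a unitary operator `U` on `ℂⁿ`: `U e_j = ∑_i u_{ij} e_i`. -/
def matEntry {ι : Type*} (U : EllTwo ι ≃ₗᵢ[ℂ] EllTwo ι) (i j : ι) : ℂ := U (basisVec j) i

end Ball

section Involution

variable {ι : Type*} {H : Type*} [NormedAddCommGroup H] [InnerProductSpace ℂ H]

theorem memlp_column (v : EllTwo ι) (h : H) : Memℓp (fun i => v i • h) 2 := by
  have hv := lp.memℓp v
  rw [memℓp_gen_iff (by norm_num)] at hv ⊢
  simpa [norm_smul, mul_pow] using hv.mul_right (‖h‖ ^ 2)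

/-- The column operator `H → H⁽ⁿ⁾`, `h ↦ (v_i h)_i`. -/
def column (v : EllTwo ι) : H →L[ℂ] Ampl ι H :=
  LinearMap.mkContinuous
    { toFun := fun h => ⟨fun i => v i • h, memlp_column v h⟩
      map_add' := fun x y => by ext i; exact smul_add _ _ _
      map_smul' := fun c x => by ext i; exact smul_comm _ _ _ }
    ‖v‖ (fun h => by
      have key : ∀ x : ℝ, x ^ (2 : ENNReal).toReal = x ^ 2 := fun x => by simp
      rw [← abs_of_nonneg (norm_nonneg _), ← abs_of_nonneg (mul_nonneg (norm_nonneg v)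
        (norm_nonneg h)), ← sq_le_sq, mul_pow, ← key,
        lp.norm_rpow_eq_tsum (by norm_num), ← key ‖v‖,
        lp.norm_rpow_eq_tsum (by norm_num) v, ← tsum_mul_right]
      simp [norm_smul, mul_pow])

variable [CompleteSpace H]

/-- The square root `T ^ (1/2)` of a positive operator `T` on a Hilbert space. -/
def opSqrt {E : Type*} [NormedAddCommGroup E] [InnerProductSpace ℂ E] [CompleteSpace E]
    (T : E →L[ℂ] E) : E →L[ℂ] E :=
  CFC.sqrt T

/-- The row contraction `[λ₁ I_H, …, λₙ I_H]`. -/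
def scalarRow (l : EllTwo ι) : RowOp ι H := ContinuousLinearMap.adjoint (column (star l))

/-- The map `Ψ_λ(X) = λ - Δ_λ (I - ∑_i conj(λ_i) X_i)⁻¹ [X₁, …, Xₙ] Δ_{λ*}`, where
`λ` also denotes the row operator `[λ₁ I_H, …, λₙ I_H]`, `Δ_λ = (I - λ λ*)^(1/2)` on `H` and
`Δ_{λ*} = (I - λ* λ)^(1/2)` on `H⁽ⁿ⁾`; note that `X λ* = ∑_i conj(λ_i) X_i`. -/
def involution (l : EllTwo ι) (X : RowOp ι H) : RowOp ι H :=
  let L : RowOp ι H := scalarRow l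
  let Ls : H →L[ℂ] Ampl ι H := ContinuousLinearMap.adjoint L
  let defect : H →L[ℂ] H := opSqrt (1 - L ∘L Ls)
  let defectStar : Ampl ι H →L[ℂ] Ampl ι H := opSqrt (1 - Ls ∘L L)
  L - defect ∘L Ring.inverse (1 - X ∘L Ls) ∘L X ∘L defectStar

/-- `Y = Φ_U(X) = [X₁, …, Xₙ] U`, that is, `Y_j = ∑_i u_{ij} X_i` (in norm) for every `j`. -/
def IsRightMul (U : EllTwo ι ≃ₗᵢ[ℂ] EllTwo ι) (X Y : RowOp ι H) : Prop :=
  ∀ j, HasSum (fun i => matEntry U i j • entry X i) (entry Y j)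

end Involution

end

/-! ### Coordinates, rows and columns. -/

noncomputable section Basics

open ContinuousLinearMap

open scoped InnerProductSpace

variable {ι : Type*}

/-! `Γ` is restriction to the scalar points `[z₁I, …, zₙI]`; the proof shows that this restriction
loses nothing and misses nothing. Since `H` is separable and infinite-dimensional, a unitary `W`
from the Fock space onto `H` moves the creation operators to `H`, so every `t S` with `0 ≤ t < 1`
becomes a point of the operatorial ball. Evaluating a bounded power series at `t S` and applying it
to the vacuum vector `e_1` reads off the coefficients `t^|α| a_α`; hence coefficients are unique and
have `ℓ²` norm at most the bound (`Represents.exists_fock`). Conversely, square summable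
coefficients give a norm-summable series at every point of the ball (`summable_smul_word`). Free
holomorphic maps are thus handled through vectors of the Fock space and the bounded linear
evaluation `ev`, and closure under composition follows (`IsFreeHolomorphic.comp`).

The map `Ψ_λ` is governed by the equation `(1 - X L*) Y = L - X E`, with `L` the row of scalars `λ`
and `E = s + (1 + s)⁻¹ L* L`, `s = (1 - ‖λ‖²)^(1/2)`. It yields the strict contractivity, the
involutivity, the power series and the restriction to scalar points, which is `φ_λ`.

Rigidity (`exists_ballRightMul_eq`): suppose that `F` fixes the origin, and choose `N` with `N² = 0`
and `‖N‖ = 1`. Then `F(zN) = f(z)N` with `f` linear and contractive, and the same holds for the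
inverse of `F`, so `f` is unitary. Therefore the linear part of each component of `F` has norm one,
while its full coefficient vector has norm at most one; nothing but the linear part remains. Moving
the origin by an involution, every automorphism is `Φ_U ∘ Ψ_λ`.

Injectivity of `Γ` is rigidity applied to an element of the kernel. Surjectivity is Cartan's theorem
for the ball (`exists_isometry_of_mem_ballAut`), after an involution has moved the preimage of the
origin to the origin. The Poisson transform agrees with evaluation at `z` because the kernel
`K_{z,r}` is a joint eigenvector of the adjoints of the creation operators
(`hasPoissonTransform_of_tendsto`). -/

theorem basisVec_eq_single [DecidableEq ι] (i : ι) : (basisVec i : EllTwo ι) = lp.single 2 i (1 : ℂ) := by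
  unfold basisVec
  congr
  exact Subsingleton.elim _ _

theorem norm_basisVec (i : ι) : ‖(basisVec i : EllTwo ι)‖ = 1 := orthonormal_basisVec.1 i

theorem inner_basisVec_left (i : ι) (v : EllTwo ι) : ⟪basisVec i, v⟫_ℂ = v i := by
  classical
  rw [basisVec_eq_single, lp.inner_single_left]
  simp

theorem basisVec_apply [DecidableEq ι] (i j : ι) :
    (basisVec i : EllTwo ι) j = if i = j then 1 else 0 := by
  rw [← inner_basisVec_left, orthonormal_iff_ite.1 orthonormal_basisVec]
  simp [eq_comm]

theorem hasSum_basisVec (v : EllTwo ι) : HasSum (fun i => v i • (basisVec i : EllTwo ι)) v := by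
  classical
  convert lp.hasSum_single (by norm_num) v using 2 with i
  rw [basisVec_eq_single, ← lp.single_smul]
  simp

theorem EllTwo.norm_sq (v : EllTwo ι) : ‖v‖ ^ 2 = ∑' i, ‖v i‖ ^ 2 := by
  simpa using lp.norm_rpow_eq_tsum (p := 2) (by norm_num) v

theorem Ampl.norm_sq {K : Type*} [NormedAddCommGroup K] (v : Ampl ι K) :
    ‖v‖ ^ 2 = ∑' i, ‖v i‖ ^ 2 := by
  simpa using lp.norm_rpow_eq_tsum (p := 2) (by norm_num) v

theorem Ampl.summable_sq {K : Type*} [NormedAddCommGroup K] (v : Ampl ι K) :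
    Summable fun i => ‖v i‖ ^ 2 := by
  simpa using (memℓp_gen_iff (by norm_num)).1 (lp.memℓp v)

theorem ext_basisVec {E : Type*} [NormedAddCommGroup E] [NormedSpace ℂ E]
    {f g : EllTwo ι →L[ℂ] E} (h : ∀ i, f (basisVec i) = g (basisVec i)) : f = g := by
  ext v
  refine ((hasSum_basisVec v).mapL f).unique ?_
  convert (hasSum_basisVec v).mapL g using 2 with i
  simp [h]

variable {K : Type*} [NormedAddCommGroup K] [InnerProductSpace ℂ K]

theorem inclusion_eq_single [DecidableEq ι] (i : ι) (x : K) :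
    inclusion i x = lp.single 2 i x := by
  unfold inclusion
  simp only [LinearMap.mkContinuous_apply, lp.lsingle_apply]
  congr
  exact Subsingleton.elim _ _

theorem hasSum_inclusion (v : Ampl ι K) : HasSum (fun i => inclusion i (v i)) v := by
  classical
  simpa only [inclusion_eq_single] using lp.hasSum_single (by norm_num) v

theorem inner_inclusion_left (i : ι) (x : K) (v : Ampl ι K) :
    ⟪inclusion i x, v⟫_ℂ = ⟪x, v i⟫_ℂ := by
  classical
  rw [inclusion_eq_single, lp.inner_single_left]

theorem norm_inclusion_apply (i : ι) (x : K) : ‖inclusion i x‖ = ‖x‖ := by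
  classical
  rw [inclusion_eq_single, lp.norm_single (by norm_num)]

theorem entry_apply (X : RowOp ι K) (i : ι) (x : K) : entry X i x = X (inclusion i x) := rfl

theorem ext_inclusion {E : Type*} [NormedAddCommGroup E] [NormedSpace ℂ E]
    {X Y : Ampl ι K →L[ℂ] E} (h : ∀ i, X ∘L inclusion i = Y ∘L inclusion i) : X = Y := by
  ext v
  refine ((hasSum_inclusion v).mapL X).unique ?_
  convert (hasSum_inclusion v).mapL Y using 2 with i
  exact congr($(h i) (v i))

theorem ext_entry {X Y : RowOp ι K} (h : ∀ i, entry X i = entry Y i) : X = Y :=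
  ext_inclusion h

theorem norm_entry_le (X : RowOp ι K) (i : ι) : ‖entry X i‖ ≤ ‖X‖ :=
  opNorm_le_bound _ (norm_nonneg X) fun x =>
    (X.le_opNorm _).trans_eq congr(‖X‖ * $(norm_inclusion_apply i x))

@[simp] theorem entry_add (X Y : RowOp ι K) (i : ι) : entry (X + Y) i = entry X i + entry Y i := rfl

@[simp] theorem entry_sub (X Y : RowOp ι K) (i : ι) : entry (X - Y) i = entry X i - entry Y i := rfl

@[simp] theorem entry_smul (c : ℂ) (X : RowOp ι K) (i : ι) : entry (c • X) i = c • entry X i := rfl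

@[simp] theorem entry_comp (T : K →L[ℂ] K) (X : RowOp ι K) (i : ι) :
    entry (T ∘L X) i = T ∘L entry X i := rfl

@[simp] theorem entry_zero (i : ι) : entry (0 : RowOp ι K) i = 0 := rfl

theorem norm_opBall_lt (X : OpBall ι K) : ‖X.1‖ < 1 :=
  (@mem_ball_zero_iff (RowOp ι K) _ X.1 1).1 X.2

theorem mem_opBall {X : RowOp ι K} (hX : ‖X‖ < 1) : X ∈ Metric.ball (0 : RowOp ι K) 1 :=
  (@mem_ball_zero_iff (RowOp ι K) _ X 1).2 hX

theorem HasFreeSum.unique {a : FreeMonoid ι → ℂ} {X : ι → K →L[ℂ] K} {Y Z : K →L[ℂ] K}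
    (hY : HasFreeSum a X Y) (hZ : HasFreeSum a X Z) : Y = Z :=
  tendsto_nhds_unique hY.2 hZ.2

theorem column_apply (v : EllTwo ι) (h : K) (i : ι) : column v h i = v i • h := rfl

theorem inner_column (v w : EllTwo ι) (h k : K) :
    ⟪column v h, column w k⟫_ℂ = ⟪v, w⟫_ℂ * ⟪h, k⟫_ℂ := by
  have key (i : ι) : ⟪column v h i, column w k i⟫_ℂ = ⟪v i, w i⟫_ℂ * ⟪h, k⟫_ℂ := by
    change ⟪v i • h, w i • k⟫_ℂ = _
    rw [inner_smul_left, inner_smul_right, RCLike.inner_apply]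
    ring
  refine (lp.hasSum_inner (𝕜 := ℂ) (column v h) (column w k)).unique ?_
  simp only [key]
  exact (lp.hasSum_inner (𝕜 := ℂ) v w).mul_right ⟪h, k⟫_ℂ

theorem norm_column_apply (v : EllTwo ι) (h : K) : ‖column v h‖ = ‖v‖ * ‖h‖ := by
  rw [← sq_eq_sq₀ (norm_nonneg _) (by positivity), mul_pow]
  have h1 := inner_self_eq_norm_sq_to_K (𝕜 := ℂ) (column v h)
  have h2 := inner_self_eq_norm_sq_to_K (𝕜 := ℂ) v
  have h3 := inner_self_eq_norm_sq_to_K (𝕜 := ℂ) h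
  have h4 := inner_column v v h h
  rw [h1, h2, h3] at h4
  exact_mod_cast h4

theorem norm_column_le (v : EllTwo ι) : ‖(column v : K →L[ℂ] Ampl ι K)‖ ≤ ‖v‖ :=
  opNorm_le_bound _ (norm_nonneg v) fun h => (norm_column_apply v h).le

theorem column_add (v w : EllTwo ι) :
    (column (v + w) : K →L[ℂ] Ampl ι K) = column v + column w := by
  ext h i
  exact add_smul (v i) (w i) h

theorem column_smul (c : ℂ) (v : EllTwo ι) :
    (column (c • v) : K →L[ℂ] Ampl ι K) = c • column v := by
  ext h i
  exact mul_smul c (v i) h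

/-- The column operator as a linear function of the vector. -/
def columnLM (ι K : Type*) [NormedAddCommGroup K] [InnerProductSpace ℂ K] :
    EllTwo ι →ₗ[ℂ] K →L[ℂ] Ampl ι K where
  toFun := column
  map_add' := column_add
  map_smul' := column_smul

theorem norm_columnLM_le (v : EllTwo ι) : ‖columnLM ι K v‖ ≤ 1 * ‖v‖ := by
  rw [one_mul]
  exact norm_column_le v

/-- The column operator as a continuous linear function of the vector. -/
def columnL (ι K : Type*) [NormedAddCommGroup K] [InnerProductSpace ℂ K] :
    EllTwo ι →L[ℂ] K →L[ℂ] Ampl ι K :=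
  ⟨columnLM ι K, by
    refine AddMonoidHomClass.continuous_of_bound (columnLM ι K) 1 ?_
    exact norm_columnLM_le⟩

theorem columnL_apply (v : EllTwo ι) : columnL ι K v = column v := rfl

theorem column_basisVec (i : ι) : (column (basisVec i) : K →L[ℂ] Ampl ι K) = inclusion i := by
  classical
  ext h j
  rw [column_apply, inclusion_eq_single, basisVec_apply, lp.single_apply]
  by_cases hij : i = j
  · subst hij; simp
  · simp [hij, Ne.symm hij]

/-- The column operator depends boundedly and linearly on `v`, so expanding `v` in the standard
basis gives convergence in operator norm, also for infinitely many variables. -/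
theorem hasSum_column (X : RowOp ι K) (v : EllTwo ι) :
    HasSum (fun i => v i • entry X i) (X ∘L column v) := by
  have := ((hasSum_basisVec v).mapL (columnL ι K)).mapL (compL ℂ K (Ampl ι K) K X)
  simpa [columnL_apply, column_basisVec, entry] using this

variable [CompleteSpace K]

theorem adjoint_row_apply (X : RowOp ι K) (h : K) (i : ι) : adjoint X h i = adjoint (entry X i) h := by
  refine ext_inner_left ℂ fun x => ?_
  rw [adjoint_inner_right, ← inner_inclusion_left, adjoint_inner_right, entry_apply]

theorem tsum_norm_adjoint_entry_sq (X : RowOp ι K) (h : K) :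
    ∑' i, ‖adjoint (entry X i) h‖ ^ 2 = ‖adjoint X h‖ ^ 2 := by
  rw [Ampl.norm_sq]
  simp only [adjoint_row_apply]

theorem adjoint_scalarRow (l : EllTwo ι) :
    adjoint (scalarRow l : RowOp ι K) = column (star l) := adjoint_adjoint _

@[simp] theorem entry_scalarRow (l : EllTwo ι) (i : ι) :
    entry (scalarRow l : RowOp ι K) i = l i • (1 : K →L[ℂ] K) := by
  ext x
  refine ext_inner_left ℂ fun y => ?_
  rw [entry_apply, ← adjoint_inner_left, adjoint_scalarRow, ← inner_conj_symm,
    inner_inclusion_left, column_apply, inner_conj_symm]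
  simp [inner_smul_left, inner_smul_right]

theorem scalarRow_injective [Nontrivial K] :
    Function.Injective (scalarRow : EllTwo ι → RowOp ι K) := by
  intro l m h
  ext i
  have := congr(entry $h i)
  rw [entry_scalarRow, entry_scalarRow] at this
  exact smul_left_injective ℂ one_ne_zero this

end Basics

/-! ### Power series with square summable coefficients. -/

noncomputable section Evaluation

open ContinuousLinearMap

open scoped InnerProductSpace

variable {ι : Type*} {K : Type*} [NormedAddCommGroup K] [InnerProductSpace ℂ K] [CompleteSpace K]

theorem tsum_ofReal_adjoint_entry_le (X : RowOp ι K) (h : K) :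
    ∑' i, ENNReal.ofReal (‖adjoint (entry X i) h‖ ^ 2) ≤
      ENNReal.ofReal (‖X‖ ^ 2) * ENNReal.ofReal (‖h‖ ^ 2) := by
  have hs : Summable fun i => ‖adjoint (entry X i) h‖ ^ 2 := by
    simpa only [adjoint_row_apply] using Ampl.summable_sq (adjoint X h)
  rw [← ENNReal.ofReal_tsum_of_nonneg (fun _ => by positivity) hs, tsum_norm_adjoint_entry_sq,
    ← ENNReal.ofReal_mul (by positivity), ← mul_pow]
  refine ENNReal.ofReal_le_ofReal (pow_le_pow_left₀ (norm_nonneg _) ?_ 2)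
  simpa using (adjoint X).le_opNorm h

/-- Induction on the length: `(X_i X_β)* h = X_β* (X_i* h)`, so the induction hypothesis is applied
to the vectors `X_i* h`, whose squared norms add up to `‖X* h‖²`. -/
theorem tsum_ofReal_adjoint_word_le (X : RowOp ι K) (n : ℕ) (h : K) :
    ∑' v : Fin n → ι, ENNReal.ofReal
        (‖adjoint (FreeMonoid.lift (entry X) (FreeMonoid.ofList (List.ofFn v))) h‖ ^ 2) ≤
      ENNReal.ofReal (‖X‖ ^ 2) ^ n * ENNReal.ofReal (‖h‖ ^ 2) := by
  induction n generalizing h with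
  | zero => simp [← ContinuousLinearMap.star_eq_adjoint]
  | succ n ih =>
    rw [← (Fin.consEquiv (fun _ : Fin (n + 1) => ι)).tsum_eq, ENNReal.tsum_prod']
    calc _ ≤ ∑' i, ENNReal.ofReal (‖X‖ ^ 2) ^ n *
          ENNReal.ofReal (‖adjoint (entry X i) h‖ ^ 2) := by
          refine ENNReal.tsum_le_tsum fun i => le_trans (le_of_eq ?_) (ih (adjoint (entry X i) h))
          refine tsum_congr fun v => ?_
          simp [Fin.consEquiv, List.ofFn_succ, FreeMonoid.lift_ofList,
            ← ContinuousLinearMap.star_eq_adjoint]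
      _ ≤ _ := by
          rw [ENNReal.tsum_mul_left, pow_succ _ n, mul_assoc]
          gcongr
          exact tsum_ofReal_adjoint_entry_le X h

theorem sum_norm_adjoint_word_sq_le {X : RowOp ι K} (hX : ‖X‖ < 1) (s : Finset (FreeMonoid ι))
    (h : K) : ∑ α ∈ s, ‖adjoint (FreeMonoid.lift (entry X) α) h‖ ^ 2 ≤
      (1 - ‖X‖ ^ 2)⁻¹ * ‖h‖ ^ 2 := by
  have hX2 : ‖X‖ ^ 2 < 1 := by nlinarith [norm_nonneg X]
  have hpos : 0 < 1 - ‖X‖ ^ 2 := by linarith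
  have key : ∑' α, ENNReal.ofReal (‖adjoint (FreeMonoid.lift (entry X) α) h‖ ^ 2) ≤
      ENNReal.ofReal ((1 - ‖X‖ ^ 2)⁻¹ * ‖h‖ ^ 2) := by
    rw [ENNReal.ofReal_mul (by positivity), ENNReal.ofReal_inv_of_pos hpos,
      ENNReal.ofReal_sub _ (by positivity), ENNReal.ofReal_one, ← ENNReal.tsum_geometric,
      ← ENNReal.tsum_mul_right, ← FreeMonoid.ofList.tsum_eq,
      ← (List.equivSigmaTuple).symm.tsum_eq, ENNReal.tsum_sigma']
    exact ENNReal.tsum_le_tsum fun n => tsum_ofReal_adjoint_word_le X n h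
  rw [← ENNReal.ofReal_le_ofReal_iff (by positivity),
    ENNReal.ofReal_sum_of_nonneg fun _ _ => by positivity]
  exact (ENNReal.sum_le_tsum s).trans key

/-- Cauchy–Schwarz after moving the words to the other side: with `y` the value at `x`, `‖y‖² = ∑
a_α ⟪X_α* y, x⟫`, and the norms `‖X_α* y‖` are square summable. -/
theorem norm_sum_smul_word_le {X : RowOp ι K} (hX : ‖X‖ < 1) (s : Finset (FreeMonoid ι))
    (a : FreeMonoid ι → ℂ) :
    ‖∑ α ∈ s, a α • FreeMonoid.lift (entry X) α‖ ≤
      √(∑ α ∈ s, ‖a α‖ ^ 2) * √(1 - ‖X‖ ^ 2)⁻¹ := by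
  refine opNorm_le_bound _ (by positivity) fun x => ?_
  set y := (∑ α ∈ s, a α • FreeMonoid.lift (entry X) α) x with hy
  have h1 : ‖y‖ ^ 2 ≤ ‖x‖ * ∑ α ∈ s, ‖a α‖ * ‖adjoint (FreeMonoid.lift (entry X) α) y‖ := by
    have : (‖y‖ ^ 2 : ℝ) = ‖⟪y, y⟫_ℂ‖ := by
      rw [norm_inner_symm, inner_self_eq_norm_sq_to_K]
      simp
    rw [this]
    nth_rewrite 2 [hy]
    rw [sum_apply, inner_sum, Finset.mul_sum]
    refine (norm_sum_le _ _).trans (Finset.sum_le_sum fun α _ => ?_)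
    rw [smul_apply, inner_smul_right, ← adjoint_inner_left, norm_mul]
    calc _ ≤ ‖a α‖ * (‖adjoint (FreeMonoid.lift (entry X) α) y‖ * ‖x‖) := by
          gcongr
          exact norm_inner_le_norm _ _
      _ = _ := by ring
  have h2 := (Real.sum_mul_le_sqrt_mul_sqrt s (fun α => ‖a α‖)
    (fun α => ‖adjoint (FreeMonoid.lift (entry X) α) y‖))
  have h3 : √(∑ α ∈ s, ‖adjoint (FreeMonoid.lift (entry X) α) y‖ ^ 2) ≤
      √(1 - ‖X‖ ^ 2)⁻¹ * ‖y‖ := by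
    refine (Real.sqrt_le_sqrt (sum_norm_adjoint_word_sq_le hX s y)).trans_eq ?_
    rw [Real.sqrt_mul' _ (by positivity), Real.sqrt_sq (norm_nonneg y)]
  rcases (norm_nonneg y).eq_or_lt with h0 | h0
  · rw [← h0]; positivity
  refine le_of_mul_le_mul_right ?_ h0
  calc ‖y‖ * ‖y‖ = ‖y‖ ^ 2 := (sq _).symm
    _ ≤ ‖x‖ * (√(∑ α ∈ s, ‖a α‖ ^ 2) * (√(1 - ‖X‖ ^ 2)⁻¹ * ‖y‖)) := by
        refine h1.trans ?_
        gcongr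
        refine h2.trans ?_
        gcongr
    _ = _ := by ring

theorem EllTwo.summable_sq {κ : Type*} (a : EllTwo κ) : Summable fun i => ‖a i‖ ^ 2 := by
  simpa using (memℓp_gen_iff (by norm_num)).1 (lp.memℓp a)

theorem EllTwo.sum_sq_le {κ : Type*} (a : EllTwo κ) (s : Finset κ) :
    ∑ i ∈ s, ‖a i‖ ^ 2 ≤ ‖a‖ ^ 2 := by
  rw [EllTwo.norm_sq]
  exact a.summable_sq.sum_le_tsum s fun _ _ => by positivity

/-- The norm of any finite block is controlled by the `ℓ²` norm of the coefficients in it, which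
gives the Cauchy criterion; absolute convergence is not claimed. -/
theorem summable_smul_word {X : RowOp ι K} (hX : ‖X‖ < 1) (a : Fock ι) :
    Summable fun α => a α • FreeMonoid.lift (entry X) α := by
  have hX2 : ‖X‖ ^ 2 < 1 := by nlinarith [norm_nonneg X]
  have hpos : 0 < 1 - ‖X‖ ^ 2 := by linarith
  rw [summable_iff_vanishing_norm]
  intro ε hε
  obtain ⟨s, hs⟩ := summable_iff_vanishing_norm.1 a.summable_sq (ε ^ 2 * (1 - ‖X‖ ^ 2))
    (by positivity)
  refine ⟨s, fun t ht => (norm_sum_smul_word_le hX t a).trans_lt ?_⟩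
  have h := (le_abs_self _).trans_lt (hs t ht)
  rw [← Real.sqrt_mul' _ (by positivity), Real.sqrt_lt' hε, ← div_eq_mul_inv, div_lt_iff₀ hpos]
  exact h

theorem norm_tsum_smul_word_le {X : RowOp ι K} (hX : ‖X‖ < 1) (a : Fock ι) :
    ‖∑' α, a α • FreeMonoid.lift (entry X) α‖ ≤ √(1 - ‖X‖ ^ 2)⁻¹ * ‖a‖ := by
  refine le_of_tendsto (summable_smul_word hX a).hasSum.norm (.of_forall fun s => ?_)
  refine (norm_sum_smul_word_le hX s a).trans ?_
  rw [mul_comm]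
  gcongr
  exact Real.sqrt_le_left (norm_nonneg a) |>.2 (a.sum_sq_le s)

/-- The value at `X` of the power series with square summable coefficients `a`. -/
def ev (X : OpBall ι K) : Fock ι →L[ℂ] K →L[ℂ] K :=
  have hX : ‖X.1‖ < 1 := norm_opBall_lt X
  LinearMap.mkContinuous
    { toFun := fun a => ∑' α, a α • FreeMonoid.lift (entry X.1) α
      map_add' := fun a b => by
        rw [← (summable_smul_word hX a).tsum_add (summable_smul_word hX b)]
        exact tsum_congr fun α => add_smul _ _ _
      map_smul' := fun c a => by
        rw [← (summable_smul_word hX a).tsum_const_smul]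
        exact tsum_congr fun α => mul_smul _ _ _ }
    _ (norm_tsum_smul_word_le hX)

theorem hasSum_ev (X : OpBall ι K) (a : Fock ι) :
    HasSum (fun α => a α • FreeMonoid.lift (entry X.1) α) (ev X a) :=
  (summable_smul_word (norm_opBall_lt X) a).hasSum

@[simp] theorem ev_basisVec (X : OpBall ι K) (α : FreeMonoid ι) :
    ev X (basisVec α) = FreeMonoid.lift (entry X.1) α := by
  classical
  refine (hasSum_ev X _).unique ?_
  convert hasSum_single α ?_ using 1
  · simp [basisVec_apply]
  · intro β hβ
    simp [basisVec_apply, hβ.symm]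

/-- An unconditional sum over all words may be grouped by length. -/
theorem HasSum.hasFreeSum {a : FreeMonoid ι → ℂ} {X : ι → K →L[ℂ] K} {Y : K →L[ℂ] K}
    (h : HasSum (fun α => a α • FreeMonoid.lift X α) Y) : HasFreeSum a X Y := by
  have hs (k : ℕ) : Summable fun α : {α : FreeMonoid ι // α.length = k} =>
      a α.1 • FreeMonoid.lift X α.1 := h.summable.subtype {α | α.length = k}
  refine ⟨hs, HasSum.tendsto_sum_nat ?_⟩
  rw [← (Equiv.sigmaFiberEquiv FreeMonoid.length).hasSum_iff] at h
  exact h.sigma fun k => (hs k).hasSum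

theorem hasFreeSum_ev (X : OpBall ι K) (a : Fock ι) : HasFreeSum a (entry X.1) (ev X a) :=
  (hasSum_ev X a).hasFreeSum

end Evaluation

/-! ### Creation operators on `K`, recovery of coefficients, composition. -/

noncomputable section Shifts

open ContinuousLinearMap

open scoped InnerProductSpace

variable {ι : Type*} {K : Type*} [NormedAddCommGroup K] [InnerProductSpace ℂ K] [CompleteSpace K]

/-- The left creation operators as linear isometries. -/
def creationIsometry (i : ι) : Fock ι →ₗᵢ[ℂ] Fock ι :=
  (orthonormal_shift i).orthogonalFamily.linearIsometry

/-- Words with different first letters are different; linearity and continuity extend this from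
basis vectors, one argument at a time. -/
theorem inner_creation_of_ne {i j : ι} (hij : i ≠ j) (x y : Fock ι) :
    ⟪creation i x, creation j y⟫_ℂ = 0 := by
  classical
  have h1 (α : FreeMonoid ι) (y : Fock ι) :
      ⟪creation i (basisVec α), creation j y⟫_ℂ = 0 := by
    have : innerSL ℂ (creation i (basisVec α)) ∘L creation j = 0 := by
      refine ext_basisVec fun β => ?_
      simp only [comp_apply, innerSL_apply_apply, creation_basisVec, inner_basisVec_left,
        basisVec_apply, zero_apply, ite_eq_right_iff, one_ne_zero, imp_false]
      intro h
      exact hij.symm (List.cons.inj h).1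
    exact congr($this y)
  have h2 : innerSL ℂ (creation j y) ∘L creation i = 0 := by
    refine ext_basisVec fun α => ?_
    rw [comp_apply, innerSL_apply_apply, ← inner_conj_symm, h1, map_zero, zero_apply]
  rw [← inner_conj_symm]
  simpa using congr(starRingEnd ℂ ($h2 x))

/-- The creation operators transported to `K` along an isometric isomorphism. -/
def shiftIsometry (W : Fock ι ≃ₗᵢ[ℂ] K) (i : ι) : K →ₗᵢ[ℂ] K :=
  W.toLinearIsometry.comp ((creationIsometry i).comp W.symm.toLinearIsometry)

omit [CompleteSpace K] in
theorem shiftIsometry_apply (W : Fock ι ≃ₗᵢ[ℂ] K) (i : ι) (x : K) :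
    shiftIsometry W i x = W (creation i (W.symm x)) := rfl

omit [CompleteSpace K] in
theorem orthogonalFamily_shiftIsometry (W : Fock ι ≃ₗᵢ[ℂ] K) :
    OrthogonalFamily ℂ (fun _ : ι => K) (shiftIsometry W) := by
  intro i j hij x y
  rw [shiftIsometry_apply, shiftIsometry_apply, LinearIsometryEquiv.inner_map_map,
    inner_creation_of_ne hij]

/-- The row of creation operators, transported to `K` along an isometric isomorphism. -/
def shiftRow (W : Fock ι ≃ₗᵢ[ℂ] K) : RowOp ι K :=
  (orthogonalFamily_shiftIsometry W).linearIsometry.toContinuousLinearMap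

theorem norm_shiftRow_le (W : Fock ι ≃ₗᵢ[ℂ] K) : ‖shiftRow W‖ ≤ 1 :=
  LinearIsometry.norm_toContinuousLinearMap_le _

theorem entry_shiftRow_apply (W : Fock ι ≃ₗᵢ[ℂ] K) (i : ι) (x : K) :
    entry (shiftRow W) i x = W (creation i (W.symm x)) := by
  classical
  rw [entry_apply, inclusion_eq_single]
  exact (orthogonalFamily_shiftIsometry W).linearIsometry_apply_single x

theorem entry_shiftRow_refl (i : ι) :
    entry (shiftRow (LinearIsometryEquiv.refl ℂ (Fock ι))) i = creation i :=
  ContinuousLinearMap.ext fun x => entry_shiftRow_apply _ i x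

theorem lift_entry_shiftRow_apply (W : Fock ι ≃ₗᵢ[ℂ] K) (α β : FreeMonoid ι) :
    FreeMonoid.lift (entry (shiftRow W)) α (W (basisVec β)) = W (basisVec (α * β)) := by
  induction α using FreeMonoid.inductionOn' with
  | one => simp
  | of_mul i α ih =>
    rw [map_mul, mul_apply_eq_comp, ih, FreeMonoid.lift_eval_of, entry_shiftRow_apply,
      LinearIsometryEquiv.symm_apply_apply, creation_basisVec, mul_assoc]

omit [CompleteSpace K] in
theorem lift_smul (c : ℂ) (X : ι → K →L[ℂ] K) (α : FreeMonoid ι) :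
    FreeMonoid.lift (fun i => c • X i) α = c ^ α.length • FreeMonoid.lift X α := by
  induction α using FreeMonoid.inductionOn' with
  | one => simp
  | of_mul i α ih =>
    simp only [map_mul, FreeMonoid.lift_eval_of, ih, FreeMonoid.length_mul, FreeMonoid.length_of,
      smul_mul_assoc, mul_smul_comm, smul_smul, pow_add, pow_one,
      mul_comm]

omit [CompleteSpace K] in
theorem norm_shrink_lt {t : ℝ} (ht : t ∈ Set.Ico (0 : ℝ) 1) {X : RowOp ι K} (hX : ‖X‖ ≤ 1) :
    ‖(t : ℂ) • X‖ < 1 := by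
  refine (opNorm_smul_le (t : ℂ) X).trans_lt ?_
  rw [Complex.norm_real, Real.norm_of_nonneg ht.1]
  nlinarith [norm_nonneg X, ht.1, ht.2]

/-- The tuple `t X` as an element of the operatorial ball, for `0 ≤ t < 1` and `‖X‖ ≤ 1`. -/
def shrink {t : ℝ} (ht : t ∈ Set.Ico (0 : ℝ) 1) {X : RowOp ι K} (hX : ‖X‖ ≤ 1) : OpBall ι K :=
  ⟨(t : ℂ) • X, mem_opBall (norm_shrink_lt ht hX)⟩

omit [CompleteSpace K] in
theorem lift_entry_shrink {t : ℝ} (ht : t ∈ Set.Ico (0 : ℝ) 1) {X : RowOp ι K} (hX : ‖X‖ ≤ 1)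
    (α : FreeMonoid ι) : FreeMonoid.lift (entry (shrink ht hX).1) α =
      (t : ℂ) ^ α.length • FreeMonoid.lift (entry X) α :=
  lift_smul (t : ℂ) (entry X) α

omit [CompleteSpace K] in
theorem HasFreeSum.tendsto_map {E : Type*} [NormedAddCommGroup E] [NormedSpace ℂ E]
    {a : FreeMonoid ι → ℂ} {X : ι → K →L[ℂ] K} {Y : K →L[ℂ] K} (h : HasFreeSum a X Y)
    (φ : (K →L[ℂ] K) →L[ℂ] E) :
    Filter.Tendsto (fun N : ℕ => ∑ k ∈ Finset.range N,
      ∑' α : {α : FreeMonoid ι // α.length = k}, a α.1 • φ (FreeMonoid.lift X α.1))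
      Filter.atTop (nhds (φ Y)) := by
  refine ((φ.continuous.tendsto Y).comp h.2).congr fun N => ?_
  rw [Function.comp_apply, map_sum]
  refine Finset.sum_congr rfl fun k _ => ?_
  rw [φ.map_tsum (h.1 k)]
  simp only [map_smul]

omit [CompleteSpace K] in
/-- A functional that is nonzero on a single word computes the coefficient of that word. -/
theorem HasFreeSum.map_eq {a : FreeMonoid ι → ℂ} {X : ι → K →L[ℂ] K} {Y : K →L[ℂ] K}
    (h : HasFreeSum a X Y) (φ : (K →L[ℂ] K) →L[ℂ] ℂ) (α : FreeMonoid ι)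
    (hφ : ∀ β, β ≠ α → φ (FreeMonoid.lift X β) = 0) :
    φ Y = a α * φ (FreeMonoid.lift X α) := by
  refine tendsto_nhds_unique (h.tendsto_map φ) ?_
  refine tendsto_const_nhds.congr' ?_
  filter_upwards [Filter.eventually_gt_atTop α.length] with N hN
  rw [Finset.sum_eq_single_of_mem α.length (Finset.mem_range.2 hN), tsum_eq_single ⟨α, rfl⟩]
  · rfl
  · intro β hβ
    rw [hφ β.1 fun h => hβ (Subtype.ext h), smul_zero]
  · intro k _ hk
    convert tsum_zero with β
    rw [hφ β.1 fun h => hk (by rw [← β.2, h]), smul_zero]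

/-- The vector of coefficients of an operator with respect to transported creation operators. -/
def coeffVec (W : Fock ι ≃ₗᵢ[ℂ] K) (Y : K →L[ℂ] K) : Fock ι := W.symm (Y (W (basisVec 1)))

omit [CompleteSpace K] in
theorem norm_coeffVec_le (W : Fock ι ≃ₗᵢ[ℂ] K) (Y : K →L[ℂ] K) : ‖coeffVec W Y‖ ≤ ‖Y‖ := by
  rw [coeffVec, LinearIsometryEquiv.norm_map]
  simpa [norm_basisVec] using Y.le_opNorm (W (basisVec 1))

/-- The word `β` in the creation operators sends `e_1` to `e_β`, so the matrix entry between `e_1`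
and `e_α` sees only the word `α`. -/
theorem HasFreeSum.coeffVec_apply {W : Fock ι ≃ₗᵢ[ℂ] K} {t : ℝ} {a : FreeMonoid ι → ℂ}
    {Y : K →L[ℂ] K} (h : HasFreeSum a (fun i => (t : ℂ) • entry (shiftRow W) i) Y)
    (α : FreeMonoid ι) : coeffVec W Y α = (t : ℂ) ^ α.length * a α := by
  classical
  let φ : (K →L[ℂ] K) →L[ℂ] ℂ :=
    innerSL ℂ (W (basisVec α)) ∘L ContinuousLinearMap.apply ℂ K (W (basisVec 1))
  have hφ (Z : K →L[ℂ] K) : φ Z = coeffVec W Z α := by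
    rw [← inner_basisVec_left, coeffVec, ← W.inner_map_map, W.apply_symm_apply]
    rfl
  have hw (β : FreeMonoid ι) :
      φ (FreeMonoid.lift (fun i => (t : ℂ) • entry (shiftRow W) i) β) =
        (t : ℂ) ^ β.length * if β = α then 1 else 0 := by
    rw [hφ, coeffVec, lift_smul, smul_apply, lift_entry_shiftRow_apply, map_smul,
      W.symm_apply_apply, mul_one, lp.coeFn_smul, Pi.smul_apply, basisVec_apply, smul_eq_mul]
  rw [← hφ, h.map_eq φ α fun β hβ => by rw [hw, if_neg hβ, mul_zero], hw, if_pos rfl]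
  ring

theorem hasFreeSum_ev_shrink {t : ℝ} (ht : t ∈ Set.Ico (0 : ℝ) 1) {X : RowOp ι K} (hX : ‖X‖ ≤ 1)
    (a : Fock ι) : HasFreeSum a (fun i => (t : ℂ) • entry X i) (ev (shrink ht hX) a) :=
  hasFreeSum_ev (shrink ht hX) a

theorem coeffVec_ev_shrink {W : Fock ι ≃ₗᵢ[ℂ] K} {t : ℝ} (ht : t ∈ Set.Ico (0 : ℝ) 1)
    (a : Fock ι) (α : FreeMonoid ι) :
    coeffVec W (ev (shrink ht (norm_shiftRow_le W)) a) α = (t : ℂ) ^ α.length * a α :=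
  (hasFreeSum_ev_shrink ht (norm_shiftRow_le W) a).coeffVec_apply α

theorem HasSum.congr_terms {κ E : Type*} [AddCommMonoid E] [TopologicalSpace E] {f g : κ → E} {x : E}
    (hg : HasSum g x) (h : ∀ k, f k = g k) : HasSum f x :=
  (funext h : f = g) ▸ hg

/-- Multiplying a power series on the left by `X_α` shifts its coefficients, which is the action of
`S_α` on the Fock space. -/
theorem lift_entry_comp_ev (W : Fock ι ≃ₗᵢ[ℂ] K) (X : OpBall ι K) (α : FreeMonoid ι) (b : Fock ι) :
    FreeMonoid.lift (entry X.1) α * ev X b =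
      ev X (W.symm (FreeMonoid.lift (entry (shiftRow W)) α (W b))) := by
  have h1 := (hasSum_ev X b).mul_left (FreeMonoid.lift (entry X.1) α)
  have h2 := ((((hasSum_basisVec b).mapL (W.toContinuousLinearEquiv : Fock ι →L[ℂ] K)).mapL
    (FreeMonoid.lift (entry (shiftRow W)) α)).mapL
      (W.symm.toContinuousLinearEquiv : K →L[ℂ] Fock ι)).mapL (ev X)
  refine h1.unique (h2.congr_terms fun β => ?_)
  change _ = ev X (W.symm (FreeMonoid.lift (entry (shiftRow W)) α (W (b β • basisVec β))))
  rw [map_smul, map_smul, lift_entry_shiftRow_apply, map_smul, W.symm_apply_apply, map_smul,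
    ev_basisVec, map_mul, mul_smul_comm]

/-- Multiplication of power series. -/
theorem ev_shrink_mul_ev (W : Fock ι ≃ₗᵢ[ℂ] K) {t : ℝ} (ht : t ∈ Set.Ico (0 : ℝ) 1)
    (X : OpBall ι K) (a b : Fock ι) :
    ev (shrink ht (norm_opBall_lt X).le) a * ev X b =
      ev X (W.symm (ev (shrink ht (norm_shiftRow_le W)) a (W b))) := by
  have h1 := (hasSum_ev (shrink ht (norm_opBall_lt X).le) a).mul_right (ev X b)
  have h2 := (((hasSum_ev (shrink ht (norm_shiftRow_le W)) a).mapL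
    (ContinuousLinearMap.apply ℂ K (W b))).mapL
      (W.symm.toContinuousLinearEquiv : K →L[ℂ] Fock ι)).mapL (ev X)
  refine h1.unique (h2.congr_terms fun α => ?_)
  change _ = ev X (W.symm ((a α • FreeMonoid.lift (entry (shrink ht (norm_shiftRow_le W)).1) α)
    (W b)))
  rw [lift_entry_shrink, lift_entry_shrink, smul_apply, smul_apply, map_smul, map_smul, map_smul,
    map_smul, ← lift_entry_comp_ev, smul_mul_assoc, smul_mul_assoc]

/-- A family of coefficients all of whose dilations are bounded by `C` is bounded by `C`. -/
theorem exists_fock_of_dilate {d : FreeMonoid ι → ℂ} {C : ℝ}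
    (h : ∀ t ∈ Set.Ioo (0 : ℝ) 1, ∃ c : Fock ι, ‖c‖ ≤ C ∧ ∀ α, c α = (t : ℂ) ^ α.length * d α) :
    ∃ a : Fock ι, (∀ α, a α = d α) ∧ ‖a‖ ≤ C := by
  have hC : 0 ≤ C := by
    obtain ⟨c, hc, -⟩ := h (1 / 2) (by norm_num)
    exact (norm_nonneg c).trans hc
  have hs (s : Finset (FreeMonoid ι)) : ∑ α ∈ s, ‖d α‖ ^ 2 ≤ C ^ 2 := by
    have hcont : Filter.Tendsto (fun t : ℝ => ∑ α ∈ s, (t ^ α.length * ‖d α‖) ^ 2)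
        (nhdsWithin 1 (Set.Iio 1)) (nhds (∑ α ∈ s, ((1 : ℝ) ^ α.length * ‖d α‖) ^ 2)) := by
      -- A finite sum is continuous in `t`, so its bound survives `t → 1⁻`; the full `ℓ²` bound then
      -- follows over finite sets.
      refine Filter.Tendsto.mono_left (Continuous.tendsto ?_ 1) nhdsWithin_le_nhds
      fun_prop
    simp only [one_pow, one_mul] at hcont
    refine le_of_tendsto hcont ?_
    filter_upwards [Ioo_mem_nhdsLT (zero_lt_one' ℝ)] with t ht
    obtain ⟨c, hc, hct⟩ := h t ht
    calc _ = ∑ α ∈ s, ‖c α‖ ^ 2 := Finset.sum_congr rfl fun α _ => by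
          rw [hct, norm_mul, norm_pow, Complex.norm_real, Real.norm_of_nonneg ht.1.le]
      _ ≤ ‖c‖ ^ 2 := c.sum_sq_le s
      _ ≤ C ^ 2 := by gcongr
  have hm : Memℓp d 2 := memℓp_gen' (C := C ^ 2) fun s => by simpa using hs s
  refine ⟨⟨d, hm⟩, fun _ => rfl, ?_⟩
  rw [← sq_le_sq₀ (norm_nonneg _) hC, EllTwo.norm_sq]
  exact (EllTwo.summable_sq (⟨d, hm⟩ : Fock ι)).tsum_le_of_sum_le hs

/-- The coefficients of a bounded free holomorphic function are square summable. -/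
theorem Represents.exists_fock (W : Fock ι ≃ₗᵢ[ℂ] K) {a : FreeMonoid ι → ℂ}
    {f : OpBall ι K → K →L[ℂ] K} (h : Represents a f) {C : ℝ} (hf : ∀ X, ‖f X‖ ≤ C) :
    ∃ b : Fock ι, (∀ α, b α = a α) ∧ ‖b‖ ≤ C := by
  refine exists_fock_of_dilate fun t ht => ?_
  have ht' := Set.Ioo_subset_Ico_self ht
  refine ⟨coeffVec W (f (shrink ht' (norm_shiftRow_le W))), (norm_coeffVec_le W _).trans (hf _),
    (h (shrink ht' (norm_shiftRow_le W))).coeffVec_apply⟩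

omit [CompleteSpace K] in
theorem norm_entry_opBall_le (X : OpBall ι K) (i : ι) : ‖entry X.1 i‖ ≤ 1 :=
  (norm_entry_le X.1 i).trans (norm_opBall_lt X).le

theorem isFreeHolomorphic_of_ev {F : OpBall ι K → OpBall ι K} (a : ι → Fock ι)
    (h : ∀ X j, entry (F X).1 j = ev X (a j)) : IsFreeHolomorphic F := fun j =>
  ⟨a j, fun X => by
    change HasFreeSum _ _ (entry (F X).1 j)
    rw [h]
    exact hasFreeSum_ev X (a j)⟩

theorem IsFreeHolomorphic.exists_ev (W : Fock ι ≃ₗᵢ[ℂ] K) {F : OpBall ι K → OpBall ι K}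
    (hF : IsFreeHolomorphic F) :
    ∃ a : ι → Fock ι, (∀ X j, entry (F X).1 j = ev X (a j)) ∧ ∀ j, ‖a j‖ ≤ 1 := by
  have h (j : ι) : ∃ a : Fock ι, (∀ X, entry (F X).1 j = ev X a) ∧ ‖a‖ ≤ 1 := by
    obtain ⟨a, ha⟩ := hF j
    obtain ⟨b, hb, hb1⟩ := ha.exists_fock W fun X => norm_entry_opBall_le (F X) j
    refine ⟨b, fun X => (ha X).unique ?_, hb1⟩
    have := hasFreeSum_ev X b
    rwa [show (b : FreeMonoid ι → ℂ) = a from funext hb] at this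
  choose a ha using h
  exact ⟨a, fun X j => (ha j).1 X, fun j => (ha j).2⟩

/-- The coefficients of `X ↦ f(G(tX))` are found by evaluating at the creation operators. The
dilation is needed because `t S` lies in the open ball while membership of `S` itself is not
available. -/
theorem ev_comp (W : Fock ι ≃ₗᵢ[ℂ] K) {G : OpBall ι K → OpBall ι K} {b : ι → Fock ι}
    (hG : ∀ X j, entry (G X).1 j = ev X (b j)) {t : ℝ} (ht : t ∈ Set.Ico (0 : ℝ) 1)
    (X : OpBall ι K) (a : Fock ι) :
    ev (G (shrink ht (norm_opBall_lt X).le)) a =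
      ev X (coeffVec W (ev (G (shrink ht (norm_shiftRow_le W))) a)) := by
  let f : Fock ι →L[ℂ] K →L[ℂ] K :=
    ev X ∘L (W.symm.toContinuousLinearEquiv : K →L[ℂ] Fock ι) ∘L ContinuousLinearMap.apply ℂ K (W (basisVec 1)) ∘L
      ev (G (shrink ht (norm_shiftRow_le W)))
  suffices ev (G (shrink ht (norm_opBall_lt X).le)) = f from congr($this a)
  -- Both sides are bounded and linear in `a`, which leaves single words; there the claim is
  -- multiplicativity, one letter at a time.
  refine ext_basisVec fun α => ?_
  change _ = ev X (W.symm (ev (G (shrink ht (norm_shiftRow_le W))) (basisVec α) (W (basisVec 1))))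
  rw [ev_basisVec, ev_basisVec]
  induction α using FreeMonoid.inductionOn' with
  | one => simp
  | of_mul i α ih =>
    rw [map_mul, map_mul, FreeMonoid.lift_eval_of, FreeMonoid.lift_eval_of, ih,
      mul_apply_eq_comp, hG, hG,
      ev_shrink_mul_ev W, W.apply_symm_apply]

/-- Let `c_t` be the coefficients of `X ↦ F_j(G(tX))`. They satisfy `c_{ts}(α) = s^|α| c_t(α)`, so
`c_t(α) = t^|α| d_α` for a single family `d`; the bound `‖c_t‖ ≤ 1` puts `d` in the Fock space. -/
theorem IsFreeHolomorphic.comp (W : Fock ι ≃ₗᵢ[ℂ] K) {F G : OpBall ι K → OpBall ι K}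
    (hF : IsFreeHolomorphic F) (hG : IsFreeHolomorphic G) : IsFreeHolomorphic (F ∘ G) := by
  obtain ⟨a, ha, -⟩ := hF.exists_ev W
  obtain ⟨b, hb, -⟩ := hG.exists_ev W
  have key (j : ι) : ∃ d : Fock ι, ∀ X, entry (F (G X)).1 j = ev X d := by
    let c {t : ℝ} (ht : t ∈ Set.Ico (0 : ℝ) 1) : Fock ι :=
      coeffVec W (ev (G (shrink ht (norm_shiftRow_le W))) (a j))
    have hc1 {t : ℝ} (ht : t ∈ Set.Ico (0 : ℝ) 1) : ‖c ht‖ ≤ 1 := by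
      refine (norm_coeffVec_le W _).trans ?_
      rw [← ha]
      exact norm_entry_opBall_le _ j
    have hmul {t s r : ℝ} (ht : t ∈ Set.Ico (0 : ℝ) 1) (hs : s ∈ Set.Ico (0 : ℝ) 1)
        (hr : r ∈ Set.Ico (0 : ℝ) 1) (hrs : r = t * s) (α : FreeMonoid ι) :
        c hr α = (s : ℂ) ^ α.length * c ht α := by
      rw [← coeffVec_ev_shrink (W := W) hs, ← ev_comp W hb ht]
      have : shrink hr (norm_shiftRow_le W) =
          shrink ht (norm_opBall_lt (shrink hs (norm_shiftRow_le W))).le := by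
        ext1
        simp only [shrink, smul_smul, hrs, Complex.ofReal_mul]
      rw [← this]
    -- Any base point in `(0, 1)` would serve to normalise `d`; the three cases below compare `t`
    -- with it, since the dilation rule only goes from a larger parameter to a smaller one.
    have hhalf : (1 / 2 : ℝ) ∈ Set.Ico (0 : ℝ) 1 := by norm_num
    let d (α : FreeMonoid ι) : ℂ := 2 ^ α.length * c hhalf α
    have hd {t : ℝ} (ht : t ∈ Set.Ioo (0 : ℝ) 1) (α : FreeMonoid ι) :
        c (Set.Ioo_subset_Ico_self ht) α = (t : ℂ) ^ α.length * d α := by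
      have ht0 : (t : ℂ) ≠ 0 := Complex.ofReal_ne_zero.2 ht.1.ne'
      have ht' := Set.Ioo_subset_Ico_self ht
      rcases lt_trichotomy t (1 / 2) with h | h | h
      · rw [hmul hhalf (s := 2 * t) ⟨by linarith [ht.1], by linarith⟩ ht' (by ring)]
        simp only [d, Complex.ofReal_mul, mul_pow, Complex.ofReal_ofNat]
        ring
      · subst h
        simp only [d, ← mul_assoc, ← mul_pow]
        norm_num
      · simp only [d]
        rw [hmul ht' (s := 1 / (2 * t)) (r := 1 / 2) ⟨by have := ht.1; positivity, by
          rw [div_lt_one (by linarith)]; linarith⟩ hhalf (by have := ht.1; field_simp)]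
        rw [← mul_assoc, ← mul_assoc, ← mul_pow, ← mul_pow]
        push_cast
        rw [show (t : ℂ) * 2 * (1 / (2 * t)) = 1 by field_simp, one_pow, one_mul]
    obtain ⟨d', hd', -⟩ := exists_fock_of_dilate (d := d) (C := 1) fun t ht =>
      ⟨c (Set.Ioo_subset_Ico_self ht), hc1 _, hd ht⟩
    refine ⟨d', fun X => ?_⟩
    -- With `‖X‖ < t < 1`, the point `Y = t⁻¹ X` is still in the ball, and `c_t(α) Y_α = d_α X_α`.
    obtain ⟨t, ht1, ht2⟩ := exists_between (norm_opBall_lt X)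
    have ht0 : 0 < t := (norm_nonneg X.1).trans_lt ht1
    have ht : t ∈ Set.Ioo (0 : ℝ) 1 := ⟨ht0, ht2⟩
    have ht' := Set.Ioo_subset_Ico_self ht
    have htC : (t : ℂ) ≠ 0 := Complex.ofReal_ne_zero.2 ht0.ne'
    let Y : OpBall ι K := ⟨(t : ℂ)⁻¹ • X.1, mem_opBall (by
      refine (opNorm_smul_le (t : ℂ)⁻¹ X.1).trans_lt ?_
      rw [norm_inv, Complex.norm_real, Real.norm_of_nonneg ht0.le, inv_mul_lt_iff₀ ht0]
      simpa using ht1)⟩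
    have hXY : shrink ht' (norm_opBall_lt Y).le = X := by
      ext1
      simp only [shrink, Y, smul_smul, mul_inv_cancel₀ htC, one_smul]
    rw [ha]
    nth_rewrite 1 [← hXY]
    rw [ev_comp W hb ht']
    refine (hasSum_ev Y _).unique ?_
    convert hasSum_ev X d' using 2 with α
    have hα : FreeMonoid.lift (entry X.1) α =
        (t : ℂ) ^ α.length • FreeMonoid.lift (entry Y.1) α := by
      rw [← lift_entry_shrink ht' (norm_opBall_lt Y).le, hXY]
    rw [hα, smul_smul, hd', mul_comm (d α), ← hd ht α]
  choose d hd using key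
  exact isFreeHolomorphic_of_ev d fun X j => hd j X

theorem isFreeHolomorphic_id : IsFreeHolomorphic (id : OpBall ι K → OpBall ι K) :=
  isFreeHolomorphic_of_ev (fun j => basisVec (FreeMonoid.of j)) fun X j => by
    rw [ev_basisVec, FreeMonoid.lift_eval_of, id]

/-- `Aut(B(H)ⁿ₁)` as a group under composition. -/
def freeAutGroup (W : Fock ι ≃ₗᵢ[ℂ] K) : Subgroup (Equiv.Perm (OpBall ι K)) where
  carrier := freeAut ι K
  mul_mem' := fun ha hb => ⟨ha.1.comp W hb.1, hb.2.comp W ha.2⟩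
  one_mem' := ⟨isFreeHolomorphic_id, isFreeHolomorphic_id⟩
  inv_mem' := fun ha => ⟨ha.2, ha.1⟩

end Shifts

/-! ### The Fock space as a model of `H`. -/

noncomputable section Identification

open scoped InnerProductSpace

/-- Distinct orthonormal vectors are at distance `√2 > 1`, so the balls of radius `1/2` around them
are disjoint open sets in a separable space. -/
theorem Orthonormal.countable_index {κ H : Type*} [NormedAddCommGroup H] [InnerProductSpace ℂ H]
    [TopologicalSpace.SeparableSpace H] {v : κ → H} (hv : Orthonormal ℂ v) : Countable κ := by
  have hdist {i j : κ} (hij : i ≠ j) : 1 < dist (v i) (v j) := by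
    have h : ‖v i - v j‖ * ‖v i - v j‖ = 2 := by
      rw [norm_sub_mul_self (𝕜 := ℂ), hv.2 hij, hv.1, hv.1]
      norm_num
    rw [dist_eq_norm]
    nlinarith [norm_nonneg (v i - v j)]
  have hdisj : Pairwise (Function.onFun Disjoint fun i => Metric.ball (v i) (1 / 2)) :=
    fun i j hij => Metric.ball_disjoint_ball (by linarith [hdist hij])
  have := Set.PairwiseDisjoint.countable_of_isOpen (s := fun i => Metric.ball (v i) (1 / 2))
    (a := Set.univ) (fun i _ j _ hij => hdisj hij) (fun i _ => Metric.isOpen_ball)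
    (fun i _ => ⟨v i, Metric.mem_ball_self (by norm_num)⟩)
  exact Set.countable_univ_iff.1 this

/-- Every infinite-dimensional separable Hilbert space is isometrically isomorphic to the full Fock
space. -/
theorem exists_fock_equiv (ι : Type*) [Countable ι] [Nonempty ι]
    {H : Type*} [NormedAddCommGroup H] [InnerProductSpace ℂ H] [CompleteSpace H]
    [TopologicalSpace.SeparableSpace H] (hH : ¬ FiniteDimensional ℂ H) :
    Nonempty (Fock ι ≃ₗᵢ[ℂ] H) := by
  obtain ⟨w, b, -⟩ := exists_hilbertBasis ℂ H
  have : Countable w := b.orthonormal.countable_index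
  have : Infinite w := by
    by_contra hfin
    rw [not_infinite_iff_finite] at hfin
    have := Fintype.ofFinite w
    exact hH b.toOrthonormalBasis.toBasis.finiteDimensional_of_finite
  have : Countable (FreeMonoid ι) := inferInstanceAs (Countable (List ι))
  have : Infinite (FreeMonoid ι) := inferInstanceAs (Infinite (List ι))
  obtain ⟨e⟩ := nonempty_equiv_of_countable (α := FreeMonoid ι) (β := w)
  have hsp : ⊤ ≤ (Submodule.span ℂ (Set.range (b ∘ e))).topologicalClosure := by
    rw [e.surjective.range_comp, b.dense_span]
  exact ⟨(HilbertBasis.mk (b.orthonormal.comp e e.injective) hsp).repr.symm⟩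

end Identification

/-! ### The involutions of the operatorial ball. -/

noncomputable section Moebius

open ContinuousLinearMap

open scoped InnerProductSpace

variable {ι : Type*} {K : Type*} [NormedAddCommGroup K] [InnerProductSpace ℂ K] [CompleteSpace K]

theorem inner_star_star (v w : EllTwo ι) : ⟪star v, star w⟫_ℂ = ⟪w, v⟫_ℂ := by
  refine (lp.hasSum_inner (𝕜 := ℂ) (star v) (star w)).unique
    ((lp.hasSum_inner (𝕜 := ℂ) w v).congr_terms fun i => ?_)
  simp [RCLike.inner_apply, mul_comm]

theorem scalarRow_comp_column_star (z l : EllTwo ι) :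
    (scalarRow z : RowOp ι K) ∘L column (star l) = ⟪l, z⟫_ℂ • (1 : K →L[ℂ] K) := by
  ext y
  refine ext_inner_left ℂ fun x => ?_
  rw [comp_apply, ← adjoint_inner_left, adjoint_scalarRow, inner_column, inner_star_star]
  simp [inner_smul_right]

theorem norm_scalarRow_le (l : EllTwo ι) : ‖(scalarRow l : RowOp ι K)‖ ≤ ‖l‖ := by
  rw [scalarRow, LinearIsometryEquiv.norm_map, ← norm_star l]
  exact norm_column_le _

/-- The scalar `(1 - ‖l‖²)^(1/2)`. -/
def defectNorm (l : EllTwo ι) : ℝ := √(1 - ‖l‖ ^ 2)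

theorem defectNorm_nonneg (l : EllTwo ι) : 0 ≤ defectNorm l := Real.sqrt_nonneg _

theorem defectNorm_sq {l : EllTwo ι} (hl : ‖l‖ < 1) : defectNorm l ^ 2 = 1 - ‖l‖ ^ 2 :=
  Real.sq_sqrt (by nlinarith [norm_nonneg l])

/-- The scalar `(1 + (1 - ‖l‖²)^(1/2))⁻¹`. -/
def defectCoeff (l : EllTwo ι) : ℝ := (1 + defectNorm l)⁻¹

theorem defectCoeff_mul (l : EllTwo ι) : defectCoeff l * (1 + defectNorm l) = 1 :=
  inv_mul_cancel₀ (by have := defectNorm_nonneg l; positivity)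

theorem defectCoeff_mul_norm_sq {l : EllTwo ι} (hl : ‖l‖ < 1) :
    defectCoeff l * ‖l‖ ^ 2 = 1 - defectNorm l := by
  have h1 := defectCoeff_mul l
  have h2 := defectNorm_sq hl
  linear_combination (1 - defectNorm l) * h1 + defectCoeff l * h2

/-- The operator `L* L` on the direct sum, where `L` is the row of scalars `l`. -/
def rowGram (K : Type*) [NormedAddCommGroup K] [InnerProductSpace ℂ K] [CompleteSpace K]
    (l : EllTwo ι) : Ampl ι K →L[ℂ] Ampl ι K :=
  column (star l) ∘L scalarRow l

theorem scalarRow_column_star_apply (l : EllTwo ι) (x : K) :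
    (scalarRow l : RowOp ι K) (column (star l) x) = ((‖l‖ ^ 2 : ℝ) : ℂ) • x := by
  have h := congr($(scalarRow_comp_column_star (K := K) l l) x)
  have h2 := inner_self_eq_norm_sq_to_K (𝕜 := ℂ) l
  rw [h2] at h
  simpa using h

theorem rowGram_rowGram (l : EllTwo ι) (v : Ampl ι K) :
    rowGram K l (rowGram K l v) = ((‖l‖ ^ 2 : ℝ) : ℂ) • rowGram K l v := by
  change column (star l) (scalarRow l (column (star l) (scalarRow l v))) = _
  rw [scalarRow_column_star_apply, map_smul]
  rfl

theorem inner_rowGram_left (l : EllTwo ι) (v w : Ampl ι K) :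
    ⟪rowGram K l v, w⟫_ℂ = ⟪scalarRow l v, scalarRow l w⟫_ℂ := by
  rw [rowGram, comp_apply, ← adjoint_scalarRow, adjoint_inner_left]

theorem inner_rowGram_right (l : EllTwo ι) (v w : Ampl ι K) :
    ⟪v, rowGram K l w⟫_ℂ = ⟪scalarRow l v, scalarRow l w⟫_ℂ := by
  rw [rowGram, comp_apply, ← adjoint_scalarRow, adjoint_inner_right]

/-- Since `(L* L)² = ‖l‖² L* L`, the square of `1 - c L* L` is `1 - L* L` as soon as `c (2 - c ‖l‖²)
= 1`. For `c = (1 + s)⁻¹` this holds because `c ‖l‖² = 1 - s`, which also gives positivity. -/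
theorem opSqrt_one_sub_rowGram {l : EllTwo ι} (hl : ‖l‖ < 1) :
    opSqrt (1 - rowGram K l) = 1 - (defectCoeff l : ℂ) • rowGram K l := by
  refine CFC.sqrt_unique ?_ ?_
  · ext1 v
    change (v - (defectCoeff l : ℂ) • rowGram K l v) -
      (defectCoeff l : ℂ) • rowGram K l (v - (defectCoeff l : ℂ) • rowGram K l v) =
        v - rowGram K l v
    rw [map_sub, map_smul, rowGram_rowGram]
    have h1 := defectCoeff_mul l
    have h2 := defectCoeff_mul_norm_sq hl
    have h3 : (defectCoeff l : ℂ) * (2 - defectCoeff l * ((‖l‖ ^ 2 : ℝ) : ℂ)) = 1 := by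
      rw [← Complex.ofReal_mul, h2]
      have : defectCoeff l * (2 - (1 - defectNorm l)) = 1 := by linear_combination h1
      exact_mod_cast this
    linear_combination (norm := module) -(h3 • (rowGram K l v))
  · rw [nonneg_iff_isPositive]
    have hc : 0 ≤ defectCoeff l := inv_nonneg.2 (by have := defectNorm_nonneg l; positivity)
    refine ⟨?_, fun v => ?_⟩
    · intro v w
      change ⟪v - (defectCoeff l : ℂ) • rowGram K l v, w⟫_ℂ =
        ⟪v, w - (defectCoeff l : ℂ) • rowGram K l w⟫_ℂ
      rw [inner_sub_left, inner_sub_right, inner_smul_left, inner_smul_right, inner_rowGram_left,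
        inner_rowGram_right, Complex.conj_ofReal]
    · change 0 ≤ RCLike.re ⟪v - (defectCoeff l : ℂ) • rowGram K l v, v⟫_ℂ
      have h1 := inner_self_eq_norm_sq_to_K (𝕜 := ℂ) v
      have h2 := inner_self_eq_norm_sq_to_K (𝕜 := ℂ) ((scalarRow l : RowOp ι K) v)
      rw [inner_sub_left, inner_smul_left, inner_rowGram_left, h1, h2, Complex.conj_ofReal]
      have h3 : ‖(scalarRow l : RowOp ι K) v‖ ^ 2 ≤ ‖l‖ ^ 2 * ‖v‖ ^ 2 := by
        rw [← mul_pow]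
        gcongr
        exact ((scalarRow l : RowOp ι K).le_opNorm v).trans (by gcongr; exact norm_scalarRow_le l)
      have h4 : defectCoeff l * ‖(scalarRow l : RowOp ι K) v‖ ^ 2 ≤
          (1 - defectNorm l) * ‖v‖ ^ 2 := by
        rw [← defectCoeff_mul_norm_sq hl, mul_assoc]
        gcongr
      have h5 : 0 ≤ ‖v‖ ^ 2 - defectCoeff l * ‖(scalarRow l : RowOp ι K) v‖ ^ 2 := by
        nlinarith [defectNorm_nonneg l, sq_nonneg ‖v‖]
      have h6 : ((RCLike.ofReal ‖v‖ : ℂ) ^ 2 - (defectCoeff l : ℂ) *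
          (RCLike.ofReal ‖(scalarRow l : RowOp ι K) v‖ : ℂ) ^ 2) =
          ((‖v‖ ^ 2 - defectCoeff l * ‖(scalarRow l : RowOp ι K) v‖ ^ 2 : ℝ) : ℂ) := by
        push_cast
        rfl
      rw [h6]
      simpa only [RCLike.re_to_complex, Complex.ofReal_re] using h5

/-- The operator `E = s + (1 + s)⁻¹ L* L`, with `s = (1 - ‖l‖²)^(1/2)`. -/
def moebiusDefect (K : Type*) [NormedAddCommGroup K] [InnerProductSpace ℂ K] [CompleteSpace K]
    (l : EllTwo ι) : Ampl ι K →L[ℂ] Ampl ι K :=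
  (defectNorm l : ℂ) • 1 + (defectCoeff l : ℂ) • rowGram K l

theorem moebiusDefect_apply (l : EllTwo ι) (v : Ampl ι K) : moebiusDefect K l v =
    (defectNorm l : ℂ) • v + (defectCoeff l : ℂ) • column (star l) (scalarRow l v) := rfl

theorem defectNorm_add {l : EllTwo ι} (hl : ‖l‖ < 1) :
    (defectNorm l : ℂ) + defectCoeff l * ((‖l‖ ^ 2 : ℝ) : ℂ) = 1 := by
  rw [← Complex.ofReal_mul, defectCoeff_mul_norm_sq hl]
  push_cast
  ring

theorem scalarRow_moebiusDefect {l : EllTwo ι} (hl : ‖l‖ < 1) (v : Ampl ι K) :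
    (scalarRow l : RowOp ι K) (moebiusDefect K l v) = scalarRow l v := by
  rw [moebiusDefect_apply, map_add, map_smul, map_smul, scalarRow_column_star_apply, smul_smul,
    ← add_smul, defectNorm_add hl, one_smul]

theorem moebiusDefect_column_star {l : EllTwo ι} (hl : ‖l‖ < 1) (x : K) :
    moebiusDefect K l (column (star l) x) = column (star l) x := by
  rw [moebiusDefect_apply, scalarRow_column_star_apply, map_smul, smul_smul, ← add_smul,
    defectNorm_add hl, one_smul]

theorem moebiusDefect_moebiusDefect {l : EllTwo ι} (hl : ‖l‖ < 1) (v : Ampl ι K) :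
    moebiusDefect K l (moebiusDefect K l v) =
      ((1 - ‖l‖ ^ 2 : ℝ) : ℂ) • v + column (star l) (scalarRow l v) := by
  have h1 : (defectCoeff l : ℂ) * (1 + defectNorm l) = 1 := by exact_mod_cast defectCoeff_mul l
  have h2 : ((1 - ‖l‖ ^ 2 : ℝ) : ℂ) = (defectNorm l : ℂ) ^ 2 := by
    exact_mod_cast (defectNorm_sq hl).symm
  rw [moebiusDefect_apply, scalarRow_moebiusDefect hl, moebiusDefect_apply, h2]
  linear_combination (norm := module) h1 • (column (star l) ((scalarRow l : RowOp ι K) v))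

theorem inner_moebiusDefect_left (l : EllTwo ι) (v w : Ampl ι K) :
    ⟪moebiusDefect K l v, w⟫_ℂ = ⟪v, moebiusDefect K l w⟫_ℂ := by
  change ⟪(defectNorm l : ℂ) • v + (defectCoeff l : ℂ) • rowGram K l v, w⟫_ℂ =
    ⟪v, (defectNorm l : ℂ) • w + (defectCoeff l : ℂ) • rowGram K l w⟫_ℂ
  simp only [inner_add_left, inner_add_right, inner_smul_left, inner_smul_right,
    inner_rowGram_left, inner_rowGram_right, Complex.conj_ofReal]

omit [CompleteSpace K] in
theorem norm_comp_column_lt {l : EllTwo ι} (hl : ‖l‖ < 1) (X : OpBall ι K) :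
    ‖X.1 ∘L column (star l)‖ < 1 := by
  refine (opNorm_comp_le _ _).trans_lt ?_
  have h1 : ‖(column (star l) : K →L[ℂ] Ampl ι K)‖ ≤ ‖l‖ := by
    simpa using norm_column_le (K := K) (star l)
  nlinarith [norm_nonneg (column (star l) : K →L[ℂ] Ampl ι K), norm_nonneg X.1, norm_opBall_lt X]

theorem isUnit_one_sub_comp_column {l : EllTwo ι} (hl : ‖l‖ < 1) (X : OpBall ι K) :
    IsUnit (1 - X.1 ∘L column (star l)) :=
  isUnit_one_sub_of_norm_lt_one (norm_comp_column_lt hl X)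

omit [CompleteSpace K] in
theorem IsUnit.comp_left_cancel {E : Type*} [NormedAddCommGroup E] [NormedSpace ℂ E]
    {M : K →L[ℂ] K} (hM : IsUnit M) {A B : E →L[ℂ] K} (h : M ∘L A = M ∘L B) : A = B := by
  have := congr(Ring.inverse M ∘L $h)
  rwa [← comp_assoc, ← comp_assoc, ← mul_def, Ring.inverse_mul_cancel _ hM, one_def, id_comp,
    id_comp] at this

/-- The linear fractional equation that defines the involution. -/
theorem one_sub_comp_involution {l : EllTwo ι} (hl : ‖l‖ < 1) (X : OpBall ι K) :
    (1 - X.1 ∘L column (star l)) ∘L involution l X.1 =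
      scalarRow l - X.1 ∘L moebiusDefect K l := by
  have hM := isUnit_one_sub_comp_column hl X
  have h1 : opSqrt (1 - (scalarRow l : RowOp ι K) ∘L column (star l)) =
      (defectNorm l : ℂ) • 1 := by
    refine CFC.sqrt_unique ?_ ?_
    · ext1 x
      change (defectNorm l : ℂ) • (defectNorm l : ℂ) • x = x - scalarRow l (column (star l) x)
      have h : (defectNorm l : ℂ) ^ 2 = 1 - ((‖l‖ ^ 2 : ℝ) : ℂ) := by
        exact_mod_cast defectNorm_sq hl
      rw [scalarRow_column_star_apply]
      linear_combination (norm := module) h • x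
    · rw [nonneg_iff_isPositive]
      exact isPositive_one.smul_of_nonneg (Complex.zero_le_real.2 (defectNorm_nonneg l))
  have h2 : opSqrt (1 - column (star l) ∘L (scalarRow l : RowOp ι K)) =
      1 - (defectCoeff l : ℂ) • rowGram K l := opSqrt_one_sub_rowGram hl
  unfold involution
  simp only [adjoint_scalarRow]
  rw [h1, h2]
  set M := 1 - X.1 ∘L column (star l) with hMdef
  have h3 (y : K) : M (Ring.inverse M y) = y := by
    rw [← mul_apply_eq_comp, Ring.mul_inverse_cancel _ hM, one_apply_eq_self]
  ext1 v
  change M (scalarRow l v - (defectNorm l : ℂ) •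
    Ring.inverse M (X.1 (v - (defectCoeff l : ℂ) • column (star l) (scalarRow l v)))) =
      scalarRow l v - X.1 (moebiusDefect K l v)
  rw [map_sub, map_smul, h3, moebiusDefect_apply]
  change scalarRow l v - X.1 (column (star l) (scalarRow l v)) - _ = _
  simp only [map_add, map_sub, map_smul]
  have h1 : (defectCoeff l : ℂ) * (1 + defectNorm l) = 1 := by exact_mod_cast defectCoeff_mul l
  -- The coefficients of `X L* L` agree because `-1 + s c = -c`.
  linear_combination (norm := module) h1 • (X.1 (column (star l) ((scalarRow l : RowOp ι K) v)))

/-- With `M = 1 - X L*`, the reason is the identity `M (1 - Y Y*) M* = (1 - ‖l‖²)(1 - X X*)`, used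
as an equality of quadratic forms (`hid`). As `M*` is onto and bounded, the positive gap on the
right passes to `1 - Y Y*`. -/
theorem norm_involution_lt {l : EllTwo ι} (hl : ‖l‖ < 1) (X : OpBall ι K) :
    ‖involution l X.1‖ < 1 := by
  set L : RowOp ι K := scalarRow l with hL
  set M := 1 - X.1 ∘L column (star l) with hM
  set Y := involution l X.1 with hY
  have hs : 0 < 1 - ‖l‖ ^ 2 := by nlinarith [norm_nonneg l]
  have hXX : 0 < 1 - ‖X.1‖ ^ 2 := by nlinarith [norm_nonneg X.1, norm_opBall_lt X]
  have hadj : adjoint M = 1 - L ∘L adjoint X.1 := by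
    rw [hM, map_sub, adjoint_comp, ← adjoint_scalarRow, adjoint_adjoint, ← star_eq_adjoint,
      star_one]
  have hYM (k : K) : adjoint Y (adjoint M k) =
      column (star l) k - moebiusDefect K l (adjoint X.1 k) := by
    refine ext_inner_right ℂ fun v => ?_
    rw [adjoint_inner_left, adjoint_inner_left, ← comp_apply M Y, one_sub_comp_involution hl X]
    change ⟪k, L v - X.1 (moebiusDefect K l v)⟫_ℂ = _
    rw [inner_sub_right, inner_sub_left, inner_moebiusDefect_left, adjoint_inner_left,
      ← adjoint_scalarRow, adjoint_inner_left]
  have hsurj (h : K) : ∃ k, adjoint M k = h := by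
    obtain ⟨u, hu⟩ := (isUnit_one_sub_comp_column hl X).star
    refine ⟨(↑u⁻¹ : K →L[ℂ] K) h, ?_⟩
    rw [← star_eq_adjoint, ← hu, ← mul_apply_eq_comp, u.mul_inv, one_apply_eq_self]
  have hid (k : K) : ‖adjoint M k‖ ^ 2 - ‖adjoint Y (adjoint M k)‖ ^ 2 =
      (1 - ‖l‖ ^ 2) * (‖k‖ ^ 2 - ‖adjoint X.1 k‖ ^ 2) := by
    set p := adjoint X.1 k with hp
    have e1 : adjoint M k = k - L p := by rw [hadj]; rfl
    have e2 : RCLike.re ⟪column (star l) k, moebiusDefect K l p⟫_ℂ = RCLike.re ⟪k, L p⟫_ℂ := by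
      rw [← inner_moebiusDefect_left, moebiusDefect_column_star hl, ← adjoint_scalarRow,
        adjoint_inner_left]
    have e3 : ‖(column (star l) k : Ampl ι K)‖ ^ 2 = ‖l‖ ^ 2 * ‖k‖ ^ 2 := by
      rw [norm_column_apply, norm_star, mul_pow]
    have e4 : ‖moebiusDefect K l p‖ ^ 2 = (1 - ‖l‖ ^ 2) * ‖p‖ ^ 2 + ‖L p‖ ^ 2 := by
      have i1 := inner_self_eq_norm_sq_to_K (𝕜 := ℂ) (moebiusDefect K l p)
      have i2 := inner_self_eq_norm_sq_to_K (𝕜 := ℂ) p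
      have i3 := inner_self_eq_norm_sq_to_K (𝕜 := ℂ) (L p)
      have i4 : ⟪p, column (star l) (L p)⟫_ℂ = ⟪L p, L p⟫_ℂ := inner_rowGram_right l p p
      rw [inner_moebiusDefect_left, moebiusDefect_moebiusDefect hl, inner_add_right,
        inner_smul_right, i4, i2, i3] at i1
      refine Complex.ofReal_injective ?_
      push_cast at i1 ⊢
      exact i1.symm
    rw [hYM, e1, norm_sub_sq (𝕜 := ℂ), norm_sub_sq (𝕜 := ℂ), e2, e3, e4]
    ring
  -- The factor `4` comes from `‖M* k‖ ≤ 2 ‖k‖`.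
  set δ := (1 - ‖l‖ ^ 2) * (1 - ‖X.1‖ ^ 2) / 4 with hδ
  have hδ0 : 0 < δ := by positivity
  have hbound (h : K) : ‖adjoint Y h‖ ^ 2 ≤ (1 - δ) * ‖h‖ ^ 2 := by
    obtain ⟨k, rfl⟩ := hsurj h
    have h1 : ‖adjoint X.1 k‖ ≤ ‖X.1‖ * ‖k‖ := by simpa using (adjoint X.1).le_opNorm k
    have h2 : ‖adjoint M k‖ ≤ 2 * ‖k‖ := by
      have : adjoint M k = k - L (adjoint X.1 k) := by rw [hadj]; rfl
      rw [this]
      have h3 : ‖L (adjoint X.1 k)‖ ≤ 1 * ‖adjoint X.1 k‖ :=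
        L.le_of_opNorm_le ((norm_scalarRow_le l).trans hl.le) _
      have h4 := norm_sub_le k (L (adjoint X.1 k))
      nlinarith [norm_nonneg k, norm_opBall_lt X]
    have h3 : ‖adjoint X.1 k‖ ^ 2 ≤ ‖X.1‖ ^ 2 * ‖k‖ ^ 2 := by
      rw [← mul_pow]; gcongr
    have h4 : ‖adjoint M k‖ ^ 2 ≤ 4 * ‖k‖ ^ 2 := by
      calc _ ≤ (2 * ‖k‖) ^ 2 := by gcongr
        _ = _ := by ring
    have h5 : δ * ‖adjoint M k‖ ^ 2 ≤ (1 - ‖l‖ ^ 2) * (1 - ‖X.1‖ ^ 2) * ‖k‖ ^ 2 := by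
      calc _ ≤ δ * (4 * ‖k‖ ^ 2) := by gcongr
        _ = _ := by rw [hδ]; ring
    have h6 : (1 - ‖l‖ ^ 2) * (1 - ‖X.1‖ ^ 2) * ‖k‖ ^ 2 ≤
        (1 - ‖l‖ ^ 2) * (‖k‖ ^ 2 - ‖adjoint X.1 k‖ ^ 2) := by
      rw [mul_assoc]
      gcongr
      linarith
    linarith [hid k]
  have hδ1 : δ ≤ 1 := by
    have h1 : 1 - ‖l‖ ^ 2 ≤ 1 := by linarith [sq_nonneg ‖l‖]
    have h2 : 1 - ‖X.1‖ ^ 2 ≤ 1 := by linarith [sq_nonneg ‖X.1‖]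
    have := mul_le_mul h1 h2 hXX.le zero_le_one
    rw [hδ]; linarith
  have hle : ‖adjoint Y‖ ≤ √(1 - δ) := opNorm_le_bound _ (Real.sqrt_nonneg _) fun h => by
    rw [← Real.sqrt_sq (norm_nonneg h), ← Real.sqrt_mul' _ (by positivity)]
    exact Real.le_sqrt_of_sq_le (hbound h)
  rw [LinearIsometryEquiv.norm_map] at hle
  exact hle.trans_lt ((Real.sqrt_lt' one_pos).2 (by linarith))

/-- The involution as a self-map of the operatorial ball. -/
def ballInvolution {l : EllTwo ι} (hl : ‖l‖ < 1) (X : OpBall ι K) : OpBall ι K :=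
  ⟨involution l X.1, mem_opBall (norm_involution_lt hl X)⟩

theorem ballInvolution_eq {l : EllTwo ι} (hl : ‖l‖ < 1) {X Y : OpBall ι K}
    (h : (1 - X.1 ∘L column (star l)) ∘L Y.1 = scalarRow l - X.1 ∘L moebiusDefect K l) :
    ballInvolution hl X = Y :=
  Subtype.ext ((isUnit_one_sub_comp_column hl X).comp_left_cancel
    ((one_sub_comp_involution hl X).trans h.symm))

/-- The defining equation with `X` and `Y` exchanged is checked after multiplying on the left by `M
= 1 - X L*`. Every `M Y` becomes `L - X E`, and `E L* = L*`, `L E = L`, `E² = (1 - ‖l‖²) + L* L`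
finish the computation. -/
theorem ballInvolution_ballInvolution {l : EllTwo ι} (hl : ‖l‖ < 1) (X : OpBall ι K) :
    ballInvolution hl (ballInvolution hl X) = X := by
  refine ballInvolution_eq hl ((isUnit_one_sub_comp_column hl X).comp_left_cancel ?_)
  have key (v : Ampl ι K) : (1 - X.1 ∘L column (star l)) (involution l X.1 v) =
      scalarRow l v - X.1 (moebiusDefect K l v) := congr($(one_sub_comp_involution hl X) v)
  ext1 v
  change (1 - X.1 ∘L column (star l)) (X.1 v - involution l X.1 (column (star l) (X.1 v))) =
    (1 - X.1 ∘L column (star l)) (scalarRow l v - involution l X.1 (moebiusDefect K l v))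
  rw [map_sub, map_sub, key, key, moebiusDefect_column_star hl, moebiusDefect_moebiusDefect hl,
    scalarRow_moebiusDefect hl, scalarRow_column_star_apply]
  change (X.1 v - X.1 (column (star l) (X.1 v))) - _ =
    (scalarRow l v - X.1 (column (star l) (scalarRow l v))) - _
  simp only [map_add, map_smul]
  push_cast
  module

end Moebius

/-! ### Power series of involutions and of unitary right multiplications. -/

noncomputable section PowerSeries

open ContinuousLinearMap

open scoped InnerProductSpace

variable {ι : Type*} {K : Type*} [NormedAddCommGroup K] [InnerProductSpace ℂ K] [CompleteSpace K]

/-- The right creation operators `e_α ↦ e_{αβ}`. -/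
def rightCreation (β : FreeMonoid ι) : Fock ι →ₗᵢ[ℂ] Fock ι :=
  (orthonormal_basisVec.comp (fun α : FreeMonoid ι => α * β)
    (mul_left_injective β)).orthogonalFamily.linearIsometry

theorem rightCreation_basisVec (α β : FreeMonoid ι) :
    rightCreation β (basisVec α) = basisVec (α * β) := by
  classical
  rw [basisVec_eq_single]
  simp [rightCreation, OrthogonalFamily.linearIsometry_apply_single]

/-- The embedding of `ℂⁿ` into the Fock space as the space of words of length one. -/
def letterEmbedding (ι : Type*) : EllTwo ι →ₗᵢ[ℂ] Fock ι :=
  (orthonormal_basisVec.comp (fun i : ι => FreeMonoid.of i)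
    FreeMonoid.of_injective).orthogonalFamily.linearIsometry

theorem letterEmbedding_basisVec (i : ι) :
    letterEmbedding ι (basisVec i) = basisVec (FreeMonoid.of i) := by
  classical
  rw [basisVec_eq_single]
  simp [letterEmbedding, OrthogonalFamily.linearIsometry_apply_single]

theorem ev_mul_entry (X : OpBall ι K) (a : Fock ι) (i : ι) :
    ev X a * entry X.1 i = ev X (rightCreation (FreeMonoid.of i) a) := by
  have h1 := (hasSum_ev X a).mul_right (entry X.1 i)
  have h2 := ((hasSum_basisVec a).mapL (rightCreation (FreeMonoid.of i)).toContinuousLinearMap).mapL (ev X)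
  refine h1.unique (h2.congr_terms fun α => ?_)
  rw [map_smul, LinearIsometry.coe_toContinuousLinearMap, rightCreation_basisVec, map_smul,
    ev_basisVec, map_mul, FreeMonoid.lift_eval_of, smul_mul_assoc]

theorem entry_mul_ev (X : OpBall ι K) (a : Fock ι) (i : ι) :
    entry X.1 i * ev X a = ev X (creation i a) := by
  have h1 := (hasSum_ev X a).mul_left (entry X.1 i)
  have h2 := ((hasSum_basisVec a).mapL (creation i)).mapL (ev X)
  refine h1.unique (h2.congr_terms fun α => ?_)
  rw [map_smul, creation_basisVec, map_smul, ev_basisVec, map_mul, FreeMonoid.lift_eval_of,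
    mul_smul_comm]

theorem ev_letterEmbedding (X : OpBall ι K) (v : EllTwo ι) :
    ev X (letterEmbedding ι v) = X.1 ∘L column v := by
  have h := ((hasSum_basisVec v).mapL (letterEmbedding ι).toContinuousLinearMap).mapL (ev X)
  refine (h.congr_terms fun i => ?_).unique (hasSum_column X.1 v)
  rw [map_smul, LinearIsometry.coe_toContinuousLinearMap, letterEmbedding_basisVec, map_smul,
    ev_basisVec, FreeMonoid.lift_eval_of]

/-- The vector `(z_α)_α` in the Fock space. -/
def wordVec {z : EllTwo ι} (hz : ‖z‖ < 1) : Fock ι := ⟨_, memlp_lift hz⟩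

theorem wordVec_apply {z : EllTwo ι} (hz : ‖z‖ < 1) (α : FreeMonoid ι) :
    wordVec hz α = FreeMonoid.lift (z : ι → ℂ) α := rfl

theorem creation_apply_one (i : ι) (x : Fock ι) : creation i x 1 = 0 := by
  classical
  have : innerSL ℂ (basisVec 1 : Fock ι) ∘L creation i = 0 := by
    refine ext_basisVec fun α => ?_
    simp only [comp_apply, innerSL_apply_apply, creation_basisVec, inner_basisVec_left,
      basisVec_apply, zero_apply, ite_eq_right_iff, one_ne_zero, imp_false]
    exact fun h => List.cons_ne_nil _ _ h
  rw [← inner_basisVec_left]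
  exact congr($this x)

theorem creation_apply_of_mul [DecidableEq ι] (i j : ι) (α : FreeMonoid ι) (x : Fock ι) :
    creation i x (FreeMonoid.of j * α) = if i = j then x α else 0 := by
  rw [← inner_basisVec_left, ← creation_basisVec]
  split_ifs with h
  · subst h
    rw [← inner_basisVec_left]
    exact (creationIsometry i).inner_map_map _ _
  · exact inner_creation_of_ne (Ne.symm h) _ _

theorem hasSum_creation_column (z : EllTwo ι) (x : Fock ι) :
    HasSum (fun i => z i • creation i x)
      (shiftRow (LinearIsometryEquiv.refl ℂ (Fock ι)) (column z x)) := by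
  have h := (hasSum_column (shiftRow (LinearIsometryEquiv.refl ℂ (Fock ι))) z).mapL
    (ContinuousLinearMap.apply ℂ (Fock ι) x)
  refine h.congr_terms fun i => ?_
  rw [map_smul, apply_apply]
  exact congr(z i • $((entry_shiftRow_refl i).symm) x)

/-- The recursion `z_{g_j α} = z_j z_α` says that `∑ z_i S_i` reproduces `(z_α)_α` except at the
empty word, where it gives `0` in place of `1`. -/
theorem shiftRow_column_wordVec {z : EllTwo ι} (hz : ‖z‖ < 1) :
    shiftRow (LinearIsometryEquiv.refl ℂ (Fock ι)) (column z (wordVec hz)) =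
      wordVec hz - basisVec 1 := by
  classical
  ext α
  have hα := (hasSum_creation_column z (wordVec hz)).mapL (innerSL ℂ (basisVec α))
  simp only [innerSL_apply_apply, inner_basisVec_left, lp.coeFn_smul, Pi.smul_apply,
    smul_eq_mul] at hα
  refine hα.unique ?_
  rw [lp.coeFn_sub, Pi.sub_apply, basisVec_apply, wordVec_apply]
  induction α using FreeMonoid.inductionOn' with
  | one => simp [creation_apply_one, hasSum_zero]
  | of_mul j α _ =>
    have hne : (1 : FreeMonoid ι) ≠ FreeMonoid.of j * α := fun h => List.cons_ne_nil _ _ h.symm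
    convert hasSum_single j ?_ using 1
    · rw [creation_apply_of_mul, if_pos rfl, if_neg hne, map_mul, FreeMonoid.lift_eval_of,
        wordVec_apply, sub_zero]
    · intro i hi
      rw [creation_apply_of_mul, if_neg hi, mul_zero]

theorem hasSum_creation_wordVec {z : EllTwo ι} (hz : ‖z‖ < 1) :
    HasSum (fun i => z i • creation i (wordVec hz)) (wordVec hz - basisVec 1) := by
  rw [← shiftRow_column_wordVec hz]
  exact hasSum_creation_column z (wordVec hz)

/-- The row of creation operators is isometric, so with `w = (z_α)_α` the recursion gives `‖w - e_1‖
= ‖z‖ ‖w‖`, while `⟪w, e_1⟫ = 1`. -/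
theorem norm_wordVec_sq {z : EllTwo ι} (hz : ‖z‖ < 1) :
    (1 - ‖z‖ ^ 2) * ‖wordVec hz‖ ^ 2 = 1 := by
  have h1 : ‖wordVec hz - basisVec 1‖ = ‖z‖ * ‖wordVec hz‖ := by
    rw [← shiftRow_column_wordVec hz, ← norm_column_apply]
    exact (orthogonalFamily_shiftIsometry _).linearIsometry.norm_map _
  have h2 : ⟪wordVec hz, (basisVec 1 : Fock ι)⟫_ℂ = 1 := by
    rw [← inner_conj_symm, inner_basisVec_left, wordVec_apply]
    simp
  have h3 := norm_sub_sq (𝕜 := ℂ) (wordVec hz) (basisVec 1)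
  rw [h1, h2, norm_basisVec, RCLike.one_re] at h3
  linarith [mul_pow ‖z‖ ‖wordVec hz‖ 2]

/-- Evaluating the recursion for `(z_α)_α` at `X` exhibits the inverse of `1 - ∑ z_i X_i` as a power
series with square summable coefficients. -/
theorem one_sub_comp_column_mul_ev {z : EllTwo ι} (hz : ‖z‖ < 1) (X : OpBall ι K) :
    (1 - X.1 ∘L column z) * ev X (wordVec hz) = 1 := by
  have h1 := (hasSum_column X.1 z).mul_right (ev X (wordVec hz))
  have h2 := (hasSum_creation_wordVec hz).mapL (ev X)
  have h3 := h1.unique (h2.congr_terms fun i => by rw [map_smul, smul_mul_assoc, entry_mul_ev])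
  rw [sub_mul, h3, map_sub, ev_basisVec, map_one, one_mul]
  abel

/-- The coefficients of the components of the involution. -/
def involutionCoeff {l : EllTwo ι} (hl : ‖star l‖ < 1) (j : ι) : Fock ι :=
  (l j * (1 - defectCoeff l) : ℂ) • wordVec hl + (defectCoeff l * l j : ℂ) • basisVec 1 -
    (defectNorm l : ℂ) • rightCreation (FreeMonoid.of j) (wordVec hl)

/-- Multiply the `j`-th entry of the linear fractional equation by `R = (1 - X L*)⁻¹`. The terms are
`R`, `R X_j` and `R X L* = R - 1`, all of them power series. -/
theorem entry_involution {l : EllTwo ι} (hl : ‖l‖ < 1) (hl' : ‖star l‖ < 1) (X : OpBall ι K)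
    (j : ι) : entry (involution l X.1) j = ev X (involutionCoeff hl' j) := by
  set M := 1 - X.1 ∘L column (star l) with hM
  set R := ev X (wordVec hl') with hR
  have hMu : IsUnit M := isUnit_one_sub_comp_column hl X
  have hMR : M * R = 1 := one_sub_comp_column_mul_ev hl' X
  have hRM : R * M = 1 := by
    obtain ⟨u, hu⟩ := hMu
    rw [← hu] at hMR ⊢
    rw [← Units.inv_eq_of_mul_eq_one_right hMR, Units.inv_mul]
  have h1 : M * entry (involution l X.1) j = l j • 1 - (defectNorm l : ℂ) • entry X.1 j -
      (defectCoeff l * l j : ℂ) • X.1 ∘L column (star l) := by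
    have h := congr(entry $(one_sub_comp_involution hl X) j)
    rw [entry_comp, entry_sub, entry_scalarRow] at h
    refine h.trans ?_
    rw [sub_sub]
    congr 1
    ext1 x
    change X.1 (moebiusDefect K l (inclusion j x)) = (defectNorm l : ℂ) • X.1 (inclusion j x) +
      (defectCoeff l * l j : ℂ) • X.1 (column (star l) x)
    rw [moebiusDefect_apply, ← entry_apply, entry_scalarRow, map_add, map_smul, map_smul]
    change _ + _ • X.1 (column (star l) (l j • x)) = _
    rw [map_smul, map_smul, smul_smul]
  have h2 : R * X.1 ∘L column (star l) = R - 1 := by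
    rw [← hRM, hM, mul_sub, mul_one]
    exact (sub_sub_cancel _ _).symm
  calc entry (involution l X.1) j = R * (M * entry (involution l X.1) j) := by
        rw [← mul_assoc, hRM, one_mul]
    _ = _ := by
        rw [h1, mul_sub, mul_sub, mul_smul_comm, mul_smul_comm, mul_smul_comm, mul_one, h2,
          hR, ev_mul_entry, involutionCoeff, map_sub, map_add, map_smul, map_smul, map_smul,
          ev_basisVec, map_one]
        module

theorem isFreeHolomorphic_ballInvolution {l : EllTwo ι} (hl : ‖l‖ < 1) :
    IsFreeHolomorphic (ballInvolution hl : OpBall ι K → OpBall ι K) :=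
  isFreeHolomorphic_of_ev (involutionCoeff (by rwa [norm_star])) fun X j =>
    entry_involution hl _ X j

/-- The involution as a permutation of the operatorial ball. -/
def involutionPerm (K : Type*) [NormedAddCommGroup K] [InnerProductSpace ℂ K] [CompleteSpace K]
    {l : EllTwo ι} (hl : ‖l‖ < 1) : Equiv.Perm (OpBall ι K) :=
  Function.Involutive.toPerm (ballInvolution hl) (ballInvolution_ballInvolution hl)

theorem involutionPerm_mem {l : EllTwo ι} (hl : ‖l‖ < 1) : involutionPerm K hl ∈ freeAut ι K :=
  ⟨isFreeHolomorphic_ballInvolution hl, isFreeHolomorphic_ballInvolution hl⟩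

/-- The column operator of a unit vector, as an isometry. -/
def columnIsometry (K : Type*) [NormedAddCommGroup K] [InnerProductSpace ℂ K] {v : EllTwo ι}
    (hv : ‖v‖ = 1) : K →ₗᵢ[ℂ] Ampl ι K where
  toLinearMap := (column v : K →L[ℂ] Ampl ι K).toLinearMap
  norm_map' := fun h => (norm_column_apply v h).trans (by rw [hv, one_mul])

theorem norm_map_basisVec (U : EllTwo ι ≃ₗᵢ[ℂ] EllTwo ι) (i : ι) : ‖U (basisVec i)‖ = 1 := by
  rw [U.norm_map, norm_basisVec]

theorem orthogonalFamily_columnIsometry (K : Type*) [NormedAddCommGroup K] [InnerProductSpace ℂ K]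
    (U : EllTwo ι ≃ₗᵢ[ℂ] EllTwo ι) :
    OrthogonalFamily ℂ (fun _ : ι => K) fun i => columnIsometry K (norm_map_basisVec U i) := by
  intro i j hij x y
  change ⟪column (U (basisVec i)) x, column (U (basisVec j)) y⟫_ℂ = 0
  rw [inner_column, U.inner_map_map, orthonormal_basisVec.2 hij, zero_mul]

/-- The operator `U ⊗ I` on the direct sum of copies of `K`. -/
def amplify (K : Type*) [NormedAddCommGroup K] [InnerProductSpace ℂ K] [CompleteSpace K]
    (U : EllTwo ι ≃ₗᵢ[ℂ] EllTwo ι) : Ampl ι K →ₗᵢ[ℂ] Ampl ι K :=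
  (orthogonalFamily_columnIsometry K U).linearIsometry

theorem amplify_inclusion (U : EllTwo ι ≃ₗᵢ[ℂ] EllTwo ι) (i : ι) (x : K) :
    amplify K U (inclusion i x) = column (U (basisVec i)) x := by
  classical
  rw [inclusion_eq_single]
  exact (orthogonalFamily_columnIsometry K U).linearIsometry_apply_single x

theorem amplify_column (U : EllTwo ι ≃ₗᵢ[ℂ] EllTwo ι) (v : EllTwo ι) (x : K) :
    amplify K U (column v x) = column (U v) x := by
  have h1 := ((((hasSum_basisVec v).mapL (columnL ι K)).mapL
    (ContinuousLinearMap.apply ℂ (Ampl ι K) x))).mapL (amplify K U).toContinuousLinearMap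
  have h2 := ((((hasSum_basisVec v).mapL (U.toContinuousLinearEquiv : EllTwo ι →L[ℂ] EllTwo ι)).mapL
    (columnL ι K)).mapL (ContinuousLinearMap.apply ℂ (Ampl ι K) x))
  refine h1.unique (h2.congr_terms fun i => ?_)
  change amplify K U (columnL ι K (v i • basisVec i) x) = columnL ι K (U (v i • basisVec i)) x
  rw [map_smul, map_smul, map_smul, smul_apply, smul_apply, map_smul, columnL_apply, columnL_apply,
    column_basisVec, amplify_inclusion]

/-- Right multiplication by a unitary matrix, as a self-map of the operatorial ball. -/
def ballRightMul (U : EllTwo ι ≃ₗᵢ[ℂ] EllTwo ι) (X : OpBall ι K) : OpBall ι K :=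
  ⟨X.1 ∘L (amplify K U).toContinuousLinearMap, mem_opBall <| by
    refine (opNorm_comp_le _ _).trans_lt ?_
    nlinarith [(amplify K U).norm_toContinuousLinearMap_le, norm_opBall_lt X, norm_nonneg X.1]⟩

theorem entry_ballRightMul (U : EllTwo ι ≃ₗᵢ[ℂ] EllTwo ι) (X : OpBall ι K) (j : ι) :
    entry (ballRightMul U X).1 j = X.1 ∘L column (U (basisVec j)) := by
  ext1 x
  exact congr(X.1 $(amplify_inclusion U j x))

theorem isRightMul_ballRightMul (U : EllTwo ι ≃ₗᵢ[ℂ] EllTwo ι) (X : OpBall ι K) :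
    IsRightMul U X.1 (ballRightMul U X).1 := fun j => by
  rw [entry_ballRightMul]
  exact hasSum_column X.1 (U (basisVec j))

theorem ballRightMul_ballRightMul (U V : EllTwo ι ≃ₗᵢ[ℂ] EllTwo ι) (X : OpBall ι K) :
    ballRightMul U (ballRightMul V X) = ballRightMul (U.trans V) X := by
  refine Subtype.ext (ext_entry fun j => ?_)
  rw [entry_ballRightMul, entry_ballRightMul]
  ext1 x
  exact congr(X.1 $(amplify_column V (U (basisVec j)) x))

theorem ballRightMul_refl (X : OpBall ι K) :
    ballRightMul (LinearIsometryEquiv.refl ℂ (EllTwo ι)) X = X := by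
  refine Subtype.ext (ext_entry fun j => ?_)
  rw [entry_ballRightMul, LinearIsometryEquiv.coe_refl, id, column_basisVec]
  rfl

/-- Right multiplication by a unitary matrix, as a permutation of the operatorial ball. -/
def rightMulPerm (K : Type*) [NormedAddCommGroup K] [InnerProductSpace ℂ K] [CompleteSpace K]
    (U : EllTwo ι ≃ₗᵢ[ℂ] EllTwo ι) : Equiv.Perm (OpBall ι K) where
  toFun := ballRightMul U
  invFun := ballRightMul U.symm
  left_inv := fun X => by
    rw [ballRightMul_ballRightMul, LinearIsometryEquiv.symm_trans_self, ballRightMul_refl]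
  right_inv := fun X => by
    rw [ballRightMul_ballRightMul, LinearIsometryEquiv.self_trans_symm, ballRightMul_refl]

theorem isFreeHolomorphic_ballRightMul (U : EllTwo ι ≃ₗᵢ[ℂ] EllTwo ι) :
    IsFreeHolomorphic (ballRightMul U : OpBall ι K → OpBall ι K) :=
  isFreeHolomorphic_of_ev (fun j => letterEmbedding ι (U (basisVec j))) fun X j => by
    rw [entry_ballRightMul, ev_letterEmbedding]

theorem rightMulPerm_mem (U : EllTwo ι ≃ₗᵢ[ℂ] EllTwo ι) : rightMulPerm K U ∈ freeAut ι K :=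
  ⟨isFreeHolomorphic_ballRightMul U, isFreeHolomorphic_ballRightMul U.symm⟩

end PowerSeries

/-! ### Scalar points and the restriction of the model maps. -/

noncomputable section Scalars

open ContinuousLinearMap

open scoped InnerProductSpace

variable {ι : Type*} {K : Type*} [NormedAddCommGroup K] [InnerProductSpace ℂ K] [CompleteSpace K]

theorem norm_unitBall_lt (z : UnitBall ι) : ‖z.1‖ < 1 := mem_ball_zero_iff.1 z.2

/-- The row `[z₁ I, …, zₙ I]` as an element of the operatorial ball. -/
def scalarPoint (K : Type*) [NormedAddCommGroup K] [InnerProductSpace ℂ K] [CompleteSpace K]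
    (z : UnitBall ι) : OpBall ι K :=
  ⟨scalarRow z.1, mem_opBall ((norm_scalarRow_le z.1).trans_lt (norm_unitBall_lt z))⟩

theorem scalarPoint_injective [Nontrivial K] :
    Function.Injective (scalarPoint K : UnitBall ι → OpBall ι K) := fun _ _ h =>
  Subtype.ext (scalarRow_injective congr($h.1))

/-- The adjoint of `Y` sends `x` to the column `(conj(y_j) T* x)_j`. One `x` with `T* x ≠ 0` shows
that `y` is square summable; all `x` together give `‖T‖ ‖y‖ ≤ ‖Y‖ < 1`. It is needed for `T = 1` and
for a nilpotent `T`. -/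
theorem exists_comp_scalarRow_eq {T : K →L[ℂ] K} (hT : ‖T‖ = 1) (Y : OpBall ι K) (y : ι → ℂ)
    (hy : ∀ j, entry Y.1 j = y j • T) :
    ∃ w : UnitBall ι, (∀ j, w.1 j = y j) ∧ Y.1 = T ∘L scalarRow w.1 := by
  have hT' : adjoint T ≠ 0 := fun h => by
    rw [← LinearIsometryEquiv.norm_map adjoint, h, norm_zero] at hT
    exact zero_ne_one hT
  obtain ⟨x, hx⟩ := DFunLike.ne_iff.1 hT'
  have hm : Memℓp y 2 := by
    rw [memℓp_gen_iff (by norm_num)]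
    have := (Ampl.summable_sq (adjoint Y.1 x)).div_const (‖adjoint T x‖ ^ 2)
    have hx' : ‖adjoint T x‖ ≠ 0 := norm_ne_zero_iff.2 hx
    simp only [adjoint_row_apply, hy, ← star_eq_adjoint, star_smul, smul_apply, norm_smul,
      mul_pow, norm_star] at this hx'
    simpa [hx'] using this
  set v : EllTwo ι := ⟨y, hm⟩
  have hY : Y.1 = T ∘L scalarRow v := ext_entry fun j => by
    rw [hy, entry_comp, entry_scalarRow, comp_smul]
    rfl
  have hle : ‖adjoint T‖ * ‖v‖ ≤ ‖Y.1‖ := by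
    rw [← norm_star v, ← LinearIsometryEquiv.norm_map adjoint Y.1]
    rcases (norm_nonneg (star v)).eq_or_lt with h0 | h0
    · rw [← h0, mul_zero]
      exact norm_nonneg _
    rw [← le_div_iff₀ h0]
    refine opNorm_le_bound _ (by positivity) fun x => ?_
    rw [div_mul_eq_mul_div, le_div_iff₀ h0, mul_comm, ← norm_column_apply, ← adjoint_scalarRow,
      ← comp_apply, ← adjoint_comp, ← hY]
    exact le_opNorm _ _
  rw [LinearIsometryEquiv.norm_map, hT, one_mul] at hle
  exact ⟨⟨v, mem_ball_zero_iff.2 (hle.trans_lt (norm_opBall_lt Y))⟩, fun _ => rfl, hY⟩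

theorem exists_scalarPoint_eq [Nontrivial K] (Y : OpBall ι K) (y : ι → ℂ)
    (hy : ∀ j, entry Y.1 j = y j • 1) :
    ∃ w : UnitBall ι, (∀ j, w.1 j = y j) ∧ Y = scalarPoint K w := by
  obtain ⟨w, hw, h⟩ := exists_comp_scalarRow_eq norm_one Y y hy
  exact ⟨w, hw, Subtype.ext (h.trans (id_comp _))⟩

omit [CompleteSpace K] in
theorem lift_smul_const (z : ι → ℂ) (T : K →L[ℂ] K) (α : FreeMonoid ι) :
    FreeMonoid.lift (fun i => z i • T) α = FreeMonoid.lift z α • T ^ α.length := by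
  induction α using FreeMonoid.inductionOn' with
  | one => simp
  | of_mul i α ih =>
    rw [map_mul, ih, map_mul, FreeMonoid.lift_eval_of, FreeMonoid.lift_eval_of,
      FreeMonoid.length_mul, FreeMonoid.length_of, pow_add, pow_one, smul_mul_smul_comm]

theorem hasSum_mul_wordVec {z : EllTwo ι} (hz : ‖z‖ < 1) (a : Fock ι) :
    HasSum (fun α => a α * FreeMonoid.lift (z : ι → ℂ) α) ⟪star a, wordVec hz⟫_ℂ :=
  (lp.hasSum_inner (𝕜 := ℂ) (star a) (wordVec hz)).congr_terms fun α => by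
    simp [RCLike.inner_apply, wordVec_apply, mul_comm]

theorem ev_scalarPoint (z : UnitBall ι) (a : Fock ι) :
    ev (scalarPoint K z) a = ⟪star a, wordVec (norm_unitBall_lt z)⟫_ℂ • (1 : K →L[ℂ] K) := by
  refine (hasSum_ev (scalarPoint K z) a).unique
    (((hasSum_mul_wordVec (norm_unitBall_lt z) a).smul_const (1 : K →L[ℂ] K)).congr_terms fun α => ?_)
  have : entry (scalarPoint K z).1 = fun i => z.1 i • (1 : K →L[ℂ] K) :=
    funext fun i => entry_scalarRow z.1 i
  rw [this, lift_smul_const, one_pow, smul_smul]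

theorem ballInvolution_scalarPoint {l : EllTwo ι} (hl : ‖l‖ < 1) (z : UnitBall ι) [Nontrivial K] :
    ∃ w : UnitBall ι, w.1 = moebius l z.1 ∧
      ballInvolution hl (scalarPoint K z) = scalarPoint K w := by
  have hne : 1 - ⟪l, z.1⟫_ℂ ≠ 0 := by
    intro h
    have h1 : ‖⟪l, z.1⟫_ℂ‖ = 1 := by rw [← sub_eq_zero.1 h, norm_one]
    have h2 := norm_inner_le_norm (𝕜 := ℂ) l z.1
    nlinarith [norm_nonneg l, norm_nonneg z.1, norm_unitBall_lt z]
  have hcoord (j : ι) : (1 - ⟪l, z.1⟫_ℂ) * moebius l z.1 j =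
      l j - defectNorm l * z.1 j - defectCoeff l * ⟪l, z.1⟫_ℂ * l j := by
    -- Here `1 - s = c ‖l‖²` cancels the denominator of the projection; for `l = 0` both sides
    -- vanish.
    have hQ : (1 - defectNorm l : ℂ) * (⟪l, z.1⟫_ℂ / ⟪l, l⟫_ℂ * l j) =
        defectCoeff l * ⟪l, z.1⟫_ℂ * l j := by
      rcases eq_or_ne l 0 with rfl | h0
      · simp
      have h1 : ⟪l, l⟫_ℂ ≠ 0 := inner_self_ne_zero.2 h0
      have h2 : (1 - defectNorm l : ℂ) = defectCoeff l * ⟪l, l⟫_ℂ := by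
        have h := inner_self_eq_norm_sq_to_K (𝕜 := ℂ) l
        have h' := congrArg Complex.ofReal (defectCoeff_mul_norm_sq hl)
        push_cast at h'
        rw [h]
        exact h'.symm
      rw [h2]
      field_simp
    change (1 - ⟪l, z.1⟫_ℂ) * ((1 - ⟪l, z.1⟫_ℂ)⁻¹ * (l j - ⟪l, z.1⟫_ℂ / ⟪l, l⟫_ℂ * l j -
      defectNorm l * (z.1 j - ⟪l, z.1⟫_ℂ / ⟪l, l⟫_ℂ * l j))) = _
    rw [mul_inv_cancel_left₀ hne]
    linear_combination -hQ
  have hentry (j : ι) : entry (ballInvolution hl (scalarPoint K z)).1 j =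
      (moebius l z.1 j : ℂ) • (1 : K →L[ℂ] K) := by
    refine (isUnit_one_sub_comp_column hl (scalarPoint K z)).comp_left_cancel ?_
    have h := congr(entry $(one_sub_comp_involution hl (scalarPoint K z)) j)
    refine h.trans ?_
    ext1 x
    change (scalarRow l : RowOp ι K) (inclusion j x) -
        scalarRow z.1 (moebiusDefect K l (inclusion j x)) =
      (moebius l z.1 j • x) - (scalarRow z.1 ∘L column (star l)) (moebius l z.1 j • x)
    have he (w : EllTwo ι) : (scalarRow w : RowOp ι K) (inclusion j x) = w j • x := by
      rw [← entry_apply, entry_scalarRow]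
      rfl
    have hc (y : K) : (scalarRow z.1 : RowOp ι K) (column (star l) y) = ⟪l, z.1⟫_ℂ • y :=
      congr($(scalarRow_comp_column_star z.1 l) y)
    rw [moebiusDefect_apply, map_add, map_smul, map_smul, comp_apply, hc, hc, he, he]
    linear_combination (norm := module) -(hcoord j • x)
  obtain ⟨w, hw, h⟩ := exists_scalarPoint_eq _ _ hentry
  exact ⟨w, lp.ext (funext hw), h⟩

/-- The vector `z U` with coordinates `∑_i z_i u_{ij}`. -/
def vecMul (U : EllTwo ι ≃ₗᵢ[ℂ] EllTwo ι) (z : EllTwo ι) : EllTwo ι := star (U.symm (star z))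

/-- Row multiplication by `U` is the transpose of `U` acting on `z`, and the transpose is the
conjugate of the adjoint `U⁻¹`. -/
theorem vecMul_apply (U : EllTwo ι ≃ₗᵢ[ℂ] EllTwo ι) (z : EllTwo ι) (j : ι) :
    vecMul U z j = ⟪star (U (basisVec j)), z⟫_ℂ := by
  rw [← star_star z, inner_star_star, ← U.symm.inner_map_map, U.symm_apply_apply,
    ← inner_conj_symm, inner_basisVec_left, star_star]
  rfl

theorem hasSum_vecMul (U : EllTwo ι ≃ₗᵢ[ℂ] EllTwo ι) (z : EllTwo ι) (j : ι) :
    HasSum (fun i => matEntry U i j * z i) (vecMul U z j) := by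
  rw [vecMul_apply]
  refine (lp.hasSum_inner (𝕜 := ℂ) (star (U (basisVec j))) z).congr_terms fun i => ?_
  simp [RCLike.inner_apply, matEntry, mul_comm]

theorem norm_vecMul (U : EllTwo ι ≃ₗᵢ[ℂ] EllTwo ι) (z : EllTwo ι) : ‖vecMul U z‖ = ‖z‖ := by
  rw [vecMul, norm_star, U.symm.norm_map, norm_star]

theorem ballRightMul_scalarPoint (U : EllTwo ι ≃ₗᵢ[ℂ] EllTwo ι) (z w : UnitBall ι)
    (hw : w.1 = vecMul U z.1) : ballRightMul U (scalarPoint K z) = scalarPoint K w := by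
  refine Subtype.ext (ext_entry fun j => ?_)
  rw [entry_ballRightMul]
  change (scalarRow z.1 : RowOp ι K) ∘L _ = entry (scalarRow w.1) j
  rw [entry_scalarRow, hw, vecMul_apply, ← scalarRow_comp_column_star, star_star]

end Scalars

/-! ### Automorphisms that fix the origin. -/

noncomputable section Rigidity

open ContinuousLinearMap

open scoped InnerProductSpace

variable {ι : Type*} {K : Type*} [NormedAddCommGroup K] [InnerProductSpace ℂ K] [CompleteSpace K]

/-- Two mutually inverse linear contractions form an isometric isomorphism. -/
def isometryEquivOfContractions {E : Type*} [NormedAddCommGroup E] [NormedSpace ℂ E]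
    (f g : E →ₗ[ℂ] E) (hf : ∀ x, ‖f x‖ ≤ ‖x‖) (hg : ∀ x, ‖g x‖ ≤ ‖x‖)
    (hgf : ∀ x, g (f x) = x) (hfg : ∀ x, f (g x) = x) : E ≃ₗᵢ[ℂ] E where
  toLinearEquiv := LinearEquiv.ofLinearMap f g (LinearMap.ext hfg) (LinearMap.ext hgf)
  norm_map' := fun x => le_antisymm (hf x) (by
    have := hg (f x)
    rwa [hgf] at this)

/-- Scaling carries square summability of the coordinates from the ball to all vectors; letting the
scaling factor decrease to `‖z‖` gives the contraction bound. -/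
theorem exists_linearMap_of_unitBall (c : ι → EllTwo ι →L[ℂ] ℂ)
    (h : ∀ z : UnitBall ι, ∃ w : UnitBall ι, ∀ j, w.1 j = c j z.1) :
    ∃ f : EllTwo ι →ₗ[ℂ] EllTwo ι, (∀ z j, f z j = c j z) ∧ ∀ z, ‖f z‖ ≤ ‖z‖ := by
  have key (z : EllTwo ι) (r : ℝ) (hr : ‖z‖ < r) :
      ∃ w : EllTwo ι, (∀ j, w j = c j z) ∧ ‖w‖ ≤ r := by
    have hr0 : 0 < r := (norm_nonneg z).trans_lt hr
    have hrC : (r : ℂ) ≠ 0 := Complex.ofReal_ne_zero.2 hr0.ne'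
    obtain ⟨w, hw⟩ := h ⟨(r : ℂ)⁻¹ • z, mem_ball_zero_iff.2 (by
      rw [norm_smul, norm_inv, Complex.norm_real, Real.norm_of_nonneg hr0.le, inv_mul_lt_iff₀ hr0]
      simpa using hr)⟩
    refine ⟨(r : ℂ) • w.1, fun j => ?_, ?_⟩
    · rw [lp.coeFn_smul, Pi.smul_apply, hw, map_smul, smul_smul, mul_inv_cancel₀ hrC, one_smul]
    · rw [norm_smul, Complex.norm_real, Real.norm_of_nonneg hr0.le]
      nlinarith [norm_unitBall_lt w]
  choose g hg using fun z => key z (‖z‖ + 1) (lt_add_one _)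
  refine ⟨⟨⟨g, fun z w => ?_⟩, fun a z => ?_⟩, fun z j => (hg z).1 j, fun z => ?_⟩
  · ext j
    simp [(hg _).1 j]
  · ext j
    simp [(hg _).1 j]
  · refine le_of_forall_gt_imp_ge_of_dense fun r hr => ?_
    obtain ⟨w, hw, hwr⟩ := key z r hr
    have : w = g z := lp.ext (funext fun j => (hw j).trans ((hg z).1 j).symm)
    change ‖g z‖ ≤ r
    rwa [← this]

omit [CompleteSpace K] in
-- A rank one operator between two orthogonal unit vectors will do. Substituting multiples of it
-- kills every word of length at least two, which isolates linear parts.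
theorem exists_nilpotent [Nonempty ι] (W : Fock ι ≃ₗᵢ[ℂ] K) :
    ∃ N : K →L[ℂ] K, N * N = 0 ∧ ‖N‖ = 1 := by
  obtain ⟨i⟩ := ‹Nonempty ι›
  have hne : (1 : FreeMonoid ι) ≠ FreeMonoid.of i := fun h => List.cons_ne_nil _ _ h.symm
  refine ⟨(innerSL ℂ (W (basisVec 1))).smulRight (W (basisVec (FreeMonoid.of i))), ?_, ?_⟩
  · ext1 x
    simp [mul_apply_eq_comp, W.inner_map_map, orthonormal_basisVec.2 hne]
  · rw [norm_smulRight_apply, innerSL_apply_norm, W.norm_map, W.norm_map, norm_basisVec,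
      norm_basisVec, one_mul]

theorem inner_letterEmbedding_basisVec (v : EllTwo ι) {α : FreeMonoid ι} (hα : α.length ≠ 1) :
    ⟪letterEmbedding ι v, basisVec α⟫_ℂ = 0 := by
  have : innerSL ℂ (basisVec α : Fock ι) ∘L (letterEmbedding ι).toContinuousLinearMap = 0 := by
    refine ext_basisVec fun i => ?_
    rw [comp_apply, LinearIsometry.coe_toContinuousLinearMap, letterEmbedding_basisVec,
      innerSL_apply_apply]
    refine orthonormal_basisVec.2 fun h => hα ?_
    rw [h, FreeMonoid.length_of]
  rw [← inner_conj_symm]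
  have h := congr($this v)
  exact (congrArg _ h).trans (map_zero _)

/-- The vector of coefficients of the words of length one. -/
def linearPart (ι : Type*) : Fock ι →L[ℂ] EllTwo ι :=
  adjoint (letterEmbedding ι).toContinuousLinearMap

theorem inner_linearPart (v : EllTwo ι) (a : Fock ι) :
    ⟪v, linearPart ι a⟫_ℂ = ⟪letterEmbedding ι v, a⟫_ℂ :=
  adjoint_inner_right _ _ _

/-- The tuple `[z₁ N, …, zₙ N]` as an element of the operatorial ball. -/
def opPoint {N : K →L[ℂ] K} (hN : ‖N‖ = 1) (z : UnitBall ι) : OpBall ι K :=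
  ⟨N ∘L scalarRow z.1, mem_opBall <| by
    refine (opNorm_comp_le _ _).trans_lt ?_
    rw [hN, one_mul]
    exact (norm_scalarRow_le z.1).trans_lt (norm_unitBall_lt z)⟩

theorem entry_opPoint {N : K →L[ℂ] K} (hN : ‖N‖ = 1) (z : UnitBall ι) (i : ι) :
    entry (opPoint hN z).1 i = z.1 i • N := by
  rw [opPoint, entry_comp, entry_scalarRow, comp_smul]
  rfl

theorem opPoint_injective {N : K →L[ℂ] K} (hN : ‖N‖ = 1) :
    Function.Injective (opPoint hN : UnitBall ι → OpBall ι K) := by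
  intro z w h
  have hN0 : N ≠ 0 := norm_ne_zero_iff.1 (by rw [hN]; exact one_ne_zero)
  refine Subtype.ext (lp.ext (funext fun i => smul_left_injective ℂ hN0 ?_))
  change z.1 i • N = w.1 i • N
  rw [← entry_opPoint hN, ← entry_opPoint hN, h]

/-- A power series evaluated at multiples of a nilpotent operator of order two. -/
theorem ev_opPoint {N : K →L[ℂ] K} (hN : ‖N‖ = 1) (hN2 : N * N = 0) (z : UnitBall ι)
    (a : Fock ι) :
    ev (opPoint hN z) a = a 1 • 1 + ⟪star z.1, linearPart ι a⟫_ℂ • N := by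
  classical
  let g : Fock ι →L[ℂ] K →L[ℂ] K := (innerSL ℂ (basisVec 1 : Fock ι)).smulRight 1 +
    (innerSL ℂ (letterEmbedding ι (star z.1))).smulRight N
  have hg (a : Fock ι) : g a = a 1 • 1 + ⟪star z.1, linearPart ι a⟫_ℂ • N := by
    rw [inner_linearPart, ← inner_basisVec_left]
    rfl
  rw [← hg]
  suffices ev (opPoint hN z) = g from congr($this a)
  refine ext_basisVec fun α => ?_
  rw [hg, ev_basisVec, inner_linearPart,
    show entry (opPoint hN z).1 = fun i => z.1 i • N from funext (entry_opPoint hN z),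
    lift_smul_const]
  rcases h : α.length with _ | _ | n
  · obtain rfl := FreeMonoid.length_eq_zero.1 h
    rw [inner_letterEmbedding_basisVec _ (by simp), basisVec_apply]
    simp
  · obtain ⟨i, rfl⟩ := FreeMonoid.length_eq_one.1 h
    rw [← letterEmbedding_basisVec, LinearIsometry.inner_map_map, letterEmbedding_basisVec,
      basisVec_apply, if_neg (show FreeMonoid.of i ≠ 1 from fun h => List.cons_ne_nil _ _ h), ← inner_conj_symm,
      inner_basisVec_left]
    simp
  · rw [inner_letterEmbedding_basisVec _ (by omega), basisVec_apply,
      if_neg (by rintro rfl; simp at h), pow_succ, pow_succ, mul_assoc, hN2]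
    simp

/-- The conjugate `z ↦ conj (V (conj z))` of a unitary operator. -/
def conjEquiv (V : EllTwo ι ≃ₗᵢ[ℂ] EllTwo ι) : EllTwo ι ≃ₗᵢ[ℂ] EllTwo ι where
  toFun := fun z => star (V (star z))
  invFun := fun z => star (V.symm (star z))
  map_add' := fun z w => by rw [star_add, map_add, star_add]
  map_smul' := fun a z => by
    rw [star_smul, map_smul, star_smul, star_star, RingHom.id_apply]
  left_inv := fun z => by
    change star (V.symm (star (star (V (star z))))) = z
    rw [star_star, V.symm_apply_apply, star_star]
  right_inv := fun z => by
    change star (V (star (star (V.symm (star z))))) = z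
    rw [star_star, V.apply_symm_apply, star_star]
  norm_map' := fun z => by
    change ‖star (V (star z))‖ = ‖z‖
    rw [norm_star, V.norm_map, norm_star]

theorem conjEquiv_apply (V : EllTwo ι ≃ₗᵢ[ℂ] EllTwo ι) (z : EllTwo ι) :
    conjEquiv V z = star (V (star z)) := rfl

theorem vecMul_eq_conjEquiv (U : EllTwo ι ≃ₗᵢ[ℂ] EllTwo ι) (z : EllTwo ι) :
    vecMul U z = conjEquiv U.symm z := rfl

theorem vecMul_conjEquiv_symm (V : EllTwo ι ≃ₗᵢ[ℂ] EllTwo ι) (z : EllTwo ι) :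
    vecMul (conjEquiv V).symm z = V z := by
  rw [vecMul, LinearIsometryEquiv.symm_symm, conjEquiv_apply, star_star, star_star]

/-- The origin of the ball. -/
def unitBallZero (ι : Type*) : UnitBall ι := ⟨0, Metric.mem_ball_self one_pos⟩

theorem scalarRow_zero : (scalarRow (0 : EllTwo ι) : RowOp ι K) = 0 :=
  ext_entry fun j => by rw [entry_scalarRow, lp.coeFn_zero, Pi.zero_apply, zero_smul, entry_zero]

/-- Pythagoras: the projection onto the words of length one does not shorten `a`, so `a` lies in its
range. -/
theorem eq_letterEmbedding_of_norm_le {a : Fock ι} (h : ‖a‖ ≤ ‖linearPart ι a‖) :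
    a = letterEmbedding ι (linearPart ι a) := by
  have h1 := norm_sub_sq (𝕜 := ℂ) a (letterEmbedding ι (linearPart ι a))
  have h2 : RCLike.re ⟪a, letterEmbedding ι (linearPart ι a)⟫_ℂ = ‖linearPart ι a‖ ^ 2 := by
    rw [← inner_conj_symm, ← inner_linearPart, RCLike.conj_re, inner_self_eq_norm_sq]
  rw [h2, LinearIsometry.norm_map] at h1
  have h3 : ‖a - letterEmbedding ι (linearPart ι a)‖ ^ 2 ≤ 0 := by
    nlinarith [norm_nonneg a]
  exact sub_eq_zero.1 (norm_eq_zero.1 (pow_eq_zero_iff two_ne_zero |>.1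
    (le_antisymm h3 (sq_nonneg _))))

/-- A free holomorphic automorphism that fixes the origin is the right multiplication by a unitary
matrix. -/
theorem exists_ballRightMul_eq [Nonempty ι] [Nontrivial K] (W : Fock ι ≃ₗᵢ[ℂ] K)
    {F : Equiv.Perm (OpBall ι K)} (hF : F ∈ freeAut ι K)
    (h0 : F (scalarPoint K (unitBallZero ι)) = scalarPoint K (unitBallZero ι)) :
    ∃ U : EllTwo ι ≃ₗᵢ[ℂ] EllTwo ι, ∀ X, F X = ballRightMul U X := by
  obtain ⟨N, hN2, hN⟩ := exists_nilpotent W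
  have hzero : opPoint hN (unitBallZero ι) = scalarPoint K (unitBallZero ι) := by
    refine Subtype.ext ?_
    change N ∘L scalarRow 0 = scalarRow 0
    rw [scalarRow_zero, comp_zero]
  have key {G : OpBall ι K → OpBall ι K} {a : ι → Fock ι}
      (hG : ∀ X j, entry (G X).1 j = ev X (a j))
      (hG0 : G (scalarPoint K (unitBallZero ι)) = scalarPoint K (unitBallZero ι))
      (z : UnitBall ι) : ∃ w : UnitBall ι, (∀ j, w.1 j = ⟪star z.1, linearPart ι (a j)⟫_ℂ) ∧
        G (opPoint hN z) = opPoint hN w := by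
    -- Fixing the origin removes the constant terms, so `G(zN)` has entries that are scalar
    -- multiples of `N`.
    have ha (j : ι) : a j 1 = 0 := by
      have h := hG (scalarPoint K (unitBallZero ι)) j
      rw [hG0, ← hzero, ev_opPoint hN hN2, entry_opPoint] at h
      have h' : ((a j 1 : ℂ) • (1 : K →L[ℂ] K)) = 0 := by
        simpa [unitBallZero] using h.symm
      exact (smul_eq_zero.1 h').resolve_right one_ne_zero
    obtain ⟨w, hw, h⟩ := exists_comp_scalarRow_eq hN (G (opPoint hN z))
      (fun j => ⟪star z.1, linearPart ι (a j)⟫_ℂ) fun j => by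
        rw [hG, ev_opPoint hN hN2, ha, zero_smul, zero_add]
    exact ⟨w, hw, Subtype.ext h⟩
  let func (a : ι → Fock ι) (j : ι) : EllTwo ι →L[ℂ] ℂ := innerSL ℂ (star (linearPart ι (a j)))
  have hfunc (a : ι → Fock ι) (j : ι) (z : EllTwo ι) :
      func a j z = ⟪star z, linearPart ι (a j)⟫_ℂ := by
    rw [← star_star (linearPart ι (a j)), inner_star_star]
    rfl
  obtain ⟨a, ha, ha1⟩ := hF.1.exists_ev W
  obtain ⟨b, hb, -⟩ := hF.2.exists_ev W
  have hF0 : F.symm (scalarPoint K (unitBallZero ι)) = scalarPoint K (unitBallZero ι) := by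
    rw [F.symm_apply_eq, h0]
  obtain ⟨f, hf, hf1⟩ := exists_linearMap_of_unitBall (func a) fun z => by
    obtain ⟨w, hw, -⟩ := key ha h0 z
    exact ⟨w, fun j => (hw j).trans (hfunc a j z.1).symm⟩
  obtain ⟨g, hg, hg1⟩ := exists_linearMap_of_unitBall (func b) fun z => by
    obtain ⟨w, hw, -⟩ := key hb hF0 z
    exact ⟨w, fun j => (hw j).trans (hfunc b j z.1).symm⟩
  have hfw {z w : UnitBall ι} (h : F (opPoint hN z) = opPoint hN w) : f z.1 = w.1 := by
    obtain ⟨w', hw', h'⟩ := key ha h0 z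
    rw [opPoint_injective hN (h.symm.trans h')]
    exact lp.ext (funext fun j => (hf _ j).trans ((hfunc a j z.1).trans (hw' j).symm))
  have hgw {z w : UnitBall ι} (h : F.symm (opPoint hN z) = opPoint hN w) : g z.1 = w.1 := by
    obtain ⟨w', hw', h'⟩ := key hb hF0 z
    rw [opPoint_injective hN (h.symm.trans h')]
    exact lp.ext (funext fun j => (hg _ j).trans ((hfunc b j z.1).trans (hw' j).symm))
  have extend {p : EllTwo ι →ₗ[ℂ] EllTwo ι} (hp : ∀ z : UnitBall ι, p z.1 = z.1) (z : EllTwo ι) :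
      p z = z := by
    have hpos : 0 < ‖z‖ + 1 := by positivity
    have hC : ((‖z‖ + 1 : ℝ) : ℂ) ≠ 0 := Complex.ofReal_ne_zero.2 hpos.ne'
    have := hp ⟨((‖z‖ + 1 : ℝ) : ℂ)⁻¹ • z, mem_ball_zero_iff.2 (by
      rw [norm_smul, norm_inv, Complex.norm_real, Real.norm_of_nonneg hpos.le,
        inv_mul_lt_iff₀ hpos]
      linarith)⟩
    rw [map_smul] at this
    exact smul_right_injective _ (inv_ne_zero hC) this
  have hgf : ∀ z, g (f z) = z := extend (p := g ∘ₗ f) fun z => by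
    obtain ⟨w, -, hw⟩ := key ha h0 z
    rw [LinearMap.comp_apply, hfw hw, hgw (z := w) (w := z) (F.symm_apply_eq.2 hw.symm)]
  have hfg : ∀ z, f (g z) = z := extend (p := f ∘ₗ g) fun z => by
    obtain ⟨w, -, hw⟩ := key hb hF0 z
    rw [LinearMap.comp_apply, hgw hw, hfw (z := w) (w := z) (F.symm_apply_eq.1 hw).symm]
  set V := isometryEquivOfContractions f g hf1 hg1 hgf hfg with hV
  set U := (conjEquiv V).symm with hU
  refine ⟨U, fun X => Subtype.ext (ext_entry fun j => ?_)⟩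
  -- `U` is chosen so that row multiplication by it is the linear map `V`; the linear part of the
  -- `j`-th component is then the `j`-th column of `U`, a unit vector, against `‖a j‖ ≤ 1`.
  have hlin : linearPart ι (a j) = U (basisVec j) := by
    refine ext_inner_left ℂ fun v => ?_
    have h1 := vecMul_conjEquiv_symm V (star v)
    have h2 := vecMul_apply U (star v) j
    rw [hU, h1, inner_star_star] at h2
    rw [hU, ← h2]
    change _ = f (star v) j
    rw [hf, hfunc, star_star]
  rw [ha, entry_ballRightMul, ← ev_letterEmbedding, ← hlin, ← eq_letterEmbedding_of_norm_le]
  rw [hlin, norm_map_basisVec]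
  exact ha1 j

theorem moebius_zero_right (l : EllTwo ι) : moebius l 0 = l := by
  simp [moebius]

/-- Every free holomorphic automorphism is an involution followed by the right multiplication by a
unitary matrix. -/
theorem exists_ballRightMul_ballInvolution_eq [Nonempty ι] [Nontrivial K] (W : Fock ι ≃ₗᵢ[ℂ] K)
    {Ψ : Equiv.Perm (OpBall ι K)} (hΨ : Ψ ∈ freeAut ι K) :
    ∃ (U : EllTwo ι ≃ₗᵢ[ℂ] EllTwo ι) (l : UnitBall ι),
      Ψ = rightMulPerm K U * involutionPerm K (norm_unitBall_lt l) := by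
  obtain ⟨b, hb, -⟩ := hΨ.2.exists_ev W
  -- Take `l = Ψ⁻¹(0)`, a scalar point; the involution sends the origin to `l`, so its composition
  -- with `Ψ` fixes the origin.
  obtain ⟨l, -, hl⟩ := exists_scalarPoint_eq (Ψ.symm (scalarPoint K (unitBallZero ι))) _ fun j => by
    rw [hb, ev_scalarPoint]
  obtain ⟨w, hw, hlw⟩ := ballInvolution_scalarPoint (K := K) (norm_unitBall_lt l) (unitBallZero ι)
  have hwl : w = l := Subtype.ext (hw.trans (moebius_zero_right l.1))
  have hmem : Ψ * involutionPerm K (norm_unitBall_lt l) ∈ freeAut ι K :=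
    (freeAutGroup W).mul_mem hΨ (involutionPerm_mem (norm_unitBall_lt l))
  obtain ⟨U, hU⟩ := exists_ballRightMul_eq W hmem (by
    change Ψ (ballInvolution (norm_unitBall_lt l) _) = _
    rw [hlw, hwl, ← hl, Ψ.apply_symm_apply])
  refine ⟨U, l, Equiv.ext fun X => ?_⟩
  have := hU (ballInvolution (norm_unitBall_lt l) X)
  change Ψ (ballInvolution (norm_unitBall_lt l) (ballInvolution (norm_unitBall_lt l) X)) = _ at this
  rwa [ballInvolution_ballInvolution] at this

end Rigidity

/-! ### Cartan's theorem for the unit ball. -/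

noncomputable section BallAutomorphisms

open ContinuousLinearMap

open scoped InnerProductSpace

variable {ι : Type*}

theorem differentiableOn_moebius {l : EllTwo ι} (hl : ‖l‖ < 1) :
    DifferentiableOn ℂ (moebius l) (Metric.ball 0 1) := by
  have hne (z : EllTwo ι) (hz : z ∈ Metric.ball (0 : EllTwo ι) 1) : 1 - innerSL ℂ l z ≠ 0 := by
    intro h
    have h1 : ‖⟪l, z⟫_ℂ‖ = 1 := by
      rw [← innerSL_apply_apply, ← sub_eq_zero.1 h, norm_one]
    have h2 := norm_inner_le_norm (𝕜 := ℂ) l z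
    have h3 := mem_ball_zero_iff.1 hz
    nlinarith [norm_nonneg l, norm_nonneg z]
  have h1 : DifferentiableOn ℂ (fun z => (1 - innerSL ℂ l z)⁻¹) (Metric.ball 0 1) :=
    DifferentiableOn.inv (by fun_prop) hne
  have hQ : Differentiable ℂ fun z : EllTwo ι => (innerSL ℂ l z / ⟪l, l⟫_ℂ) • l := by
    simp only [div_eq_mul_inv]
    fun_prop
  refine h1.smul (DifferentiableOn.sub (DifferentiableOn.sub (by fun_prop) hQ.differentiableOn) ?_)
  exact ((differentiable_id.sub hQ).const_smul (√(1 - ‖l‖ ^ 2) : ℂ)).differentiableOn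

/-- The restriction to a complex line of a holomorphic self-map of the ball that fixes the origin. -/
theorem restrict_line_of_mapsTo_unitBall {g : EllTwo ι → EllTwo ι}
    (hd : DifferentiableOn ℂ g (Metric.ball 0 1))
    (hm : Set.MapsTo g (Metric.ball 0 1) (Metric.ball 0 1)) (h0 : g 0 = 0) (u : EllTwo ι)
    (hu : ‖u‖ = 1) :
    DifferentiableOn ℂ (fun ζ : ℂ => g (ζ • u)) (Metric.ball 0 1) ∧
      Set.MapsTo (fun ζ : ℂ => g (ζ • u)) (Metric.ball 0 1)
        (Metric.closedBall (g ((0 : ℂ) • u)) 1) ∧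
      deriv (fun ζ : ℂ => g (ζ • u)) 0 = fderiv ℂ g 0 u := by
  have hmaps : Set.MapsTo (fun ζ : ℂ => ζ • u) (Metric.ball 0 1) (Metric.ball 0 1) := by
    intro ζ hζ
    rw [mem_ball_zero_iff] at hζ ⊢
    rwa [norm_smul, hu, mul_one]
  refine ⟨hd.comp (by fun_prop) hmaps, fun ζ hζ => ?_, ?_⟩
  · rw [zero_smul, h0]
    exact Metric.ball_subset_closedBall (hm (hmaps hζ))
  · have h1 : HasFDerivAt g (fderiv ℂ g 0) ((0 : ℂ) • u) := by
      rw [zero_smul]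
      exact (hd.differentiableAt (Metric.ball_mem_nhds 0 one_pos)).hasFDerivAt
    have h2 : HasDerivAt (fun ζ : ℂ => ζ • u) u 0 := by
      simpa using (hasDerivAt_id (0 : ℂ)).smul_const u
    exact (h1.comp_hasDerivAt (0 : ℂ) h2).deriv

/-- A holomorphic self-map of the ball that fixes the origin has a contractive derivative there. -/
theorem norm_fderiv_apply_le {g : EllTwo ι → EllTwo ι}
    (hd : DifferentiableOn ℂ g (Metric.ball 0 1))
    (hm : Set.MapsTo g (Metric.ball 0 1) (Metric.ball 0 1)) (h0 : g 0 = 0) (z : EllTwo ι) :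
    ‖fderiv ℂ g 0 z‖ ≤ ‖z‖ := by
  rcases eq_or_ne z 0 with rfl | hz
  · simp
  have hz' : (‖z‖ : ℂ) ≠ 0 := Complex.ofReal_ne_zero.2 (norm_ne_zero_iff.2 hz)
  have hu : ‖(‖z‖ : ℂ)⁻¹ • z‖ = 1 := by
    rw [norm_smul, norm_inv, Complex.norm_real, norm_norm, inv_mul_cancel₀ (norm_ne_zero_iff.2 hz)]
  obtain ⟨h1, h2, h3⟩ := restrict_line_of_mapsTo_unitBall hd hm h0 _ hu
  have h4 := Complex.norm_deriv_le_div_of_mapsTo_ball h1 h2 one_pos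
  rw [h3, map_smul, norm_smul, norm_inv, Complex.norm_real, norm_norm, div_one,
    inv_mul_le_iff₀ (norm_pos_iff.2 hz), mul_one] at h4
  exact h4

/-- Cartan's theorem: a biholomorphic self-map of the ball that fixes the origin is unitary. -/
theorem exists_isometry_of_mem_ballAut {σ : Equiv.Perm (UnitBall ι)} (hσ : σ ∈ ballAut ι)
    (h0 : σ (unitBallZero ι) = unitBallZero ι) :
    ∃ V : EllTwo ι ≃ₗᵢ[ℂ] EllTwo ι, ∀ z, (σ z).1 = V z.1 := by
  obtain ⟨⟨g, hgd, hg⟩, ⟨g', hgd', hg'⟩⟩ := hσ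
  have hm : Set.MapsTo g (Metric.ball 0 1) (Metric.ball 0 1) := fun z hz => by
    rw [hg ⟨z, hz⟩]
    exact (σ ⟨z, hz⟩).2
  have hm' : Set.MapsTo g' (Metric.ball 0 1) (Metric.ball 0 1) := fun z hz => by
    rw [hg' ⟨z, hz⟩]
    exact (σ.symm ⟨z, hz⟩).2
  have hg0 : g 0 = 0 := (hg (unitBallZero ι)).trans congr($(h0).1)
  have hg0' : g' 0 = 0 := (hg' (unitBallZero ι)).trans
    congr($((σ.symm_apply_eq.2 h0.symm)).1)
  have hball : Metric.ball (0 : EllTwo ι) 1 ∈ nhds 0 := Metric.ball_mem_nhds 0 one_pos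
  have chain {p q : EllTwo ι → EllTwo ι} (hp : DifferentiableOn ℂ p (Metric.ball 0 1))
      (hq : DifferentiableOn ℂ q (Metric.ball 0 1)) (hp0 : p 0 = 0)
      (hqp : ∀ z ∈ Metric.ball (0 : EllTwo ι) 1, q (p z) = z) (z : EllTwo ι) :
      fderiv ℂ q 0 (fderiv ℂ p 0 z) = z := by
    have h1 : HasFDerivAt q (fderiv ℂ q 0) (p 0) := by
      rw [hp0]
      exact (hq.differentiableAt hball).hasFDerivAt
    have h2 := h1.comp (0 : EllTwo ι) (hp.differentiableAt hball).hasFDerivAt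
    have h3 : HasFDerivAt (q ∘ p) (ContinuousLinearMap.id ℂ (EllTwo ι)) 0 :=
      (hasFDerivAt_id (0 : EllTwo ι)).congr_of_eventuallyEq
        (Filter.eventually_of_mem hball hqp)
    exact congr($(h2.unique h3) z)
  have hinv1 (z : EllTwo ι) (hz : z ∈ Metric.ball (0 : EllTwo ι) 1) : g' (g z) = z := by
    rw [hg ⟨z, hz⟩, hg', σ.symm_apply_apply]
  have hinv2 (z : EllTwo ι) (hz : z ∈ Metric.ball (0 : EllTwo ι) 1) : g (g' z) = z := by
    rw [hg' ⟨z, hz⟩, hg, σ.apply_symm_apply]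
  -- By the chain rule the derivatives at the origin are mutually inverse, and by the Schwarz lemma
  -- both are contractions.
  set V := isometryEquivOfContractions (fderiv ℂ g 0).toLinearMap (fderiv ℂ g' 0).toLinearMap
    (norm_fderiv_apply_le hgd hm hg0) (norm_fderiv_apply_le hgd' hm' hg0')
    (chain hgd hgd' hg0 hinv1) (chain hgd' hgd hg0' hinv2)
  refine ⟨V, fun z => ?_⟩
  rw [← hg]
  change g z.1 = fderiv ℂ g 0 z.1
  rcases eq_or_ne z.1 0 with hz | hz
  · rw [hz, hg0, map_zero]
  have hz' : (‖z.1‖ : ℂ) ≠ 0 := Complex.ofReal_ne_zero.2 (norm_ne_zero_iff.2 hz)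
  set u : EllTwo ι := (‖z.1‖ : ℂ)⁻¹ • z.1 with hudef
  have hu : ‖u‖ = 1 := by
    rw [norm_smul, norm_inv, Complex.norm_real, norm_norm, inv_mul_cancel₀ (norm_ne_zero_iff.2 hz)]
  have hzu : z.1 = (‖z.1‖ : ℂ) • u := by rw [hudef, smul_smul, mul_inv_cancel₀ hz', one_smul]
  obtain ⟨h1, h2, h3⟩ := restrict_line_of_mapsTo_unitBall hgd hm hg0 u hu
  -- The derivative is isometric, so the Schwarz lemma on the line through `u` holds with equality
  -- and `g` is linear there.
  have h4 : ‖dslope (fun ζ : ℂ => g (ζ • u)) 0 0‖ = 1 / 1 := by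
    rw [dslope_same, h3, div_one]
    exact (V.norm_map u).trans hu
  have h5 := Complex.affine_of_mapsTo_ball_of_norm_dslope_eq_div h1 h2
    (Metric.mem_ball_self one_pos) h4
  have h6 := h5 (x := (‖z.1‖ : ℂ)) (by
    rw [mem_ball_zero_iff, Complex.norm_real, norm_norm]
    exact norm_unitBall_lt z)
  simp only [zero_smul, hg0, zero_add, sub_zero, dslope_same, h3] at h6
  rw [← hzu, ← map_smul, ← hzu] at h6
  exact h6

end BallAutomorphisms

/-! ### Boundary functions. -/

noncomputable section Boundary

open ContinuousLinearMap

open scoped InnerProductSpace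

variable {ι : Type*} {K : Type*} [NormedAddCommGroup K] [InnerProductSpace ℂ K] [CompleteSpace K]

/-- A bounded family of operators that converges at every basis vector converges strongly. -/
theorem exists_strong_limit {κ E R : Type*} [NormedAddCommGroup E] [NormedSpace ℂ E]
    [CompleteSpace E] {l : Filter R} [l.NeBot] [l.IsCountablyGenerated]
    {Y : R → EllTwo κ →L[ℂ] E} (hY : ∀ r, ‖Y r‖ ≤ 1)
    (hb : ∀ k, ∃ y, Filter.Tendsto (fun r => Y r (basisVec k)) l (nhds y)) :
    ∃ B : EllTwo κ →L[ℂ] E, ∀ x, Filter.Tendsto (fun r => Y r x) l (nhds (B x)) := by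
  choose y hy using hb
  have key (x : EllTwo κ) : ∃ b, Filter.Tendsto (fun r => Y r x) l (nhds b) := by
    refine CompleteSpace.complete (f := Filter.map (fun r => Y r x) l) ?_
    refine Metric.cauchy_iff.2 ⟨inferInstance, fun ε hε => ?_⟩
    -- Approximate `x` by a finite combination of basis vectors; the uniform bound on `Y r` costs at
    -- most the approximation error, whatever `r` is.
    obtain ⟨s, hs⟩ := ((hasSum_basisVec x).eventually
      (Metric.ball_mem_nhds x (show 0 < ε / 4 by positivity))).exists
    have hlim : Filter.Tendsto (fun r => Y r (∑ k ∈ s, x k • basisVec k)) l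
        (nhds (∑ k ∈ s, x k • y k)) := by
      simp only [map_sum, map_smul]
      exact tendsto_finsetSum _ fun k _ => (hy k).const_smul _
    refine ⟨Metric.ball (∑ k ∈ s, x k • y k) (ε / 2), ?_, fun a ha b hb => ?_⟩
    · rw [Filter.mem_map]
      filter_upwards [hlim (Metric.ball_mem_nhds _ (show 0 < ε / 4 by positivity))] with r hr
      rw [Set.mem_preimage, Metric.mem_ball] at hr ⊢
      have h1 : dist (Y r x) (Y r (∑ k ∈ s, x k • basisVec k)) ≤
          dist (∑ k ∈ s, x k • basisVec k) x := by
        rw [dist_eq_norm, ← map_sub, dist_comm, dist_eq_norm]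
        simpa using (Y r).le_of_opNorm_le (hY r) (x - ∑ k ∈ s, x k • basisVec k)
      have h2 := Metric.mem_ball.1 hs
      have h3 := dist_triangle (Y r x) (Y r (∑ k ∈ s, x k • basisVec k)) (∑ k ∈ s, x k • y k)
      linarith
    · rw [Metric.mem_ball] at ha hb
      have := dist_triangle_right a b (∑ k ∈ s, x k • y k)
      linarith
  choose b hb using key
  exact ⟨continuousLinearMapOfTendsto Y (tendsto_pi_nhds.2 hb), hb⟩

open Classical in
/-- The value at `r S` of a power series with square summable coefficients. -/
def evCreation (a : Fock ι) (r : ℝ) : Fock ι →L[ℂ] Fock ι :=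
  if hr : r ∈ Set.Ico (0 : ℝ) 1 then
    ev (shrink hr (norm_shiftRow_le (LinearIsometryEquiv.refl ℂ (Fock ι)))) a
  else 0

theorem evCreation_of_mem (a : Fock ι) {r : ℝ} (hr : r ∈ Set.Ico (0 : ℝ) 1) : evCreation a r =
    ev (shrink hr (norm_shiftRow_le (LinearIsometryEquiv.refl ℂ (Fock ι)))) a := dif_pos hr

theorem hasFreeSum_evCreation (a : Fock ι) {r : ℝ} (hr : r ∈ Set.Ico (0 : ℝ) 1) :
    HasFreeSum a (fun i => (r : ℂ) • creation i) (evCreation a r) := by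
  rw [evCreation_of_mem a hr]
  simpa only [entry_shiftRow_refl] using
    hasFreeSum_ev_shrink hr (norm_shiftRow_le (LinearIsometryEquiv.refl ℂ (Fock ι))) a

theorem hasSum_evCreation (a : Fock ι) {r : ℝ} (hr : r ∈ Set.Ico (0 : ℝ) 1) :
    HasSum (fun α => (a α * (r : ℂ) ^ α.length) • FreeMonoid.lift creation α) (evCreation a r) := by
  rw [evCreation_of_mem a hr]
  refine (hasSum_ev _ a).congr_terms fun α => ?_
  rw [lift_entry_shrink, smul_smul,
    show entry (shiftRow (LinearIsometryEquiv.refl ℂ (Fock ι))) = creation from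
      funext entry_shiftRow_refl]

theorem lift_entry_shiftRow (W : Fock ι ≃ₗᵢ[ℂ] K) (α : FreeMonoid ι) (x : Fock ι) :
    FreeMonoid.lift (entry (shiftRow W)) α (W x) = W (FreeMonoid.lift creation α x) := by
  induction α using FreeMonoid.inductionOn' generalizing x with
  | one => simp
  | of_mul i α ih =>
    rw [map_mul, mul_apply_eq_comp, ih, FreeMonoid.lift_eval_of, entry_shiftRow_apply,
      W.symm_apply_apply, map_mul, mul_apply_eq_comp, FreeMonoid.lift_eval_of]

theorem map_evCreation (W : Fock ι ≃ₗᵢ[ℂ] K) (a : Fock ι) {r : ℝ} (hr : r ∈ Set.Ico (0 : ℝ) 1)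
    (x : Fock ι) : W (evCreation a r x) = ev (shrink hr (norm_shiftRow_le W)) a (W x) := by
  have h1 := ((hasSum_evCreation a hr).mapL (ContinuousLinearMap.apply ℂ (Fock ι) x)).mapL
    (W.toContinuousLinearEquiv : Fock ι →L[ℂ] K)
  have h2 := (hasSum_ev (shrink hr (norm_shiftRow_le W)) a).mapL
    (ContinuousLinearMap.apply ℂ K (W x))
  refine h1.unique (h2.congr_terms fun α => ?_)
  change W (((a α * (r : ℂ) ^ α.length) • FreeMonoid.lift creation α) x) =
    (a α • FreeMonoid.lift (entry (shrink hr (norm_shiftRow_le W)).1) α) (W x)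
  rw [lift_entry_shrink, smul_apply, smul_apply, smul_apply, map_smul, lift_entry_shiftRow,
    smul_smul]

theorem norm_evCreation_le (W : Fock ι ≃ₗᵢ[ℂ] K) {a : Fock ι}
    (ha : ∀ X : OpBall ι K, ‖ev X a‖ ≤ 1) (r : ℝ) : ‖evCreation a r‖ ≤ 1 := by
  by_cases hr : r ∈ Set.Ico (0 : ℝ) 1
  · refine opNorm_le_bound _ zero_le_one fun x => ?_
    rw [← W.norm_map, map_evCreation W a hr, ← W.norm_map x]
    exact le_of_opNorm_le _ (ha _) _
  -- The default value `0` outside `[0, 1)` keeps the bound valid for every `r`, as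
  -- `exists_strong_limit` requires.
  · rw [evCreation, dif_neg hr, norm_zero]
    exact zero_le_one

theorem lift_creation_rightCreation (α β : FreeMonoid ι) (x : Fock ι) :
    FreeMonoid.lift creation α (rightCreation β x) =
      rightCreation β (FreeMonoid.lift creation α x) := by
  suffices FreeMonoid.lift creation α ∘L (rightCreation β).toContinuousLinearMap =
      (rightCreation β).toContinuousLinearMap ∘L FreeMonoid.lift creation α from congr($this x)
  refine ext_basisVec fun γ => ?_
  have h (δ : FreeMonoid ι) :
      FreeMonoid.lift creation α (basisVec δ : Fock ι) = basisVec (α * δ) := by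
    induction α using FreeMonoid.inductionOn' with
    | one => simp
    | of_mul i α ih =>
      rw [map_mul, mul_apply_eq_comp, ih, FreeMonoid.lift_eval_of, creation_basisVec, mul_assoc]
  simp only [comp_apply, LinearIsometry.coe_toContinuousLinearMap, rightCreation_basisVec, h,
    mul_assoc]

/-- Left and right creation operators commute. Hence `f(rS) e_β` is a right shift of `f(rS) e_1`,
and strong convergence need only be examined at `e_1`. -/
theorem evCreation_rightCreation (a : Fock ι) (r : ℝ) (β : FreeMonoid ι) (x : Fock ι) :
    evCreation a r (rightCreation β x) = rightCreation β (evCreation a r x) := by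
  by_cases hr : r ∈ Set.Ico (0 : ℝ) 1
  · have h1 := (hasSum_evCreation a hr).mapL
      (ContinuousLinearMap.apply ℂ (Fock ι) (rightCreation β x))
    have h2 := ((hasSum_evCreation a hr).mapL (ContinuousLinearMap.apply ℂ (Fock ι) x)).mapL
      (rightCreation β).toContinuousLinearMap
    refine h1.unique (h2.congr_terms fun α => ?_)
    change ((a α * (r : ℂ) ^ α.length) • FreeMonoid.lift creation α) (rightCreation β x) =
      rightCreation β (((a α * (r : ℂ) ^ α.length) • FreeMonoid.lift creation α) x)
    rw [smul_apply, smul_apply, map_smul, lift_creation_rightCreation]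
  · rw [evCreation, dif_neg hr, zero_apply, zero_apply, map_zero]

theorem evCreation_basisVec_one_apply (a : Fock ι) {r : ℝ} (hr : r ∈ Set.Ico (0 : ℝ) 1)
    (α : FreeMonoid ι) : evCreation a r (basisVec 1) α = (r : ℂ) ^ α.length * a α := by
  rw [evCreation_of_mem a hr]
  exact coeffVec_ev_shrink (W := LinearIsometryEquiv.refl ℂ (Fock ι)) hr a α

/-- Dominated convergence for `∑ (1 - r^|α|)² |a_α|²`. -/
theorem tendsto_evCreation_basisVec_one (a : Fock ι) :
    Filter.Tendsto (fun r => evCreation a r (basisVec 1)) (nhdsWithin 1 (Set.Iio 1)) (nhds a) := by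
  rw [tendsto_iff_norm_sub_tendsto_zero]
  have hsq : Filter.Tendsto (fun r => ‖evCreation a r (basisVec 1) - a‖ ^ 2)
      (nhdsWithin 1 (Set.Iio 1)) (nhds 0) := by
    have h := tendsto_tsum_of_dominated_convergence (𝓕 := nhdsWithin (1 : ℝ) (Set.Iio 1))
      (f := fun r α => ((1 - r ^ α.length) * ‖a α‖) ^ 2) (g := fun _ => (0 : ℝ)) a.summable_sq
      (fun α => by
        have : Filter.Tendsto (fun r : ℝ => ((1 - r ^ α.length) * ‖a α‖) ^ 2) (nhds 1)
            (nhds (((1 - (1 : ℝ) ^ α.length) * ‖a α‖) ^ 2)) :=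
          Continuous.tendsto (by fun_prop) 1
        simpa using this.mono_left nhdsWithin_le_nhds)
      (by
        filter_upwards [Ioo_mem_nhdsLT (zero_lt_one' ℝ)] with r hr α
        have h1 : r ^ α.length ≤ 1 := pow_le_one₀ hr.1.le hr.2.le
        have h0 : 0 ≤ r ^ α.length := pow_nonneg hr.1.le _
        rw [Real.norm_of_nonneg (by positivity)]
        have : (1 - r ^ α.length) * ‖a α‖ ≤ 1 * ‖a α‖ := by gcongr; linarith
        rw [one_mul] at this
        exact pow_le_pow_left₀ (mul_nonneg (by linarith) (norm_nonneg _)) this 2)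
    rw [tsum_zero] at h
    refine h.congr' ?_
    filter_upwards [Ioo_mem_nhdsLT (zero_lt_one' ℝ)] with r hr
    rw [EllTwo.norm_sq]
    refine tsum_congr fun α => ?_
    have h1 : r ^ α.length ≤ 1 := pow_le_one₀ hr.1.le hr.2.le
    rw [lp.coeFn_sub, Pi.sub_apply, evCreation_basisVec_one_apply a (Set.Ioo_subset_Ico_self hr),
      ← sub_one_mul, norm_mul, ← Complex.ofReal_pow, ← Complex.ofReal_one, ← Complex.ofReal_sub,
      Complex.norm_real, Real.norm_of_nonpos (by linarith), neg_sub]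
  simpa using hsq.sqrt

/-- A bounded power series has a strong limit `SOT-lim f(r S)` as `r → 1⁻`. -/
theorem exists_boundary (W : Fock ι ≃ₗᵢ[ℂ] K) {a : Fock ι}
    (ha : ∀ X : OpBall ι K, ‖ev X a‖ ≤ 1) : ∃ B : Fock ι →L[ℂ] Fock ι, ∀ x,
      Filter.Tendsto (fun r => evCreation a r x) (nhdsWithin 1 (Set.Iio 1)) (nhds (B x)) := by
  refine exists_strong_limit (norm_evCreation_le W ha) fun β => ⟨rightCreation β a, ?_⟩
  refine (((rightCreation β).continuous.tendsto a).comp (tendsto_evCreation_basisVec_one a)).congr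
    fun r => ?_
  rw [Function.comp_apply, ← evCreation_rightCreation, rightCreation_basisVec, one_mul]

theorem Represents.unique (W : Fock ι ≃ₗᵢ[ℂ] K) {a b : FreeMonoid ι → ℂ}
    {f : OpBall ι K → K →L[ℂ] K} (ha : Represents a f) (hb : Represents b f) : a = b := by
  have ht : (1 / 2 : ℝ) ∈ Set.Ico (0 : ℝ) 1 := by norm_num
  funext α
  have h1 := (ha (shrink ht (norm_shiftRow_le W))).coeffVec_apply α
  have h2 := (hb (shrink ht (norm_shiftRow_le W))).coeffVec_apply α
  exact mul_left_cancel₀ (pow_ne_zero _ (by norm_num)) (h1.symm.trans h2)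

/-- The boundary function in terms of square summable coefficients. -/
theorem isBoundaryFunction_iff (W : Fock ι ≃ₗᵢ[ℂ] K) {F : OpBall ι K → OpBall ι K}
    {a : ι → Fock ι} (ha : ∀ X j, entry (F X).1 j = ev X (a j))
    (B : ι → (Fock ι →L[ℂ] Fock ι)) : IsBoundaryFunction F B ↔ ∀ j x,
      Filter.Tendsto (fun r => evCreation (a j) r x) (nhdsWithin 1 (Set.Iio 1))
        (nhds (B j x)) := by
  have hrep (j : ι) : Represents (a j) (fun X => entry (F X).1 j) := fun X => by
    change HasFreeSum _ _ (entry (F X).1 j)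
    rw [ha]
    exact hasFreeSum_ev X (a j)
  refine forall_congr' fun j => ⟨?_, fun h => ⟨a j, evCreation (a j), hrep j,
    fun r hr0 hr1 => hasFreeSum_evCreation (a j) ⟨hr0, hr1⟩, h⟩⟩
  rintro ⟨b, Y, hb, hY, hlim⟩ x
  obtain rfl := hb.unique W (hrep j)
  refine (hlim x).congr' ?_
  filter_upwards [Ioo_mem_nhdsLT (zero_lt_one' ℝ)] with r hr
  rw [(hY r hr.1.le hr.2).unique (hasFreeSum_evCreation (a j) (Set.Ioo_subset_Ico_self hr))]

end Boundary

/-! ### The Poisson transform of a boundary function. -/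

noncomputable section Poisson

open ContinuousLinearMap

open scoped InnerProductSpace

variable {ι : Type*}

theorem norm_ncPoissonKernel {z : EllTwo ι} (hz : ‖z‖ < 1) {r : ℝ} (hr : r ∈ Set.Ico (0 : ℝ) 1) :
    ‖ncPoissonKernel z r‖ = 1 := by
  have hrz : ‖(r : ℂ) • z‖ = r * ‖z‖ := by
    rw [norm_smul, Complex.norm_real, Real.norm_of_nonneg hr.1]
  have hrz1 : ‖(r : ℂ) • z‖ < 1 := by
    rw [hrz]
    nlinarith [norm_nonneg z, hr.1, hr.2]
  have hlift (α : FreeMonoid ι) : FreeMonoid.lift (((r : ℂ) • z : EllTwo ι) : ι → ℂ) α =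
      (r : ℂ) ^ α.length * FreeMonoid.lift z α := by
    induction α using FreeMonoid.inductionOn' with
    | one => simp
    | of_mul i α ih =>
      rw [map_mul, ih]
      simp only [FreeMonoid.lift_eval_of, map_mul, FreeMonoid.length_mul, FreeMonoid.length_of,
        lp.coeFn_smul, Pi.smul_apply, smul_eq_mul]
      ring
  have hK : ncPoissonKernel z r = (√(1 - r ^ 2 * ‖z‖ ^ 2) : ℂ) • star (wordVec hrz1) := by
    ext α
    rw [ncPoissonKernel_apply hz hr.1 hr.2.le, lp.coeFn_smul, Pi.smul_apply, lp.star_apply,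
      wordVec_apply, hlift, smul_eq_mul, star_mul', star_pow, RCLike.star_def,
      Complex.conj_ofReal]
    ring
  have h1 := norm_wordVec_sq hrz1
  rw [hrz, mul_pow] at h1
  have hnn : 0 ≤ 1 - r ^ 2 * ‖z‖ ^ 2 := by
    have := mul_pow r ‖z‖ 2
    rw [hrz] at hrz1
    nlinarith [mul_nonneg hr.1 (norm_nonneg z)]
  rw [hK, norm_smul, Complex.norm_real, Real.norm_of_nonneg (Real.sqrt_nonneg _), norm_star,
    ← sq_eq_sq₀ (by positivity) zero_le_one, mul_pow, Real.sq_sqrt hnn, h1, one_pow]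

/-- This is the eigenvector property `S_i* K_{z,r} = r conj(z_i) K_{z,r}`, which turns words in the
creation operators into scalar monomials. -/
theorem inner_ncPoissonKernel_creation {z : EllTwo ι} (hz : ‖z‖ < 1) {r : ℝ}
    (hr : r ∈ Set.Ico (0 : ℝ) 1) (i : ι) (x : Fock ι) :
    ⟪ncPoissonKernel z r, creation i x⟫_ℂ = (r * z i) * ⟪ncPoissonKernel z r, x⟫_ℂ := by
  suffices innerSL ℂ (ncPoissonKernel z r) ∘L creation i =
      (r * z i : ℂ) • innerSL ℂ (ncPoissonKernel z r) from congr($this x)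
  refine ext_basisVec fun α => ?_
  rw [comp_apply, smul_apply, creation_basisVec, innerSL_apply_apply, innerSL_apply_apply,
    ← inner_conj_symm, inner_basisVec_left, ← inner_conj_symm _ (basisVec α), inner_basisVec_left,
    ncPoissonKernel_apply hz hr.1 hr.2.le, ncPoissonKernel_apply hz hr.1 hr.2.le]
  simp only [map_mul, map_pow, Complex.conj_ofReal, Complex.conj_conj, FreeMonoid.length_mul,
    FreeMonoid.length_of, FreeMonoid.lift_eval_of, smul_eq_mul]
  ring

theorem inner_ncPoissonKernel_lift_creation {z : EllTwo ι} (hz : ‖z‖ < 1) {r : ℝ}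
    (hr : r ∈ Set.Ico (0 : ℝ) 1) (α : FreeMonoid ι) (x : Fock ι) :
    ⟪ncPoissonKernel z r, FreeMonoid.lift creation α x⟫_ℂ =
      (r ^ α.length * FreeMonoid.lift (z : ι → ℂ) α) * ⟪ncPoissonKernel z r, x⟫_ℂ := by
  induction α using FreeMonoid.inductionOn' with
  | one => simp
  | of_mul i α ih =>
    rw [map_mul, mul_apply_eq_comp, FreeMonoid.lift_eval_of, inner_ncPoissonKernel_creation hz hr,
      ih, map_mul, FreeMonoid.lift_eval_of, FreeMonoid.length_mul, FreeMonoid.length_of]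
    ring

/-- The scalar power series `∑_α a_α t^|α| z_α` as a function of the dilation parameter. -/
def radialSeries (a : Fock ι) (z : EllTwo ι) (t : ℝ) : ℂ :=
  ∑' α : FreeMonoid ι, (a α * FreeMonoid.lift (z : ι → ℂ) α) * (t : ℂ) ^ α.length

theorem continuousOn_radialSeries (a : Fock ι) {z : EllTwo ι} (hz : ‖z‖ < 1) :
    ContinuousOn (radialSeries a z) (Set.Icc 0 1) := by
  refine continuousOn_tsum (fun α => by fun_prop) (hasSum_mul_wordVec hz a).summable.norm
    fun α t ht => ?_
  rw [norm_mul _ ((t : ℂ) ^ α.length), norm_pow, Complex.norm_real, Real.norm_of_nonneg ht.1]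
  exact mul_le_of_le_one_right (norm_nonneg _) (pow_le_one₀ ht.1 ht.2)

theorem radialSeries_one (a : Fock ι) {z : EllTwo ι} (hz : ‖z‖ < 1) :
    radialSeries a z 1 = ⟪star a, wordVec hz⟫_ℂ := by
  rw [← (hasSum_mul_wordVec hz a).tsum_eq, radialSeries]
  simp

theorem inner_ncPoissonKernel_evCreation {z : EllTwo ι} (hz : ‖z‖ < 1) {r s : ℝ}
    (hr : r ∈ Set.Ico (0 : ℝ) 1) (hs : s ∈ Set.Ico (0 : ℝ) 1) (a : Fock ι) :
    ⟪ncPoissonKernel z r, evCreation a s (ncPoissonKernel z r)⟫_ℂ = radialSeries a z (s * r) := by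
  have h := ((hasSum_evCreation a hs).mapL
    (ContinuousLinearMap.apply ℂ (Fock ι) (ncPoissonKernel z r))).mapL
      (innerSL ℂ (ncPoissonKernel z r))
  refine Eq.trans h.tsum_eq.symm (tsum_congr fun α => ?_)
  change ⟪ncPoissonKernel z r, ((a α * (s : ℂ) ^ α.length) • FreeMonoid.lift creation α)
    (ncPoissonKernel z r)⟫_ℂ = _
  rw [smul_apply, inner_smul_right, inner_ncPoissonKernel_lift_creation hz hr,
    inner_self_eq_norm_sq_to_K, norm_ncPoissonKernel hz hr]
  push_cast
  rw [mul_pow]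
  simp
  ring

/-- For fixed `r`, letting `s → 1⁻` in `⟪K, f(sS) K⟫ = ∑ a_α (sr)^|α| z_α` gives the value for the
boundary operator. Then `r → 1⁻` uses continuity of the series up to the endpoint, where `∑ a_α z_α`
converges absolutely. -/
theorem hasPoissonTransform_of_tendsto {z : EllTwo ι} (hz : ‖z‖ < 1) {a : Fock ι}
    {B : Fock ι →L[ℂ] Fock ι} (hB : ∀ x, Filter.Tendsto (fun s => evCreation a s x)
      (nhdsWithin 1 (Set.Iio 1)) (nhds (B x))) :
    HasPoissonTransform z B ⟪star a, wordVec hz⟫_ℂ := by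
  have key {r : ℝ} (hr : r ∈ Set.Ioo (0 : ℝ) 1) :
      ⟪ncPoissonKernel z r, B (ncPoissonKernel z r)⟫_ℂ = radialSeries a z r := by
    have h1 := ((innerSL ℂ (ncPoissonKernel z r)).continuous.tendsto _).comp (hB (ncPoissonKernel z r))
    refine tendsto_nhds_unique h1 ?_
    have h2 : ContinuousAt (radialSeries a z) (1 * r) := by
      rw [one_mul]
      exact (continuousOn_radialSeries a hz).continuousAt (Icc_mem_nhds hr.1 hr.2)
    have h3 : Filter.Tendsto (fun s : ℝ => s * r) (nhdsWithin 1 (Set.Iio 1)) (nhds (1 * r)) :=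
      (Continuous.tendsto (by fun_prop) 1).mono_left nhdsWithin_le_nhds
    have h4 := h2.tendsto.comp h3
    rw [one_mul] at h4
    refine h4.congr' ?_
    filter_upwards [Ioo_mem_nhdsLT (zero_lt_one' ℝ)] with s hs
    exact (inner_ncPoissonKernel_evCreation hz (Set.Ioo_subset_Ico_self hr)
      (Set.Ioo_subset_Ico_self hs) a).symm
  have h := (continuousOn_radialSeries a hz 1 (Set.right_mem_Icc.2 zero_le_one)).mono_left
    (nhdsWithin_le_of_mem (s := Set.Icc (0 : ℝ) 1) (t := Set.Iio 1)
      (Filter.mem_of_superset (Ioo_mem_nhdsLT (zero_lt_one' ℝ)) Set.Ioo_subset_Icc_self))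
  rw [radialSeries_one a hz] at h
  refine Filter.Tendsto.congr' ?_ h
  filter_upwards [Ioo_mem_nhdsLT (zero_lt_one' ℝ)] with r hr
  exact (key hr).symm

end Poisson

/-! ### The isomorphism. -/

noncomputable section Main

open ContinuousLinearMap

open scoped InnerProductSpace

variable {ι : Type*} {K : Type*} [NormedAddCommGroup K] [InnerProductSpace ℂ K] [CompleteSpace K]

theorem exists_scalarPoint_map [Nontrivial K] (W : Fock ι ≃ₗᵢ[ℂ] K)
    {F : OpBall ι K → OpBall ι K} (hF : IsFreeHolomorphic F) (z : UnitBall ι) :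
    ∃ w : UnitBall ι, F (scalarPoint K z) = scalarPoint K w := by
  obtain ⟨a, ha, -⟩ := hF.exists_ev W
  obtain ⟨w, -, h⟩ := exists_scalarPoint_eq (F (scalarPoint K z)) _ fun j => by
    rw [ha, ev_scalarPoint]
  exact ⟨w, h⟩

/-- The restriction of a free holomorphic automorphism to the scalar points. -/
def scalarPerm [Nontrivial K] (W : Fock ι ≃ₗᵢ[ℂ] K) (Ψ : freeAutGroup W) :
    Equiv.Perm (UnitBall ι) where
  toFun := fun z => (exists_scalarPoint_map W Ψ.2.1 z).choose
  invFun := fun z => (exists_scalarPoint_map W Ψ.2.2 z).choose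
  left_inv := fun z => scalarPoint_injective (K := K) <| by
    rw [← (exists_scalarPoint_map W Ψ.2.2 _).choose_spec,
      ← (exists_scalarPoint_map W Ψ.2.1 z).choose_spec, Ψ.1.symm_apply_apply]
  right_inv := fun z => scalarPoint_injective (K := K) <| by
    rw [← (exists_scalarPoint_map W Ψ.2.1 _).choose_spec,
      ← (exists_scalarPoint_map W Ψ.2.2 z).choose_spec, Ψ.1.apply_symm_apply]

theorem scalarPoint_scalarPerm [Nontrivial K] (W : Fock ι ≃ₗᵢ[ℂ] K) (Ψ : freeAutGroup W)
    (z : UnitBall ι) : scalarPoint K (scalarPerm W Ψ z) = Ψ.1 (scalarPoint K z) :=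
  (exists_scalarPoint_map W Ψ.2.1 z).choose_spec.symm

/-- The restriction to the scalar points as a group homomorphism. -/
def scalarPermHom [Nontrivial K] (W : Fock ι ≃ₗᵢ[ℂ] K) :
    freeAutGroup W →* Equiv.Perm (UnitBall ι) where
  toFun := scalarPerm W
  map_one' := Equiv.ext fun z => scalarPoint_injective (K := K) <| by
    rw [scalarPoint_scalarPerm]
    rfl
  map_mul' := fun Ψ Φ => Equiv.ext fun z => scalarPoint_injective (K := K) <| by
    rw [Equiv.Perm.mul_apply, scalarPoint_scalarPerm, scalarPoint_scalarPerm,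
      scalarPoint_scalarPerm]
    rfl

theorem scalarPerm_rightMul_mul_involution [Nontrivial K] (W : Fock ι ≃ₗᵢ[ℂ] K)
    (Ψ : freeAutGroup W) (U : EllTwo ι ≃ₗᵢ[ℂ] EllTwo ι) (l : UnitBall ι)
    (hΨ : Ψ.1 = rightMulPerm K U * involutionPerm K (norm_unitBall_lt l)) (z : UnitBall ι) :
    (scalarPerm W Ψ z).1 = vecMul U (moebius l.1 z.1) := by
  obtain ⟨w, hw, h⟩ := ballInvolution_scalarPoint (K := K) (norm_unitBall_lt l) z
  have hv : vecMul U w.1 ∈ Metric.ball (0 : EllTwo ι) 1 := by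
    rw [mem_ball_zero_iff, norm_vecMul]
    exact norm_unitBall_lt w
  have h1 : scalarPoint K (scalarPerm W Ψ z) = scalarPoint K ⟨vecMul U w.1, hv⟩ := by
    rw [scalarPoint_scalarPerm, hΨ, ← ballRightMul_scalarPoint U w ⟨vecMul U w.1, hv⟩ rfl, ← h]
    rfl
  rw [scalarPoint_injective h1, ← hw]

/-- Holomorphy is read off the factorization `Φ_U ∘ Ψ_λ`, whose restriction is explicit. -/
theorem isHolomorphicSelfMap_scalarPerm [Nonempty ι] [Nontrivial K] (W : Fock ι ≃ₗᵢ[ℂ] K)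
    (Ψ : freeAutGroup W) : IsHolomorphicSelfMap (scalarPerm W Ψ) := by
  obtain ⟨U, l, h⟩ := exists_ballRightMul_ballInvolution_eq W Ψ.2
  refine ⟨fun z => vecMul U (moebius l.1 z), ?_, fun z =>
    (scalarPerm_rightMul_mul_involution W Ψ U l h z).symm⟩
  exact (conjEquiv U.symm).differentiable.comp_differentiableOn
    (differentiableOn_moebius (norm_unitBall_lt l))

theorem scalarPerm_mem_ballAut [Nonempty ι] [Nontrivial K] (W : Fock ι ≃ₗᵢ[ℂ] K)
    (Ψ : freeAutGroup W) : scalarPermHom W Ψ ∈ ballAut ι := by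
  refine ⟨isHolomorphicSelfMap_scalarPerm W Ψ, ?_⟩
  have := isHolomorphicSelfMap_scalarPerm W Ψ⁻¹
  change IsHolomorphicSelfMap (scalarPermHom W Ψ⁻¹) at this
  rwa [map_inv] at this

/-- The homomorphism from free holomorphic automorphisms to automorphisms of the ball. -/
def ballAutHom [Nonempty ι] [Nontrivial K] (W : Fock ι ≃ₗᵢ[ℂ] K) : freeAutGroup W →* ballAut ι :=
  (scalarPermHom W).codRestrict (ballAut ι) (scalarPerm_mem_ballAut W)

/-- An element of the kernel fixes the origin, so it is a right multiplication by a unitary `U`;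
fixing all scalar points forces `U = 1`. -/
theorem ballAutHom_injective [Nonempty ι] [Nontrivial K] (W : Fock ι ≃ₗᵢ[ℂ] K) :
    Function.Injective (ballAutHom W) := by
  rw [injective_iff_map_eq_one]
  intro Ψ hΨ
  have h1 (z : UnitBall ι) : scalarPerm W Ψ z = z := congr($(congrArg Subtype.val hΨ) z)
  have h2 (z : UnitBall ι) : Ψ.1 (scalarPoint K z) = scalarPoint K z := by
    rw [← scalarPoint_scalarPerm, h1]
  obtain ⟨U, hU⟩ := exists_ballRightMul_eq W Ψ.2 (h2 _)
  have hw (z : UnitBall ι) : vecMul U z.1 = z.1 := by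
    have hv : vecMul U z.1 ∈ Metric.ball (0 : EllTwo ι) 1 := by
      rw [mem_ball_zero_iff, norm_vecMul]
      exact norm_unitBall_lt z
    have h3 := h2 z
    rw [hU, ballRightMul_scalarPoint U z ⟨vecMul U z.1, hv⟩ rfl] at h3
    exact congr($(scalarPoint_injective h3).1)
  have hUi (i : ι) : U (basisVec i) = basisVec i := by
    have hb : (2 : ℂ)⁻¹ • star (basisVec i) ∈ Metric.ball (0 : EllTwo ι) 1 := by
      rw [mem_ball_zero_iff, norm_smul, norm_star, norm_basisVec]
      norm_num
    have h3 := hw ⟨_, hb⟩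
    rw [vecMul_eq_conjEquiv, map_smul] at h3
    have h4 := smul_right_injective _ (inv_ne_zero (two_ne_zero' ℂ)) h3
    rw [conjEquiv_apply, star_star, star_inj, U.symm_apply_eq] at h4
    exact h4.symm
  refine Subtype.ext (Equiv.ext fun X => ?_)
  rw [hU]
  refine Subtype.ext (ext_entry fun j => ?_)
  rw [entry_ballRightMul, hUi, column_basisVec]
  rfl

/-- With `l = σ⁻¹(0)`, the map `σ ∘ φ_l` fixes the origin, so by Cartan's theorem it is unitary and
comes from a right multiplication; `φ_l` comes from `Ψ_l`. -/
theorem ballAutHom_surjective [Nonempty ι] [Nontrivial K] (W : Fock ι ≃ₗᵢ[ℂ] K) :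
    Function.Surjective (ballAutHom W) := by
  intro σ
  set l : UnitBall ι := σ.1.symm (unitBallZero ι) with hl
  let Λ : freeAutGroup W := ⟨involutionPerm K (norm_unitBall_lt l), involutionPerm_mem _⟩
  have hΛ : scalarPerm W Λ (unitBallZero ι) = l := by
    obtain ⟨w, hw, h⟩ := ballInvolution_scalarPoint (K := K) (norm_unitBall_lt l) (unitBallZero ι)
    refine scalarPoint_injective (K := K) ?_
    rw [scalarPoint_scalarPerm, ← Subtype.ext (hw.trans (moebius_zero_right l.1)), ← h]
    rfl
  have h0 : (σ * ballAutHom W Λ).1 (unitBallZero ι) = unitBallZero ι := by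
    change σ.1 (scalarPerm W Λ (unitBallZero ι)) = _
    rw [hΛ, hl, Equiv.apply_symm_apply]
  obtain ⟨V, hV⟩ := exists_isometry_of_mem_ballAut (σ * ballAutHom W Λ).2 h0
  let Θ : freeAutGroup W := ⟨rightMulPerm K (conjEquiv V).symm, rightMulPerm_mem _⟩
  have hΘ : ballAutHom W Θ = σ * ballAutHom W Λ := by
    refine Subtype.ext (Equiv.ext fun z => scalarPoint_injective (K := K) ?_)
    change scalarPoint K (scalarPerm W Θ z) = _
    rw [scalarPoint_scalarPerm]
    exact ballRightMul_scalarPoint _ z _ ((hV z).trans (vecMul_conjEquiv_symm V z.1).symm)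
  exact ⟨Θ * Λ⁻¹, by rw [map_mul, hΘ, map_inv, mul_inv_cancel_right]⟩

end Main

theorem mainTheorem2 {ι : Type*} [Countable ι] [Nonempty ι]
    {H : Type*} [NormedAddCommGroup H] [InnerProductSpace ℂ H] [CompleteSpace H]
    [TopologicalSpace.SeparableSpace H] (hH : ¬ FiniteDimensional ℂ H) :
    ∃ G : Subgroup (Equiv.Perm (OpBall ι H)), (G : Set (Equiv.Perm (OpBall ι H))) = freeAut ι H ∧
      (∀ Ψ ∈ G, ∃! B : ι → (Fock ι →L[ℂ] Fock ι), IsBoundaryFunction Ψ B) ∧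
      ∃ Γ : G ≃* ballAut ι,
        (∀ (Ψ : G) (B : ι → (Fock ι →L[ℂ] Fock ι)), IsBoundaryFunction Ψ.1 B →
          ∀ (z : UnitBall ι) (j : ι), HasPoissonTransform z.1 (B j) (((Γ Ψ).1 z).1 j)) ∧
        ∀ (U : EllTwo ι ≃ₗᵢ[ℂ] EllTwo ι) (l : UnitBall ι), ∃ Ψ : G,
          (∀ X : OpBall ι H, IsRightMul U (involution l.1 X.1) (Ψ.1 X).1) ∧
          ∀ (z : UnitBall ι) (j : ι),
            HasSum (fun i => matEntry U i j * moebius l.1 z.1 i) (((Γ Ψ).1 z).1 j) := by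
  obtain ⟨W⟩ := exists_fock_equiv ι hH
  have : Nontrivial H := by
    by_contra h
    rw [not_nontrivial_iff_subsingleton] at h
    exact hH inferInstance
  refine ⟨freeAutGroup W, rfl, fun Ψ hΨ => ?_,
    MulEquiv.ofBijective (ballAutHom W) ⟨ballAutHom_injective W, ballAutHom_surjective W⟩,
    fun Ψ B hB z j => ?_, fun U l => ?_⟩
  · obtain ⟨a, ha, -⟩ := hΨ.1.exists_ev W
    have hbd (j : ι) (X : OpBall ι H) : ‖ev X (a j)‖ ≤ 1 := by
      rw [← ha]
      exact norm_entry_opBall_le _ j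
    choose B hB using fun j => exists_boundary W (hbd j)
    refine ⟨B, (isBoundaryFunction_iff W ha B).2 hB, fun B' hB' => ?_⟩
    replace hB' := (isBoundaryFunction_iff W ha B').1 hB'
    exact funext fun j => ContinuousLinearMap.ext fun x => tendsto_nhds_unique (hB' j x) (hB j x)
  · obtain ⟨a, ha, -⟩ := Ψ.2.1.exists_ev W
    rw [isBoundaryFunction_iff W ha] at hB
    -- Comparing the two expressions for the `j`-th entry at a scalar point identifies the
    -- coordinate of `Γ(Ψ)(z)` with `∑ a_α z_α`, the value of the Poisson transform.
    have h := ha (scalarPoint H z) j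
    rw [ev_scalarPoint, ← scalarPoint_scalarPerm] at h
    have h' : (scalarPerm W Ψ z).1 j = inner ℂ (star (a j)) (wordVec (norm_unitBall_lt z)) :=
      smul_left_injective ℂ (one_ne_zero (α := H →L[ℂ] H)) ((entry_scalarRow _ j).symm.trans h)
    change HasPoissonTransform z.1 (B j) ((scalarPerm W Ψ z).1 j)
    rw [h']
    exact hasPoissonTransform_of_tendsto (norm_unitBall_lt z) (hB j)
  · refine ⟨⟨rightMulPerm H U * involutionPerm H (norm_unitBall_lt l),
      (freeAutGroup W).mul_mem (rightMulPerm_mem U) (involutionPerm_mem _)⟩,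
      fun X => isRightMul_ballRightMul U (ballInvolution (norm_unitBall_lt l) X), fun z j => ?_⟩
    change HasSum _ ((scalarPerm W _ z).1 j)
    rw [scalarPerm_rightMul_mul_involution W _ U l rfl z]
    exact hasSum_vecMul U (moebius l.1 z.1) j
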